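/- Setting. For every sample size $n$ let $(y,\boldsymbol x)\sim P=P_n$ with $y\in\mathbb R$, $\boldsymbol x=(\boldsymbol z,\boldsymbol u)$, $\boldsymbol z\in\mathbb R^{d}$, $\boldsymbol u\in\mathbb R^{p-d}$, where $p=p_n\to\infty$ and $d=d_n\le p_n$ may diverge. Given $\boldsymbol x$, $y$ has density $\exp\{(y\,\boldsymbol\beta_0^\top\boldsymbol x-b(\boldsymbol\beta_0^\top\boldsymbol x))/c\}$ with respect to a fixed measure $\nu$ on $\mathbb R$, where $\boldsymbol\beta_0=(\boldsymbol\theta_0,\boldsymbol\gamma_0)$, $c>0$ and $\int e^{(yt-b(t))/c}\,\nu(dy)=1$ for all $t\in\mathbb R$; $b,c,\nu$ do not depend on $n$. Put $\mathbf H=\mathbb E[b''(\boldsymbol\beta_0^\top\boldsymbol x)\boldsymbol x\boldsymbol x^\top]$, $\mathbf w_0=\mathbb E[b''(\boldsymbol\beta_0^\top\boldsymbol x)\boldsymbol z\boldsymbol u^\top](\mathbb E[b''(\boldsymbol\beta_0^\top\boldsymbol x)\boldsymbol u\boldsymbol u^\top])^{-1}$, $\boldsymbol\Phi=\mathbb E[b''(\boldsymbol\beta_0^\top\boldsymbol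 x)(\boldsymbol z-\mathbf w_0\boldsymbol u)\boldsymbol z^\top]$; let $s_1$ be the number of nonzero entries of $\boldsymbol\beta_0$ and $s_2$ the number of nonzero columns of $\mathbf w_0$, not both $0$. $\|\cdot\|_\infty$ is the maximal modulus of the entries of a vector or matrix. Data and estimators. $(y_i,\boldsymbol x_i)_{i\le n}$ are i.i.d. from $P$; independently, $\delta_1,\dots,\delta_n$ are i.i.d. Bernoulli$(r_{\mathrm p}/n)$ with $0<r_{\mathrm p}=r_{\mathrm p,n}\le n$, and $\mathcal K_{\mathrm p}=\{i:\delta_i=1\}$. Let $$\hat{\boldsymbol\beta}_{\mathrm p}=(\hat{\boldsymbol\theta}_{\mathrm p},\hat{\boldsymbol\gamma}_{\mathrm p})\in\arg\min_{\boldsymbol\beta}\Big\{\tfrac1{r_{\mathrm p}}\sum_{i\in\mathcal K_{\mathrm p}}\big(b(\boldsymbol\beta^\top\boldsymbol x_i)-y_i\boldsymbol\beta^\top\boldsymbol x_i\big)+\lambda\|\boldsymbol\beta\|_1\Big\},$$ $$\hat{\mathbf w}_{\mathrm p}\in\arg\min_{\mathbf w\in\mathbb R^{d\times(p-d)}}\Big\{\tfrac1{r_{\mathrm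 p}}\sum_{i\in\mathcal K_{\mathrm p}}b''(\hat{\boldsymbol\beta}_{\mathrm p}^\top\boldsymbol x_i)\|\boldsymbol z_i-\mathbf w\boldsymbol u_i\|_2^2+\tau\sum_{k,j}|w_{kj}|\Big\},$$ $\check{\boldsymbol\Phi}_{\mathrm p}=\frac1{r_{\mathrm p}}\sum_{i\in\mathcal K_{\mathrm p}}b''(\hat{\boldsymbol\beta}_{\mathrm p}^\top\boldsymbol x_i)(\boldsymbol z_i-\hat{\mathbf w}_{\mathrm p}\boldsymbol u_i)(\boldsymbol z_i-\hat{\mathbf w}_{\mathrm p}\boldsymbol u_i)^\top$, and let $\hat{\mathbf G}$ minimise $\sum_{k,l}|G_{kl}|$ over $\{\mathbf G\in\mathbb R^{d\times d}:\|\mathbf G\check{\boldsymbol\Phi}_{\mathrm p}-\mathbf I\|_\infty\le\gamma_n\}$ (any choice is allowed where a minimiser is not unique or does not exist); also let $\tilde{\mathbf G}$ be its symmetrization, $\tilde g_{kl}=\hat g_{kl}$ if $|\hat g_{kl}|\le|\hat g_{lk}|$ and $\tilde g_{kl}=\hat g_{lk}$ otherwise. With $S(\boldsymbol\theta,\boldsymbol\gamma,\mathbf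 w)=\frac1n\sum_{i=1}^n(b'(\boldsymbol\theta^\top\boldsymbol z_i+\boldsymbol\gamma^\top\boldsymbol u_i)-y_i)(\boldsymbol z_i-\mathbf w\boldsymbol u_i)$, put $$\check{\boldsymbol\theta}=\hat{\boldsymbol\theta}_{\mathrm p}-\mathbf G\,S(\hat{\boldsymbol\theta}_{\mathrm p},\hat{\boldsymbol\gamma}_{\mathrm p},\hat{\mathbf w}_{\mathrm p}),\qquad \mathbf G=\hat{\mathbf G}\ \text{or}\ \mathbf G=\tilde{\mathbf G}.$$ Theorem. Let $C_1,\kappa>0$ and $C_2,C,R_1,R_2,C_g$ be constants such that the following holds for all large $n$: the eigenvalues of $\mathbf H$ lie in $[C_1,C_2]$; almost surely $\|\boldsymbol x\|_\infty\le C$, $\|\mathbf w_0\boldsymbol u\|_\infty\le C$ and $\boldsymbol\beta_0^\top\boldsymbol x\in[R_1,R_2]$; the sub-exponential norm satisfies $\|y-b'(\boldsymbol\beta_0^\top\boldsymbol x)\|_{\psi_1}=\inf\{t>0:\mathbb E e^{|y-b'(\boldsymbol\beta_0^\top\boldsymbol x)|/t}\le2\}\le C$; the singular values of $\boldsymbol\Phi$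 are at least $\kappa$; every row of $\boldsymbol\Phi^{-1}$ has fewer than $C_g$ nonzero entries. Let $b$ be three times differentiable and such that for some $\varepsilon,C'>0$, every $t\in[R_1-\varepsilon,R_2+\varepsilon]$ and all $t_1$ close enough to $t$: $0<b''(t)\le C'$, $|b'''(t)|\le C'$, $|b''(t_1)-b''(t)|\le C'|t_1-t|b''(t)$, $|b'''(t_1)-b'''(t)|\le C'|t_1-t|$. Suppose $(s_1\vee s_2)\sqrt{\log p/n}\to0$ and $(s_1\vee s_2)\sqrt{\log p/r_{\mathrm p}}\to0$. Let $\lambda\asymp\sqrt{\log p/r_{\mathrm p}}$, $\tau\asymp\sqrt{\log p/r_{\mathrm p}}$ and $\gamma_n\asymp(s_1\vee\sqrt{s_2})\sqrt{\log p/r_{\mathrm p}}$, where the lower constants of proportionality are large enough: for $\lambda,\tau$ depending only on the fixed model quantities $b,c,\nu,C_1,C_2,C,R_1,R_2,\kappa,C_g$, and for $\gamma_n$ on these and on the upper constants for $\lambda,\tau$. Then $$\big\|\sqrt n\{(\check{\boldsymbol\theta}-\boldsymbol\theta_0)+\boldsymbol\Phi^{-1}S(\boldsymbol\theta_0,\boldsymbol\gamma_0,\mathbf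 w_0)\}\big\|_\infty=O_P\Big(n^{1/2}s_1(s_1\vee\sqrt{s_2})\frac{\log p}{r_{\mathrm p}}+\frac{s_2\log p}{r_{\mathrm p}^{1/2}}\Big).$$ -/

import Mathlib

open MeasureTheory ProbabilityTheory Filter
open scoped Matrix ENNReal Topology

noncomputable section

namespace SubsampledGLM

/-- An observation `(y, x)` with `x = (z, u)`: the first `d` covariates `z` carry the target
parameter `θ`, the last `m` covariates `u` carry the nuisance parameter `γ`; thus `p = d + m`. -/
abbrev Obs (d m : ℕ) : Type := ℝ × (Fin d ⊕ Fin m → ℝ)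

/-- A regression parameter `β = (θ, γ)`. -/
abbrev Param (d m : ℕ) : Type := Fin d ⊕ Fin m → ℝ

/-- The target part `z` of a covariate vector (or `θ` of a parameter vector). -/
def target {d m : ℕ} (x : Fin d ⊕ Fin m → ℝ) : Fin d → ℝ := fun k => x (Sum.inl k)

/-- The nuisance part `u` of a covariate vector (or `γ` of a parameter vector). -/
def nuisance {d m : ℕ} (x : Fin d ⊕ Fin m → ℝ) : Fin m → ℝ := fun j => x (Sum.inr j)

/-- `z - w u`. -/
def decorrelated {d m : ℕ} (w : Matrix (Fin d) (Fin m) ℝ) (x : Fin d ⊕ Fin m → ℝ) : Fin d → ℝ :=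
  target x - w *ᵥ nuisance x

/-! ### The model -/

/-- `b` is the cumulant function, with dispersion `c`, of the one-parameter exponential family of
densities `y ↦ exp ((y t - b t) / c)`, `t ∈ ℝ`, with respect to `ν`. -/
def IsCumulantFunction (b : ℝ → ℝ) (c : ℝ) (ν : Measure ℝ) : Prop :=
  ∀ t : ℝ, ∫⁻ y, ENNReal.ofReal (Real.exp ((y * t - b t) / c)) ∂ν = 1

/-- Under the joint law `P` of `(y, x)`, the conditional density of `y` given `x`, with respect to
`ν`, is `exp ((y (β₀ᵀ x) - b (β₀ᵀ x)) / c)`. -/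
def IsCanonicalGLM {d m : ℕ} (b : ℝ → ℝ) (c : ℝ) (ν : Measure ℝ) (β₀ : Param d m)
    (P : Measure (Obs d m)) : Prop :=
  P = (ν.prod (P.map Prod.snd)).withDensity
    (fun o => ENNReal.ofReal (Real.exp ((o.1 * (β₀ ⬝ᵥ o.2) - b (β₀ ⬝ᵥ o.2)) / c)))

/-- The population Hessian `E[b''(β₀ᵀ x) x xᵀ]`. -/
def hessian {d m : ℕ} (b : ℝ → ℝ) (β₀ : Param d m) (P : Measure (Obs d m)) :
    Matrix (Fin d ⊕ Fin m) (Fin d ⊕ Fin m) ℝ :=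
  fun i j => ∫ o, iteratedDeriv 2 b (β₀ ⬝ᵥ o.2) * (o.2 i * o.2 j) ∂P

/-- `w₀ = E[b''(β₀ᵀ x) z uᵀ] (E[b''(β₀ᵀ x) u uᵀ])⁻¹`. -/
def projection {d m : ℕ} (b : ℝ → ℝ) (β₀ : Param d m) (P : Measure (Obs d m)) :
    Matrix (Fin d) (Fin m) ℝ :=
  (hessian b β₀ P).toBlocks₁₂ * ((hessian b β₀ P).toBlocks₂₂)⁻¹

/-- `Φ = E[b''(β₀ᵀ x) (z - w₀ u) zᵀ]`. -/
def information {d m : ℕ} (b : ℝ → ℝ) (β₀ : Param d m) (P : Measure (Obs d m)) :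
    Matrix (Fin d) (Fin d) ℝ :=
  fun k l => ∫ o, iteratedDeriv 2 b (β₀ ⬝ᵥ o.2) *
    (decorrelated (projection b β₀ P) o.2 k * target o.2 l) ∂P

/-- `s₁`: the size of the support of `β₀`. -/
def supportSize {d m : ℕ} (β : Param d m) : ℕ := {j | β j ≠ 0}.ncard

/-- `s₂`: the number of nonzero columns of `w₀`. -/
def columnSupportSize {d m : ℕ} (w : Matrix (Fin d) (Fin m) ℝ) : ℕ :=
  {j | (fun k => w k j) ≠ 0}.ncard

/-- The sub-exponential norm `inf {t > 0 : E exp (|Y| / t) ≤ 2}` (`∞` if there is no such `t`). -/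
def psiOneNorm {α : Type*} [MeasurableSpace α] (P : Measure α) (Y : α → ℝ) : ℝ≥0∞ :=
  ⨅ (t : ℝ) (_ : 0 < t) (_ : ∫⁻ a, ENNReal.ofReal (Real.exp (|Y a| / t)) ∂P ≤ 2), ENNReal.ofReal t

/-! ### The regularity conditions -/

/-- Smoothness of `b` near the range `[R₁, R₂]` of the linear predictor. -/
def LinkRegularity (b : ℝ → ℝ) (R₁ R₂ : ℝ) : Prop :=
  (∀ k < 3, Differentiable ℝ (iteratedDeriv k b)) ∧
  ∃ ε > 0, ∃ C : ℝ, ∀ t ∈ Set.Icc (R₁ - ε) (R₂ + ε),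
    0 < iteratedDeriv 2 b t ∧ iteratedDeriv 2 b t ≤ C ∧ |iteratedDeriv 3 b t| ≤ C ∧
    ∀ᶠ t₁ in 𝓝 t,
      |iteratedDeriv 2 b t₁ - iteratedDeriv 2 b t| ≤ C * |t₁ - t| * iteratedDeriv 2 b t ∧
      |iteratedDeriv 3 b t₁ - iteratedDeriv 3 b t| ≤ C * |t₁ - t|

/-- The population conditions on `(β₀, P)`, with constants `C₁, C₂, C, R₁, R₂, κ, Cg`. -/
structure PopulationConditions {d m : ℕ} (b : ℝ → ℝ) (C₁ C₂ C R₁ R₂ κ Cg : ℝ) (β₀ : Param d m)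
    (P : Measure (Obs d m)) : Prop where
  /-- All eigenvalues of the population Hessian lie in `[C₁, C₂]`. -/
  eigenvalues : spectrum ℝ (hessian b β₀ P) ⊆ Set.Icc C₁ C₂
  covariates_le : ∀ᵐ o ∂P, ∀ j, |o.2 j| ≤ C
  residual_le : psiOneNorm P (fun o => o.1 - deriv b (β₀ ⬝ᵥ o.2)) ≤ ENNReal.ofReal C
  projection_le : ∀ᵐ o ∂P, ∀ k, |(projection b β₀ P *ᵥ nuisance o.2) k| ≤ C
  predictor_mem : ∀ᵐ o ∂P, β₀ ⬝ᵥ o.2 ∈ Set.Icc R₁ R₂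
  /-- All singular values of `Φ` are at least `κ`. -/
  singularValues : ∀ a ∈ spectrum ℝ ((information b β₀ P)ᵀ * information b β₀ P), κ ≤ √a
  /-- Every row of `Φ⁻¹` has fewer than `Cg` nonzero entries. -/
  rows_sparse : ∀ k, ({l | (information b β₀ P)⁻¹ k l ≠ 0}.ncard : ℝ) < Cg

/-! ### The data and the estimators -/

/-- `O` is an i.i.d. sample of size `n` from `P`, and `δ` are the indicators of a uniform Poisson
subsample of expected size `r`: i.i.d. Bernoulli(`r / n`), independent of the observations. -/
structure IsPoissonSubsample {Ω : Type*} [MeasurableSpace Ω] (μ : Measure Ω) {d m n : ℕ}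
    (P : Measure (Obs d m)) (r : ℝ) (O : Fin n → Ω → Obs d m) (δ : Fin n → Ω → Bool) : Prop where
  measurable_obs : ∀ i, Measurable (O i)
  measurable_ind : ∀ i, Measurable (δ i)
  law_obs : ∀ i, μ.map (O i) = P
  law_ind : ∀ i, μ {ω | δ i ω = true} = ENNReal.ofReal (r / n)
  indep_obs : iIndepFun O μ
  indep_ind : iIndepFun δ μ
  indep : IndepFun (fun ω i => O i ω) (fun ω i => δ i ω) μ

/-- `x` minimises `f` over `s`, whenever `f` has a minimiser over `s`. -/
def SelectsArgmin {α : Type*} (f : α → ℝ) (s : Set α) (x : α) : Prop :=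
  (∃ y ∈ s, IsMinOn f s y) → x ∈ s ∧ IsMinOn f s x

/-- The average `r⁻¹ ∑_{i : δ i} F (o i)` over the subsample. -/
def subsampleMean {d m n : ℕ} (r : ℝ) (o : Fin n → Obs d m) (δ : Fin n → Bool)
    (F : Obs d m → ℝ) : ℝ :=
  (1 / r) * ∑ i, if δ i = true then F (o i) else 0

/-- The Lasso objective for `β`. -/
def lassoObjective {d m n : ℕ} (b : ℝ → ℝ) (r lam : ℝ) (o : Fin n → Obs d m) (δ : Fin n → Bool)
    (β : Param d m) : ℝ :=
  subsampleMean r o δ (fun a => b (β ⬝ᵥ a.2) - a.1 * (β ⬝ᵥ a.2)) + lam * ∑ j, |β j|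

/-- The Lasso-type objective for `w`, given a value `β` of the pilot estimator. -/
def projectionObjective {d m n : ℕ} (b : ℝ → ℝ) (r τ : ℝ) (o : Fin n → Obs d m)
    (δ : Fin n → Bool) (β : Param d m) (w : Matrix (Fin d) (Fin m) ℝ) : ℝ :=
  subsampleMean r o δ (fun a => iteratedDeriv 2 b (β ⬝ᵥ a.2) * ∑ k, decorrelated w a.2 k ^ 2)
    + τ * ∑ j, ∑ k, |w k j|

/-- `Φ̌ = r⁻¹ ∑_{i : δ i} b''(βᵀ xᵢ) (zᵢ - w uᵢ) (zᵢ - w uᵢ)ᵀ`. -/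
def informationEstimate {d m n : ℕ} (b : ℝ → ℝ) (r : ℝ) (o : Fin n → Obs d m) (δ : Fin n → Bool)
    (β : Param d m) (w : Matrix (Fin d) (Fin m) ℝ) : Matrix (Fin d) (Fin d) ℝ :=
  fun k l => subsampleMean r o δ
    (fun a => iteratedDeriv 2 b (β ⬝ᵥ a.2) * (decorrelated w a.2 k * decorrelated w a.2 l))

/-- `∑ |G k l|`. -/
def entrywiseL1 {d : ℕ} (G : Matrix (Fin d) (Fin d) ℝ) : ℝ := ∑ k, ∑ l, |G k l|

/-- The matrices `G` with `max |(G A - I) k l| ≤ g`. -/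
def climeFeasible {d : ℕ} (A : Matrix (Fin d) (Fin d) ℝ) (g : ℝ) : Set (Matrix (Fin d) (Fin d) ℝ) :=
  {G | ∀ k l, |(G * A - 1) k l| ≤ g}

/-- The entry of smaller modulus among `G k l` and `G l k`. -/
def symmetrize {d : ℕ} (G : Matrix (Fin d) (Fin d) ℝ) : Matrix (Fin d) (Fin d) ℝ :=
  fun k l => if |G k l| ≤ |G l k| then G k l else G l k

/-- The full-data decorrelated score
`S(θ, γ, w) = n⁻¹ ∑ᵢ (b'(βᵀ xᵢ) - yᵢ) (zᵢ - w uᵢ)`, `β = (θ, γ)`. -/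
def score {d m n : ℕ} (b : ℝ → ℝ) (o : Fin n → Obs d m) (β : Param d m)
    (w : Matrix (Fin d) (Fin m) ℝ) : Fin d → ℝ :=
  (1 / (n : ℝ)) • ∑ i, (deriv b (β ⬝ᵥ (o i).2) - (o i).1) • decorrelated w (o i).2

/-- The debiased estimator `θ - G S(θ, γ, w)`, `β = (θ, γ)`. -/
def debiased {d m n : ℕ} (b : ℝ → ℝ) (o : Fin n → Obs d m) (β : Param d m)
    (w : Matrix (Fin d) (Fin m) ℝ) (G : Matrix (Fin d) (Fin d) ℝ) : Fin d → ℝ :=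
  target β - G *ᵥ score b o β w

/-- `‖√n {(θ̌ - θ₀) + Φ⁻¹ S(θ₀, γ₀, w₀)}‖_∞`; the norm on `Fin d → ℝ` is the maximum norm. -/
def bahadurRemainder {d m n : ℕ} (b : ℝ → ℝ) (β₀ : Param d m) (P : Measure (Obs d m))
    (o : Fin n → Obs d m) (θ : Fin d → ℝ) : ℝ :=
  ‖√(n : ℝ) • ((θ - target β₀) +
    (information b β₀ P)⁻¹ *ᵥ score b o β₀ (projection b β₀ P))‖

/-- `Zₙ = O_P(aₙ)`. -/
def IsBigOP {Ω : ℕ → Type*} [∀ n, MeasurableSpace (Ω n)] (μ : ∀ n, Measure (Ω n))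
    (Z : ∀ n, Ω n → ℝ) (a : ℕ → ℝ) : Prop :=
  ∀ ε : ℝ, 0 < ε → ∃ M : ℝ, ∀ᶠ n in atTop, μ n {ω | M * |a n| < |Z n ω|} ≤ ENNReal.ofReal ε

end SubsampledGLM

end

open SubsampledGLM

/-!
Write `ρ = √(log p / r)`, `ℓ = √(log p / n)`, `Δ = β̂ - β₀`, `Θ = Φ⁻¹`, and let `Ŝ`, `S` be the
full-data scores at the estimated and at the true parameters. If the score has the expansion
`Ŝ = S + Φ (θ̂ - θ₀) + ω`, then, because `Θ Φ = 1`,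

  `(θ̂ - θ₀) - G Ŝ + Θ S = -(G - Θ) (S + Φ (θ̂ - θ₀)) - G ω`

(`abs_debiased_remainder_le`). So the theorem reduces to the rates of the estimators, to the
`ℓ¹` error of the rows of `G`, and to the size of `ω`.

* *Concentration.* All randomness enters through finitely many empirical moments. A function `F` with
  `E exp (|F| / B) ≤ 2` satisfies `E exp (t F) ≤ 1 + t E F + 16 B² t²`, and Poisson sampling
  preserves this form since `E exp (t δ F) = 1 + (r / n) (E exp (t F) - 1)`. A Chernoff bound and
  a union over `O(p²)` moments give deviations `O(ρ)` on the subsample, and `O(ℓ)` on the whole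
  sample, which is a Poisson subsample with `r = n`
  (`BoundedModel.measure_not_concentrated_le`). Scores are centred because differentiating
  `∫ exp ((y t - b t) / c) dν = 1` in `t` shows that `y - b'(t)` has mean zero. Everything below is
  deterministic on this event.
* *Pilot.* The cumulant function is convex and, near `[R₁, R₂]`, strongly convex. Convexity keeps the
  sublevel set of `β₀` inside the region of strong convexity, which gives the existence of a
  minimiser and, with the cone argument `lasso_oracle_bound`, the rates `‖Δ‖₁ ≲ s₁ ρ` and
  `∑ aᵢ (Δᵀ xᵢ)² ≲ s₁ ρ²` (`lasso_rates`).
* *Projection.* The objective for `ŵ` splits into rows. The error in the estimated weights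
  `b''(β̂ᵀ x)` is absorbed by Young's inequality as an additional term `∑ aᵢ (Δᵀ xᵢ)²` in the basic
  inequality; hence the rates `(s₁ ∨ s₂) ρ` in `ℓ¹` and `(s₁ ∨ s₂) ρ²` for the squared prediction
  error (`weighted_lasso_rates`).
* *Inverse.* The plug-in information matrix is within `O((s₁ ∨ √s₂) ρ)` of `Φ` in the max norm, so
  that `Θ`, whose rows are bounded in `ℓ¹` by sparsity, is feasible. By minimality the rows of `Ĝ`
  are not longer than those of `Θ`, and sparsity turns max-norm closeness into `ℓ¹` closeness
  (`clime_bounds`, `sum_abs_sub_le_of_sparse`). As `Θ` is symmetric, both properties pass to the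
  symmetrization.
* *Score.* Since `E[b''(β₀ᵀ x) (z - w₀ u) uᵀ] = 0`, the linear term of the score is `Φ (θ̂ - θ₀)` up
  to `ℓ ‖Δ‖₁`. Replacing `w₀` by `ŵ` costs `ℓ (s₁ ∨ s₂) ρ` in the noise and, by the Cauchy–Schwarz
  inequality for the two prediction errors, `√(s₁ (s₁ ∨ s₂)) ρ² ≤ s₁ (s₁ ∨ √s₂) ρ²` in the linear
  term (`RegularSample.abs_score_sub_le`). Multiplication by `√n` and `√n ρ ℓ = log p / √r` give
  the stated rate.
-/

namespace SubsampledGLM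

/-! ### Sub-exponential tails for Poisson subsamples -/

theorem exp_le_one_add_add_sq_mul_exp_abs (x : ℝ) :
    Real.exp x ≤ 1 + x + x ^ 2 * Real.exp |x| := by
  have h := Complex.norm_exp_sub_sum_le_norm_mul_exp (x : ℂ) 2
  have h2 : Complex.exp (x : ℂ) - ∑ m ∈ Finset.range 2, (x : ℂ) ^ m / (m.factorial : ℂ)
      = ((Real.exp x - (1 + x) : ℝ) : ℂ) := by
    simp [Finset.sum_range_succ]
  rw [h2, Complex.norm_real, Complex.norm_real, Real.norm_eq_abs, Real.norm_eq_abs, sq_abs] at h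
  linarith [le_abs_self (Real.exp x - (1 + x))]

section Moments

variable {α : Type*} [MeasurableSpace α] {P : Measure α} {F : α → ℝ} {B : ℝ}

theorem integrable_exp_abs_div (hF : Measurable F)
    (h : ∫⁻ a, ENNReal.ofReal (Real.exp (|F a| / B)) ∂P ≤ 2) :
    Integrable (fun a => Real.exp (|F a| / B)) P := by
  refine ⟨(by fun_prop : Measurable _).aestronglyMeasurable, ?_⟩
  rw [hasFiniteIntegral_iff_ofReal (ae_of_all _ fun a => (Real.exp_pos _).le)]
  exact h.trans_lt (by norm_num)

theorem integral_exp_abs_div_le (hF : Measurable F)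
    (h : ∫⁻ a, ENNReal.ofReal (Real.exp (|F a| / B)) ∂P ≤ 2) :
    ∫ a, Real.exp (|F a| / B) ∂P ≤ 2 := by
  rw [integral_eq_lintegral_of_nonneg_ae (ae_of_all _ fun a => (Real.exp_pos _).le)
    (by fun_prop : Measurable _).aestronglyMeasurable]
  exact ENNReal.toReal_le_of_le_ofReal (by norm_num) (by simpa using h)

theorem integrable_of_exp_abs (hF : Measurable F) (hB : 0 < B)
    (h : ∫⁻ a, ENNReal.ofReal (Real.exp (|F a| / B)) ∂P ≤ 2) : Integrable F P := by
  refine ((integrable_exp_abs_div hF h).const_mul B).mono' hF.aestronglyMeasurable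
    (ae_of_all _ fun a => ?_)
  have h1 := Real.add_one_le_exp (|F a| / B)
  have h2 : |F a| = B * (|F a| / B) := by field_simp
  rw [Real.norm_eq_abs]
  nlinarith

theorem integrable_exp_mul_of_exp_abs (hF : Measurable F) (hB : 0 < B)
    (h : ∫⁻ a, ENNReal.ofReal (Real.exp (|F a| / B)) ∂P ≤ 2) {t : ℝ} (ht : |t| ≤ 1 / (2 * B)) :
    Integrable (fun a => Real.exp (t * F a)) P := by
  refine (integrable_exp_abs_div hF h).mono' (by fun_prop : Measurable _).aestronglyMeasurable
    (ae_of_all _ fun a => ?_)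
  rw [Real.norm_eq_abs, abs_of_pos (Real.exp_pos _), Real.exp_le_exp]
  calc t * F a ≤ |t| * |F a| := by rw [← abs_mul]; exact le_abs_self _
    _ ≤ 1 / (2 * B) * |F a| := by gcongr
    _ ≤ |F a| / B := by
        have : 0 ≤ |F a| / B := by positivity
        calc 1 / (2 * B) * |F a| = |F a| / B / 2 := by field_simp
          _ ≤ _ := by linarith

theorem integral_exp_mul_le [IsProbabilityMeasure P] (hF : Measurable F) (hB : 0 < B)
    (h : ∫⁻ a, ENNReal.ofReal (Real.exp (|F a| / B)) ∂P ≤ 2) {t : ℝ} (ht : |t| ≤ 1 / (2 * B)) :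
    ∫ a, Real.exp (t * F a) ∂P ≤ 1 + t * ∫ a, F a ∂P + 16 * B ^ 2 * t ^ 2 := by
  have hpt : ∀ a, Real.exp (t * F a) ≤
      (1 + t * F a) + 8 * B ^ 2 * t ^ 2 * Real.exp (|F a| / B) := by
    intro a
    have h1 := exp_le_one_add_add_sq_mul_exp_abs (t * F a)
    set v := |F a| / (2 * B) with hv
    have hv0 : 0 ≤ v := by positivity
    have habs : |t * F a| ≤ v := by
      rw [abs_mul, hv]
      calc |t| * |F a| ≤ 1 / (2 * B) * |F a| := by gcongr
        _ = _ := by ring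
    have h2 : Real.exp |t * F a| ≤ Real.exp v := Real.exp_le_exp.2 habs
    have h3 : v ^ 2 ≤ 2 * Real.exp v := by
      have := Real.quadratic_le_exp_of_nonneg hv0
      nlinarith
    have h4 : (t * F a) ^ 2 = 4 * B ^ 2 * t ^ 2 * v ^ 2 := by
      rw [hv, div_pow, sq_abs]; field_simp; ring
    have h5 : Real.exp (|F a| / B) = Real.exp v * Real.exp v := by
      rw [← Real.exp_add]; congr 1; rw [hv]; field_simp; ring
    have h6 : (t * F a) ^ 2 * Real.exp |t * F a| ≤
        4 * B ^ 2 * t ^ 2 * (2 * Real.exp v) * Real.exp v := by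
      rw [h4]; gcongr
    rw [h5]; nlinarith
  have hi := integrable_of_exp_abs hF hB h
  have hie := integrable_exp_abs_div hF h
  calc ∫ a, Real.exp (t * F a) ∂P
      ≤ ∫ a, ((1 + t * F a) + 8 * B ^ 2 * t ^ 2 * Real.exp (|F a| / B)) ∂P :=
        integral_mono (integrable_exp_mul_of_exp_abs hF hB h ht)
          (((integrable_const _).add (hi.const_mul t)).add (hie.const_mul _)) hpt
    _ = 1 + t * ∫ a, F a ∂P + 8 * B ^ 2 * t ^ 2 * ∫ a, Real.exp (|F a| / B) ∂P := by
        have e1 : Integrable (fun a => 1 + t * F a) P := (integrable_const _).add (hi.const_mul t)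
        rw [integral_add e1 (hie.const_mul _),
          integral_add (integrable_const _) (hi.const_mul t), integral_const_mul,
          integral_const_mul]
        simp
    _ ≤ _ := by
        have := integral_exp_abs_div_le hF h
        nlinarith [mul_nonneg (sq_nonneg B) (sq_nonneg t)]

/-- A bounded function is sub-exponential at any scale at least twice its bound. -/
theorem lintegral_exp_abs_div_le_of_bounded [IsProbabilityMeasure P] (hB : 0 < B)
    (h : ∀ᵐ a ∂P, 2 * |F a| ≤ B) :
    ∫⁻ a, ENNReal.ofReal (Real.exp (|F a| / B)) ∂P ≤ 2 := by
  calc ∫⁻ a, ENNReal.ofReal (Real.exp (|F a| / B)) ∂P ≤ ∫⁻ _, 2 ∂P := by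
        refine lintegral_mono_ae (h.mono fun a ha => ?_)
        rw [show (2 : ℝ≥0∞) = ENNReal.ofReal 2 by simp]
        apply ENNReal.ofReal_le_ofReal
        have h1 : |F a| / B ≤ 1 / 2 := by rw [div_le_iff₀ hB]; linarith
        have h2 : Real.exp (1 / 2) ^ 2 = Real.exp 1 := by rw [← Real.exp_nat_mul]; norm_num
        have h3 := Real.exp_one_lt_d9
        have h4 := Real.exp_le_exp.2 h1
        nlinarith [Real.exp_pos (1 / 2)]
    _ = 2 := by simp

end Moments

section Tail

variable {Ω : Type*} [MeasurableSpace Ω] {μ : Measure Ω} {d m n : ℕ} {P : Measure (Obs d m)}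
  {r : ℝ} {O : Fin n → Ω → Obs d m} {δ : Fin n → Ω → Bool}

/-- The pairs (observation, sampling indicator) are independent. -/
theorem IsPoissonSubsample.iIndepFun_pair [IsProbabilityMeasure μ]
    (h : IsPoissonSubsample μ P r O δ) : iIndepFun (fun i ω => (O i ω, δ i ω)) μ := by
  have hO := h.measurable_obs
  have hδ := h.measurable_ind
  have hpair : ∀ i, μ.map (fun ω => (O i ω, δ i ω)) = (μ.map (O i)).prod (μ.map (δ i)) := by
    intro i
    rw [← indepFun_iff_map_prod_eq_prod_map_map (hO i).aemeasurable (hδ i).aemeasurable]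
    exact h.indep.comp (measurable_pi_apply i) (measurable_pi_apply i)
  rw [iIndepFun_iff_map_fun_eq_pi_map fun i => ((hO i).prodMk (hδ i)).aemeasurable]
  have : ∀ i, IsProbabilityMeasure (μ.map (O i)) :=
    fun i => Measure.isProbabilityMeasure_map (hO i).aemeasurable
  have : ∀ i, IsProbabilityMeasure (μ.map (δ i)) :=
    fun i => Measure.isProbabilityMeasure_map (hδ i).aemeasurable
  have h1 := (iIndepFun_iff_map_fun_eq_pi_map fun i => (hO i).aemeasurable).1 h.indep_obs
  have h2 := (iIndepFun_iff_map_fun_eq_pi_map fun i => (hδ i).aemeasurable).1 h.indep_ind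
  have h3 := (indepFun_iff_map_prod_eq_prod_map_map (measurable_pi_lambda _ hO).aemeasurable
    (measurable_pi_lambda _ hδ).aemeasurable).1 h.indep
  rw [h1, h2] at h3
  have h4 := (measurePreserving_arrowProdEquivProdArrow (Obs d m) Bool (Fin n)
    (fun i => μ.map (O i)) (fun i => μ.map (δ i)))
  simp_rw [hpair]
  apply (MeasurableEquiv.arrowProdEquivProdArrow (Obs d m) Bool (Fin n)).map_measurableEquiv_injective
  rw [h4.map_eq, ← h3, Measure.map_map (MeasurableEquiv.measurable _)
    (measurable_pi_lambda _ fun i => (hO i).prodMk (hδ i))]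
  rfl

/-- The Chernoff bound for one tail of a subsample mean. -/
theorem IsPoissonSubsample.measure_mean_ge_le [IsProbabilityMeasure μ] [IsProbabilityMeasure P]
    (h : IsPoissonSubsample μ P r O δ) (hr : 0 < r) (hn : n ≠ 0) {F : Obs d m → ℝ}
    (hF : Measurable F) {B : ℝ} (hB : 0 < B)
    (hexp : ∫⁻ a, ENNReal.ofReal (Real.exp (|F a| / B)) ∂P ≤ 2) {u : ℝ} (hu0 : 0 ≤ u)
    (hu : u ≤ 16 * B) :
    μ.real {ω | ∫ a, F a ∂P + u ≤ subsampleMean r (fun i => O i ω) (fun i => δ i ω) F} ≤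
      Real.exp (-(r * u ^ 2 / (64 * B ^ 2))) := by
  have hO := h.measurable_obs
  have hδ := h.measurable_ind
  set t : ℝ := u / (32 * B ^ 2) with ht_def
  have ht0 : 0 ≤ t := by positivity
  have ht : |t| ≤ 1 / (2 * B) := by
    rw [abs_of_nonneg ht0, ht_def, div_le_div_iff₀ (by positivity) (by positivity)]
    nlinarith
  set X : Fin n → Ω → ℝ := fun i ω => if δ i ω = true then F (O i ω) else 0 with hX
  let f : Obs d m × Bool → ℝ := fun q => if q.2 = true then F q.1 else 0
  have hfm : Measurable f :=
    Measurable.ite (measurable_snd (measurableSet_singleton true)) (hF.comp measurable_fst)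
      measurable_const
  have hXm : ∀ i, Measurable (X i) := fun i => hfm.comp ((hO i).prodMk (hδ i))
  have hind : iIndepFun X μ := h.iIndepFun_pair.comp (fun _ => f) fun _ => hfm
  set φ : ℝ := ∫ a, Real.exp (t * F a) ∂P with hφ
  set c : ℝ := t * ∫ a, F a ∂P + 16 * B ^ 2 * t ^ 2 with hc
  have hφle : φ ≤ 1 + c := by
    have := integral_exp_mul_le hF hB hexp ht
    rw [hc]; linarith
  have hintP := integrable_exp_mul_of_exp_abs hF hB hexp ht
  have hintO : ∀ i, Integrable (fun ω => Real.exp (t * F (O i ω))) μ := fun i => by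
    have := h.law_obs i
    rw [← this] at hintP
    exact hintP.comp_measurable (hO i)
  have hφO : ∀ i, ∫ ω, Real.exp (t * F (O i ω)) ∂μ = φ := fun i => by
    rw [hφ, ← h.law_obs i, integral_map (hO i).aemeasurable
      (by fun_prop : Measurable _).aestronglyMeasurable]
  let ind : Fin n → Ω → ℝ := fun i ω => if δ i ω = true then 1 else 0
  have hindm : ∀ i, Measurable (ind i) := fun i =>
    Measurable.ite ((hδ i) (measurableSet_singleton true)) measurable_const measurable_const
  have hindint : ∀ i, Integrable (ind i) μ := fun i =>
    Integrable.of_bound (hindm i).aestronglyMeasurable 1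
      (ae_of_all _ fun ω => by simp only [ind]; split_ifs <;> simp)
  have hrn : ∀ i, ∫ ω, ind i ω ∂μ = r / n := fun i => by
    have e : ind i = Set.indicator (δ i ⁻¹' {true}) 1 := by
      ext ω
      by_cases hω : δ i ω = true <;> simp [ind, hω]
    have hlaw : μ (δ i ⁻¹' {true}) = ENNReal.ofReal (r / n) := h.law_ind i
    rw [e, integral_indicator_one ((hδ i) (measurableSet_singleton true)), measureReal_def,
      hlaw, ENNReal.toReal_ofReal (by positivity)]
  have hexpX : ∀ i, (fun ω => Real.exp (t * X i ω)) =
      fun ω => 1 + ind i ω * (Real.exp (t * F (O i ω)) - 1) := fun i => by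
    ext ω; simp only [hX, ind]; split_ifs <;> simp
  have hindep2 : ∀ i, IndepFun (ind i) (fun ω => Real.exp (t * F (O i ω)) - 1) μ := fun i => by
    have h1 : IndepFun (δ i) (O i) μ :=
      (h.indep.comp (measurable_pi_apply i) (measurable_pi_apply i)).symm
    exact h1.comp (φ := fun q : Bool => if q = true then (1 : ℝ) else 0)
      (ψ := fun o => Real.exp (t * F o) - 1) (measurable_of_countable _) (by fun_prop)
  have hprodint : ∀ i, Integrable (fun ω => ind i ω * (Real.exp (t * F (O i ω)) - 1)) μ :=
    fun i => (hindep2 i).integrable_mul (hindint i) ((hintO i).sub (integrable_const 1))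
  have hintX : ∀ i, Integrable (fun ω => Real.exp (t * X i ω)) μ := fun i => by
    rw [hexpX i]; exact (integrable_const 1).add (hprodint i)
  have hmgf : ∀ i, mgf (X i) μ t ≤ Real.exp (r / n * c) := fun i => by
    have e : mgf (X i) μ t = 1 + r / n * (φ - 1) := by
      rw [mgf, hexpX i, integral_add (integrable_const 1) (hprodint i)]
      have := (hindep2 i).integral_mul_eq_mul_integral (hindm i).aestronglyMeasurable
        (by fun_prop : Measurable _).aestronglyMeasurable
      simp only [Pi.mul_apply] at this
      rw [show (∫ ω, ind i ω * (Real.exp (t * F (O i ω)) - 1) ∂μ) =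
        (∫ ω, ind i ω ∂μ) * ∫ ω, (Real.exp (t * F (O i ω)) - 1) ∂μ from this, hrn i,
        integral_sub (hintO i) (integrable_const 1), hφO i]
      simp
    rw [e]
    have h1 : r / n * (φ - 1) ≤ r / n * c := by
      apply mul_le_mul_of_nonneg_left _ (by positivity); linarith
    linarith [Real.add_one_le_exp (r / n * c)]
  have hsumint := hind.integrable_exp_mul_sum hXm (s := Finset.univ) fun i _ => hintX i
  have hch := measure_ge_le_exp_mul_mgf (r * (∫ a, F a ∂P + u)) ht0 hsumint
  have hset : {ω | ∫ a, F a ∂P + u ≤ subsampleMean r (fun i => O i ω) (fun i => δ i ω) F} =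
      {ω | r * (∫ a, F a ∂P + u) ≤ (∑ i, X i) ω} := by
    ext ω
    simp only [Set.mem_ofPred_eq, subsampleMean, Finset.sum_apply, hX]
    rw [one_div_mul_eq_div, le_div_iff₀ hr, mul_comm]
  rw [hset]
  refine hch.trans ?_
  rw [hind.mgf_sum hXm]
  have hprod : ∏ i, mgf (X i) μ t ≤ Real.exp (r * c) := by
    calc ∏ i, mgf (X i) μ t ≤ ∏ _i : Fin n, Real.exp (r / n * c) :=
          Finset.prod_le_prod (fun i _ => mgf_nonneg) fun i _ => hmgf i
      _ ≤ Real.exp (r * c) := by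
          rw [Finset.prod_const, Finset.card_univ, Fintype.card_fin, ← Real.exp_nat_mul]
          rw [show (n : ℝ) * (r / n * c) = r * c by field_simp]
  calc Real.exp (-t * (r * (∫ a, F a ∂P + u))) * ∏ i, mgf (X i) μ t
      ≤ Real.exp (-t * (r * (∫ a, F a ∂P + u))) * Real.exp (r * c) := by gcongr
    _ = _ := by
      rw [← Real.exp_add]
      congr 1
      rw [hc, ht_def]; field_simp; ring

theorem IsPoissonSubsample.measure_abs_mean_sub_gt_le [IsProbabilityMeasure μ]
    [IsProbabilityMeasure P] (h : IsPoissonSubsample μ P r O δ) (hr : 0 < r)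
    (hn : n ≠ 0) {F : Obs d m → ℝ} (hF : Measurable F) {B : ℝ} (hB : 0 < B)
    (hexp : ∫⁻ a, ENNReal.ofReal (Real.exp (|F a| / B)) ∂P ≤ 2) {u : ℝ} (hu0 : 0 ≤ u)
    (hu : u ≤ 16 * B) :
    μ {ω | u < |subsampleMean r (fun i => O i ω) (fun i => δ i ω) F - ∫ a, F a ∂P|} ≤
      ENNReal.ofReal (2 * Real.exp (-(r * u ^ 2 / (64 * B ^ 2)))) := by
  have h1 := h.measure_mean_ge_le hr hn hF hB hexp hu0 hu
  have h2 := h.measure_mean_ge_le hr hn hF.neg hB (by simpa using hexp) hu0 hu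
  have hsub : {ω | u < |subsampleMean r (fun i => O i ω) (fun i => δ i ω) F - ∫ a, F a ∂P|} ⊆
      {ω | ∫ a, F a ∂P + u ≤ subsampleMean r (fun i => O i ω) (fun i => δ i ω) F} ∪
      {ω | ∫ a, (-F) a ∂P + u ≤ subsampleMean r (fun i => O i ω) (fun i => δ i ω) (-F)} := by
    intro ω hω
    simp only [Set.mem_ofPred_eq] at hω
    have e : subsampleMean r (fun i => O i ω) (fun i => δ i ω) (-F) =
        -subsampleMean r (fun i => O i ω) (fun i => δ i ω) F := by
      simp only [subsampleMean, Pi.neg_apply]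
      rw [← mul_neg, ← Finset.sum_neg_distrib]
      congr 1
      exact Finset.sum_congr rfl fun i _ => by split_ifs <;> simp
    rcases lt_abs.1 hω with hω | hω
    · left; simp only [Set.mem_ofPred_eq]; linarith
    · right
      simp only [Set.mem_ofPred_eq]
      rw [e]; simp only [Pi.neg_apply, integral_neg]; linarith
  refine (measure_mono hsub).trans ((measure_union_le _ _).trans ?_)
  rw [two_mul, ENNReal.ofReal_add (Real.exp_pos _).le (Real.exp_pos _).le]
  refine add_le_add ?_ ?_
  · rw [← ofReal_measureReal (measure_ne_top _ _)]; exact ENNReal.ofReal_le_ofReal h1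
  · rw [← ofReal_measureReal (measure_ne_top _ _)]; exact ENNReal.ofReal_le_ofReal h2

/-- Simultaneous deviations of finitely many subsample means, by a union bound. -/
theorem IsPoissonSubsample.measure_exists_abs_mean_sub_gt_le [IsProbabilityMeasure μ]
    [IsProbabilityMeasure P] (h : IsPoissonSubsample μ P r O δ) (hr : 0 < r) (hn : n ≠ 0)
    {ι : Type*} [Fintype ι] {F : ι → Obs d m → ℝ} (hF : ∀ k, Measurable (F k)) {B : ℝ}
    (hB : 0 < B) (hexp : ∀ k, ∫⁻ a, ENNReal.ofReal (Real.exp (|F k a| / B)) ∂P ≤ 2) {u : ℝ}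
    (hu0 : 0 ≤ u) (hu : u ≤ 16 * B) :
    μ {ω | ∃ k, u < |subsampleMean r (fun i => O i ω) (fun i => δ i ω) (F k) -
      ∫ a, F k a ∂P|} ≤
      ENNReal.ofReal (Fintype.card ι * (2 * Real.exp (-(r * u ^ 2 / (64 * B ^ 2))))) := by
  rw [Set.ofPred_exists]
  refine (measure_iUnion_fintype_le _ _).trans ((Finset.sum_le_sum fun k _ =>
    h.measure_abs_mean_sub_gt_le hr hn (hF k) hB (hexp k) hu0 hu).trans ?_)
  rw [Finset.sum_const, Finset.card_univ, nsmul_eq_mul, ENNReal.ofReal_mul (Nat.cast_nonneg _),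
    ENNReal.ofReal_natCast]

/-- The whole sample is a Poisson subsample with inclusion probability one. -/
theorem IsPoissonSubsample.full [IsProbabilityMeasure μ]
    (h : IsPoissonSubsample μ P r O δ) (hn : n ≠ 0) :
    IsPoissonSubsample μ P n O (fun _ _ => true) where
  measurable_obs := h.measurable_obs
  measurable_ind _ := measurable_const
  law_obs := h.law_obs
  law_ind i := by
    rw [div_self (by exact_mod_cast hn)]
    simp
  indep_obs := h.indep_obs
  indep_ind := by
    rw [iIndepFun_iff_measure_inter_preimage_eq_mul]
    intro S sets _
    by_cases hS : ∀ i ∈ S, true ∈ sets i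
    · have h1 : ∀ i ∈ S, (fun _ : Ω => true) ⁻¹' sets i = Set.univ := fun i hi => by
        simp [hS i hi]
      rw [Set.iInter₂_congr h1, Finset.prod_congr rfl fun i hi => by rw [h1 i hi]]
      simp
    · push Not at hS
      obtain ⟨i, hi, hin⟩ := hS
      have h1 : (fun _ : Ω => true) ⁻¹' sets i = ∅ := by simp [hin]
      rw [Finset.prod_eq_zero hi (by rw [h1]; simp)]
      exact measure_mono_null (Set.iInter₂_subset i hi) (by rw [h1]; simp)
  indep := indepFun_const_right _ _

end Tail

/-! ### Exponential families: convexity of the cumulant function and unbiasedness of the score -/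

section Cumulant

variable {b : ℝ → ℝ} {c : ℝ} {ν : Measure ℝ}

theorem IsCumulantFunction.lintegral_exp (hν : IsCumulantFunction b c ν) (t : ℝ) :
    ∫⁻ y, ENNReal.ofReal (Real.exp (y * t / c)) ∂ν = ENNReal.ofReal (Real.exp (b t / c)) := by
  have h : ∀ y, ENNReal.ofReal (Real.exp (y * t / c)) =
      ENNReal.ofReal (Real.exp (b t / c)) * ENNReal.ofReal (Real.exp ((y * t - b t) / c)) := by
    intro y
    rw [← ENNReal.ofReal_mul (Real.exp_pos _).le, ← Real.exp_add]
    congr 2; ring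
  simp_rw [h]
  rw [lintegral_const_mul' _ _ ENNReal.ofReal_ne_top, hν t, mul_one]

theorem IsCumulantFunction.integrable_exp (hν : IsCumulantFunction b c ν) (hc : 0 < c) (s : ℝ) :
    Integrable (fun y => Real.exp (s * y)) ν := by
  refine ⟨(by fun_prop : Measurable _).aestronglyMeasurable, ?_⟩
  rw [hasFiniteIntegral_iff_ofReal (ae_of_all _ fun a => (Real.exp_pos _).le)]
  have h := hν.lintegral_exp (c * s)
  have e : ∀ y, y * (c * s) / c = s * y := fun y => by field_simp
  simp_rw [e] at h
  rw [h]
  exact ENNReal.ofReal_lt_top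

theorem IsCumulantFunction.mgf_eq (hν : IsCumulantFunction b c ν) (hc : 0 < c) (s : ℝ) :
    mgf id ν s = Real.exp (b (c * s) / c) := by
  change ∫ y, Real.exp (s * y) ∂ν = _
  rw [integral_eq_lintegral_of_nonneg_ae (ae_of_all _ fun a => (Real.exp_pos _).le)
    (hν.integrable_exp hc s).aestronglyMeasurable]
  have h := hν.lintegral_exp (c * s)
  have e : ∀ y, y * (c * s) / c = s * y := fun y => by field_simp
  simp_rw [e] at h
  rw [h, ENNReal.toReal_ofReal (Real.exp_pos _).le]

theorem IsCumulantFunction.mem_interior (hν : IsCumulantFunction b c ν) (hc : 0 < c) (s : ℝ) :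
    s ∈ interior (integrableExpSet id ν) := by
  have : integrableExpSet id ν = Set.univ :=
    Set.eq_univ_of_forall fun s => hν.integrable_exp hc s
  rw [this, interior_univ]; trivial

theorem IsCumulantFunction.eq_cgf (hν : IsCumulantFunction b c ν) (hc : 0 < c) :
    b = fun t => c * cgf id ν (c⁻¹ * t) := by
  ext t
  rw [cgf, hν.mgf_eq hc, Real.log_exp]
  field_simp

theorem IsCumulantFunction.iteratedDeriv_two_nonneg (hν : IsCumulantFunction b c ν) (hc : 0 < c)
    (t : ℝ) : 0 ≤ iteratedDeriv 2 b t := by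
  have hd : ContDiff ℝ 2 (cgf id ν) := by
    rw [contDiff_iff_contDiffAt]
    exact fun s => (analyticAt_cgf (hν.mem_interior hc s)).contDiffAt
  have h1 : ∀ s, 0 ≤ iteratedDeriv 2 (cgf id ν) s := fun s => by
    rw [← variance_tilted_mul (hν.mem_interior hc s)]
    exact variance_nonneg _ _
  have h2 : ContDiff ℝ 2 fun t => cgf id ν (c⁻¹ * t) := hd.comp (by fun_prop)
  rw [hν.eq_cgf hc, iteratedDeriv_const_mul_field, iteratedDeriv_comp_const_mul hd]
  have := h1 (c⁻¹ * t)
  positivity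

/-- The score of the exponential family integrates to zero. -/
theorem IsCumulantFunction.integral_score_eq_zero (hν : IsCumulantFunction b c ν) (hc : 0 < c)
    (hb : Differentiable ℝ b) (t : ℝ) :
    ∫ y, (deriv b t - y) * Real.exp ((y * t - b t) / c) ∂ν = 0 := by
  set s := t / c with hs
  have hcs : c * s = t := by rw [hs]; field_simp
  have h1 := hasDerivAt_mgf (hν.mem_interior hc s)
  have h2 : HasDerivAt (mgf id ν) (Real.exp (b t / c) * deriv b t) s := by
    have e : mgf id ν = fun s => Real.exp (b (c * s) / c) := funext (hν.mgf_eq hc)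
    rw [e]
    have h3 : HasDerivAt (fun s => c * s) c s := by simpa using (hasDerivAt_id s).const_mul c
    have h4 : HasDerivAt b (deriv b t) (c * s) := by rw [hcs]; exact (hb t).hasDerivAt
    have h5 := ((h4.comp s h3).div_const c).exp
    simp only [Function.comp_def, hcs] at h5
    convert h5 using 1
    field_simp
  have h3 := h1.unique h2
  have hi1 : Integrable (fun y => y * Real.exp (s * y)) ν := by
    have := integrable_pow_mul_exp_of_mem_interior_integrableExpSet (hν.mem_interior hc s) 1
    simpa using this
  have e : ∀ y, (deriv b t - y) * Real.exp ((y * t - b t) / c) =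
      Real.exp (-(b t / c)) * (deriv b t * Real.exp (s * y) - y * Real.exp (s * y)) := by
    intro y
    have : Real.exp ((y * t - b t) / c) = Real.exp (-(b t / c)) * Real.exp (s * y) := by
      rw [← Real.exp_add]; congr 1; rw [hs]; field_simp; ring
    rw [this]; ring
  simp_rw [e]
  rw [integral_const_mul, integral_sub ((hν.integrable_exp hc s).const_mul _) hi1,
    integral_const_mul]
  simp only [id] at h3
  rw [h3]
  have h4 : ∫ y, Real.exp (s * y) ∂ν = Real.exp (b t / c) := by
    have := hν.mgf_eq hc s
    rw [hcs] at this
    exact this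
  rw [h4]; ring

/-- The canonical score is orthogonal to every function of the covariates. -/
theorem IsCanonicalGLM.integral_score_mul_eq_zero [SigmaFinite ν] {d m : ℕ} {β₀ : Param d m}
    {P : Measure (Obs d m)} [IsProbabilityMeasure P] (hP : IsCanonicalGLM b c ν β₀ P)
    (hν : IsCumulantFunction b c ν) (hc : 0 < c) (hb : Differentiable ℝ b)
    {φ : (Fin d ⊕ Fin m → ℝ) → ℝ}
    (hint : Integrable (fun o : Obs d m => (deriv b (β₀ ⬝ᵥ o.2) - o.1) * φ o.2) P) :
    ∫ o, (deriv b (β₀ ⬝ᵥ o.2) - o.1) * φ o.2 ∂P = 0 := by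
  set Q := P.map Prod.snd with hQ
  have hQp : IsProbabilityMeasure Q := Measure.isProbabilityMeasure_map measurable_snd.aemeasurable
  have hdot : Measurable fun o : Obs d m => β₀ ⬝ᵥ o.2 := by
    simp only [dotProduct]
    fun_prop
  have hbm : Measurable b := hb.continuous.measurable
  have hfm : Measurable fun o : Obs d m =>
      ENNReal.ofReal (Real.exp ((o.1 * (β₀ ⬝ᵥ o.2) - b (β₀ ⬝ᵥ o.2)) / c)) := by
    have := hbm.comp hdot
    simp only [Function.comp_def] at this
    fun_prop
  have hlt : ∀ᵐ o ∂(ν.prod Q), ENNReal.ofReal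
      (Real.exp ((o.1 * (β₀ ⬝ᵥ o.2) - b (β₀ ⬝ᵥ o.2)) / c)) < ⊤ :=
    ae_of_all _ fun _ => ENNReal.ofReal_lt_top
  unfold IsCanonicalGLM at hP
  rw [← hQ] at hP
  have hint' := hint
  rw [hP, integrable_withDensity_iff_integrable_smul' hfm hlt] at hint'
  rw [hP, integral_withDensity_eq_integral_toReal_smul hfm hlt, integral_prod_symm _ hint']
  refine (integral_congr_ae (ae_of_all _ fun x => ?_)).trans (integral_zero _ _)
  simp only [smul_eq_mul, ENNReal.toReal_ofReal (Real.exp_pos _).le]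
  have := hν.integral_score_eq_zero hc hb (β₀ ⬝ᵥ x)
  calc ∫ y, Real.exp ((y * (β₀ ⬝ᵥ x) - b (β₀ ⬝ᵥ x)) / c) *
        ((deriv b (β₀ ⬝ᵥ x) - y) * φ x) ∂ν
      = ∫ y, φ x * ((deriv b (β₀ ⬝ᵥ x) - y) *
        Real.exp ((y * (β₀ ⬝ᵥ x) - b (β₀ ⬝ᵥ x)) / c)) ∂ν := by
        congr 1; ext y; ring
    _ = 0 := by rw [integral_const_mul, this, mul_zero]

end Cumulant

/-! ### Local bounds on the cumulant function -/

/-- Quantitative regularity of `b` on the `ε`-neighbourhood of `[R₁, R₂]`: there `b''` takes values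
in `[c₀, L]` and `b'''` in `[-L, L]`. -/
structure LinkBounds (b : ℝ → ℝ) (R₁ R₂ ε c₀ L : ℝ) : Prop where
  differentiable : Differentiable ℝ b
  differentiable_deriv : Differentiable ℝ (deriv b)
  differentiable_deriv2 : Differentiable ℝ (iteratedDeriv 2 b)
  eps_pos : 0 < ε
  lower_pos : 0 < c₀
  one_le : 1 ≤ L
  lower_le : ∀ t ∈ Set.Icc (R₁ - ε) (R₂ + ε), c₀ ≤ iteratedDeriv 2 b t
  le_upper : ∀ t ∈ Set.Icc (R₁ - ε) (R₂ + ε), iteratedDeriv 2 b t ≤ L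
  third_le : ∀ t ∈ Set.Icc (R₁ - ε) (R₂ + ε), |iteratedDeriv 3 b t| ≤ L

section Link

variable {b : ℝ → ℝ} {R₁ R₂ ε c₀ L : ℝ}

theorem LinkRegularity.exists_linkBounds (hb : LinkRegularity b R₁ R₂) :
    ∃ ε c₀ L, LinkBounds b R₁ R₂ ε c₀ L := by
  obtain ⟨hd, ε, hε, C, hC⟩ := hb
  have h2 := hd 2 (by norm_num)
  obtain ⟨c₀, hc₀, hle⟩ := (isCompact_Icc (a := R₁ - ε) (b := R₂ + ε)).exists_forall_le'
    h2.continuous.continuousOn (a := 0) fun t ht => (hC t ht).1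
  refine ⟨ε, c₀, |C| + 1, by simpa using hd 0 (by norm_num), by simpa using hd 1 (by norm_num), h2,
    hε, hc₀, by linarith [abs_nonneg C], hle, fun t ht => ?_, fun t ht => ?_⟩
  · linarith [(hC t ht).2.1, le_abs_self C]
  · linarith [(hC t ht).2.2.1, le_abs_self C]

namespace LinkBounds

variable {t h : ℝ}

theorem add_mem (_ : LinkBounds b R₁ R₂ ε c₀ L) (ht : t ∈ Set.Icc R₁ R₂) (hh : |h| ≤ ε) :
    t + h ∈ Set.Icc (R₁ - ε) (R₂ + ε) := by
  have := abs_le.1 hh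
  exact ⟨by linarith [ht.1], by linarith [ht.2]⟩

theorem mem (hb : LinkBounds b R₁ R₂ ε c₀ L) (ht : t ∈ Set.Icc R₁ R₂) :
    t ∈ Set.Icc (R₁ - ε) (R₂ + ε) :=
  ⟨by linarith [ht.1, hb.eps_pos], by linarith [ht.2, hb.eps_pos]⟩

theorem hasDerivAt_deriv (hb : LinkBounds b R₁ R₂ ε c₀ L) (s : ℝ) :
    HasDerivAt (deriv b) (iteratedDeriv 2 b s) s := by
  have := (hb.differentiable_deriv s).hasDerivAt
  rwa [show deriv (deriv b) = iteratedDeriv 2 b by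
    rw [iteratedDeriv_succ, iteratedDeriv_one]] at this

theorem hasDerivAt_deriv2 (hb : LinkBounds b R₁ R₂ ε c₀ L) (s : ℝ) :
    HasDerivAt (iteratedDeriv 2 b) (iteratedDeriv 3 b s) s := by
  have := (hb.differentiable_deriv2 s).hasDerivAt
  rwa [← iteratedDeriv_succ] at this

theorem abs_deriv2_sub_le (hb : LinkBounds b R₁ R₂ ε c₀ L) (ht : t ∈ Set.Icc R₁ R₂)
    (hh : |h| ≤ ε) : |iteratedDeriv 2 b (t + h) - iteratedDeriv 2 b t| ≤ L * |h| := by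
  have := (convex_Icc (R₁ - ε) (R₂ + ε)).norm_image_sub_le_of_norm_hasDerivWithin_le
    (f := iteratedDeriv 2 b) (f' := iteratedDeriv 3 b)
    (fun s _ => (hb.hasDerivAt_deriv2 s).hasDerivWithinAt)
    (C := L) (fun s hs => by simpa using hb.third_le s hs) (hb.mem ht) (hb.add_mem ht hh)
  simpa using this

theorem abs_deriv_taylor_le (hb : LinkBounds b R₁ R₂ ε c₀ L) (ht : t ∈ Set.Icc R₁ R₂)
    (hh : |h| ≤ ε) :
    |deriv b (t + h) - deriv b t - iteratedDeriv 2 b t * h| ≤ L * h ^ 2 := by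
  have h1 : ∀ s ∈ Set.uIcc t (t + h), |s - t| ≤ |h| := fun s hs => by
    have := Set.abs_sub_left_of_mem_uIcc hs
    simpa using this
  have := (convex_uIcc t (t + h)).norm_image_sub_le_of_norm_hasDerivWithin_le
    (f := fun s => deriv b s - iteratedDeriv 2 b t * s)
    (f' := fun s => iteratedDeriv 2 b s - iteratedDeriv 2 b t)
    (fun s _ => by
      have := (hb.hasDerivAt_deriv s).fun_sub ((hasDerivAt_id s).const_mul (iteratedDeriv 2 b t))
      simpa using this.hasDerivWithinAt)
    (C := L * |h|) (fun s hs => by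
      have h2 := hb.abs_deriv2_sub_le ht (h := s - t) ((h1 s hs).trans hh)
      rw [show t + (s - t) = s by ring] at h2
      exact h2.trans (mul_le_mul_of_nonneg_left (h1 s hs) (by linarith [hb.one_le])))
    Set.left_mem_uIcc Set.right_mem_uIcc
  simp only [Real.norm_eq_abs, add_sub_cancel_left] at this
  calc _ = |deriv b (t + h) - iteratedDeriv 2 b t * (t + h) -
        (deriv b t - iteratedDeriv 2 b t * t)| := by congr 1; ring
    _ ≤ L * |h| * |h| := this
    _ = L * h ^ 2 := by rw [mul_assoc, ← sq, sq_abs]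

/-- Strong convexity of `b` near `[R₁, R₂]`. -/
theorem add_sq_le (hb : LinkBounds b R₁ R₂ ε c₀ L) (ht : t ∈ Set.Icc R₁ R₂) (hh : |h| ≤ ε) :
    b t + deriv b t * h + c₀ / 2 * h ^ 2 ≤ b (t + h) := by
  set g : ℝ → ℝ := fun s => b s - c₀ / 2 * s ^ 2 with hg
  have hg1 : ∀ s, HasDerivAt g (deriv b s - c₀ * s) s := fun s => by
    refine ((hb.differentiable s).hasDerivAt.fun_sub
      ((hasDerivAt_pow 2 s).const_mul (c₀ / 2))).congr_deriv ?_
    push_cast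
    ring
  have hdg : deriv g = fun s => deriv b s - c₀ * s := funext fun s => (hg1 s).deriv
  have hg2 : ∀ s, HasDerivAt (deriv g) (iteratedDeriv 2 b s - c₀) s := fun s => by
    rw [hdg]
    have := (hb.hasDerivAt_deriv s).fun_sub ((hasDerivAt_id s).const_mul c₀)
    simpa using this
  have hconv : ConvexOn ℝ (Set.Icc (R₁ - ε) (R₂ + ε)) g :=
    convexOn_of_deriv2_nonneg' (convex_Icc _ _)
      (fun s _ => (hg1 s).differentiableAt.differentiableWithinAt)
      (fun s _ => (hg2 s).differentiableAt.differentiableWithinAt)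
      (fun s hs => by
        rw [Function.iterate_succ, Function.iterate_one, Function.comp_apply, (hg2 s).deriv]
        linarith [hb.lower_le s hs])
  have key : g t + (deriv b t - c₀ * t) * h ≤ g (t + h) := by
    rcases lt_trichotomy h 0 with hneg | rfl | hpos
    · have := hconv.slope_le_of_hasDerivAt (hb.add_mem ht hh) (hb.mem ht) (by linarith) (hg1 t)
      rw [slope_def_field, div_le_iff₀ (by linarith)] at this
      linarith
    · simp
    · have := hconv.le_slope_of_hasDerivAt (hb.mem ht) (hb.add_mem ht hh) (by linarith) (hg1 t)
      rw [slope_def_field, le_div_iff₀ (by linarith)] at this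
      linarith
  simp only [hg] at key
  nlinarith

end LinkBounds

end Link

/-! ### Deterministic analysis of the two Lasso problems -/

section Lasso

variable {J ι : Type*} [Fintype J] [Fintype ι]

/-- The oracle inequality behind both Lasso estimators: from a basic inequality with curvature
`k * D` and a perturbation `e`, a restricted eigenvalue condition `hRE` bounds the prediction error
`D` and the `ℓ¹` error. If `e` is dominated by the error on the support, then the error lies in a
cone on which `hRE` is effective; otherwise `e` itself controls everything. -/
theorem lasso_oracle_bound {β Δ : J → ℝ} {S : Finset J} (hS : ∀ j ∉ S, β j = 0)
    {s k lam c₁ η e D : ℝ} (hs : (S.card : ℝ) ≤ s) (hk : 0 < k) (hlam : 0 < lam) (hc₁ : 0 < c₁)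
    (hη0 : 0 ≤ η) (he : 0 ≤ e) (hD : 0 ≤ D)
    (hbasic : k * D + lam * (∑ j, |β j + Δ j| - ∑ j, |β j|) ≤ lam / 2 * ∑ j, |Δ j| + e)
    (hRE : c₁ * ∑ j, Δ j ^ 2 - η * (∑ j, |Δ j|) ^ 2 ≤ D) (hη : 50 * η * s ≤ c₁) :
    D ≤ 8 * s * lam ^ 2 / (c₁ * k ^ 2) + 4 * e / k ∧
      ∑ j, |Δ j| ≤ 20 * s * lam / (c₁ * k) + 10 * e / lam := by
  classical
  have hs0 : 0 ≤ s := (Nat.cast_nonneg _).trans hs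
  set NS := ∑ j ∈ S, |Δ j| with hNS
  set NC := ∑ j ∈ Sᶜ, |Δ j| with hNC
  have hsplit : ∑ j, |Δ j| = NS + NC := (Finset.sum_add_sum_compl S _).symm
  have hNS0 : 0 ≤ NS := Finset.sum_nonneg fun _ _ => abs_nonneg _
  have hNC0 : 0 ≤ NC := Finset.sum_nonneg fun _ _ => abs_nonneg _
  have hdiff : NC - NS ≤ ∑ j, |β j + Δ j| - ∑ j, |β j| := by
    rw [← Finset.sum_sub_distrib, ← Finset.sum_add_sum_compl S]
    have h1 : -NS ≤ ∑ j ∈ S, (|β j + Δ j| - |β j|) := by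
      rw [hNS, ← Finset.sum_neg_distrib]
      refine Finset.sum_le_sum fun j _ => ?_
      have := abs_sub_abs_le_abs_sub (β j) (β j + Δ j)
      rw [show β j - (β j + Δ j) = -Δ j by ring, abs_neg] at this
      linarith
    have h2 : NC = ∑ j ∈ Sᶜ, (|β j + Δ j| - |β j|) := by
      refine Finset.sum_congr rfl fun j hj => ?_
      rw [hS j (Finset.mem_compl.1 hj)]; simp
    linarith
  rw [hsplit] at hbasic hRE ⊢
  have hkey : k * D + lam / 2 * NC ≤ 3 / 2 * lam * NS + e := by
    nlinarith [mul_le_mul_of_nonneg_left hdiff hlam.le]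
  have hkD : 0 ≤ k * D := by positivity
  by_cases hcase : e ≤ lam / 2 * NS
  · have hNC5 : NC ≤ 4 * NS := by nlinarith
    have hcs : NS ^ 2 ≤ s * ∑ j, Δ j ^ 2 := by
      have h1 := sq_sum_le_card_mul_sum_sq (s := S) (f := fun j => |Δ j|)
      have h2 : ∑ j ∈ S, |Δ j| ^ 2 ≤ ∑ j, Δ j ^ 2 := by
        simp only [sq_abs]
        exact Finset.sum_le_sum_of_subset_of_nonneg (Finset.subset_univ _) fun _ _ _ => sq_nonneg _
      have h3 : 0 ≤ ∑ j ∈ S, |Δ j| ^ 2 := Finset.sum_nonneg fun _ _ => sq_nonneg _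
      calc NS ^ 2 ≤ S.card * ∑ j ∈ S, |Δ j| ^ 2 := h1
        _ ≤ s * ∑ j, Δ j ^ 2 := by gcongr
    set T := ∑ j, Δ j ^ 2 with hT
    have hT0 : 0 ≤ T := Finset.sum_nonneg fun _ _ => sq_nonneg _
    have hD2 : c₁ / 2 * T ≤ D := by
      have h1 : (NS + NC) ^ 2 ≤ 25 * (s * T) := by
        have : (NS + NC) ^ 2 ≤ (5 * NS) ^ 2 := by gcongr; linarith
        nlinarith
      have h2 : η * (NS + NC) ^ 2 ≤ η * (25 * (s * T)) := by gcongr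
      have h3 : 50 * η * s * T ≤ c₁ * T := by gcongr
      nlinarith
    have hNSD : c₁ * NS ^ 2 ≤ 2 * s * D := by
      have : s * (c₁ / 2 * T) ≤ s * D := by gcongr
      nlinarith
    have hkD2 : k * D ≤ 2 * lam * NS := by nlinarith
    have hDle : D ≤ 8 * s * lam ^ 2 / (c₁ * k ^ 2) := by
      rw [le_div_iff₀ (by positivity)]
      rcases hD.eq_or_lt with h0 | h0
      · rw [← h0]; simp; positivity
      · have h1 : (k * D) ^ 2 ≤ (2 * lam * NS) ^ 2 := by gcongr
        have h2 : c₁ * (k * D) ^ 2 ≤ 4 * lam ^ 2 * (2 * s * D) := by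
          calc c₁ * (k * D) ^ 2 ≤ c₁ * (2 * lam * NS) ^ 2 := by gcongr
            _ = 4 * lam ^ 2 * (c₁ * NS ^ 2) := by ring
            _ ≤ _ := by gcongr
        have h3 : D * (D * (c₁ * k ^ 2)) ≤ D * (8 * s * lam ^ 2) := by nlinarith
        exact le_of_mul_le_mul_left h3 h0
    have hNSle : NS ≤ 4 * s * lam / (c₁ * k) := by
      rw [le_div_iff₀ (by positivity)]
      apply le_of_sq_le_sq _ (by positivity)
      have h1 : D * (c₁ * k ^ 2) ≤ 8 * s * lam ^ 2 := (le_div_iff₀ (by positivity)).1 hDle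
      calc (NS * (c₁ * k)) ^ 2 = (c₁ * NS ^ 2) * (c₁ * k ^ 2) := by ring
        _ ≤ (2 * s * D) * (c₁ * k ^ 2) := by gcongr
        _ = 2 * s * (D * (c₁ * k ^ 2)) := by ring
        _ ≤ 2 * s * (8 * s * lam ^ 2) := by gcongr
        _ = (4 * s * lam) ^ 2 := by ring
    have e1 : 0 ≤ 4 * e / k := by positivity
    have e2 : 0 ≤ 10 * e / lam := by positivity
    refine ⟨by linarith, ?_⟩
    have : 20 * s * lam / (c₁ * k) = 5 * (4 * s * lam / (c₁ * k)) := by ring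
    rw [this]; linarith
  · push Not at hcase
    have e1 : 0 ≤ 8 * s * lam ^ 2 / (c₁ * k ^ 2) := by positivity
    have e2 : 0 ≤ 20 * s * lam / (c₁ * k) := by positivity
    have h1 : D ≤ 4 * e / k := by rw [le_div_iff₀ hk]; nlinarith
    have h2 : NS + NC ≤ 10 * e / lam := by rw [le_div_iff₀ hlam]; nlinarith
    exact ⟨by linarith, by linarith⟩

theorem abs_dotProduct_le {B : ℝ} {v x : J → ℝ} (hx : ∀ j, |x j| ≤ B) :
    |v ⬝ᵥ x| ≤ B * ∑ j, |v j| := by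
  rw [dotProduct, Finset.mul_sum]
  refine (Finset.abs_sum_le_sum_abs _ _).trans (Finset.sum_le_sum fun j _ => ?_)
  rw [abs_mul, mul_comm]
  exact mul_le_mul_of_nonneg_right (hx j) (abs_nonneg _)

/-- A weighted sum of a linear functional of the design is controlled by its coordinates. -/
theorem abs_sum_mul_dotProduct_le {c : ι → ℝ} {x : ι → J → ℝ} {κ : ℝ} {v : J → ℝ}
    (h : ∀ j, |∑ i, c i * x i j| ≤ κ) : |∑ i, c i * (v ⬝ᵥ x i)| ≤ κ * ∑ j, |v j| := by
  have e : ∑ i, c i * (v ⬝ᵥ x i) = v ⬝ᵥ fun j => ∑ i, c i * x i j := by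
    simp only [dotProduct, Finset.mul_sum]
    rw [Finset.sum_comm]
    exact Finset.sum_congr rfl fun j _ => Finset.sum_congr rfl fun i _ => by ring
  rw [e]
  exact abs_dotProduct_le h

/-- Entrywise closeness of a weighted Gram matrix to `H` gives closeness of the quadratic forms
in the `ℓ¹` norm. -/
theorem abs_sum_mul_sq_sub_le {c : ι → ℝ} {x : ι → J → ℝ} {H : Matrix J J ℝ} {κ : ℝ}
    (h : ∀ j l, |∑ i, c i * (x i j * x i l) - H j l| ≤ κ) (v : J → ℝ) :
    |∑ i, c i * (v ⬝ᵥ x i) ^ 2 - v ⬝ᵥ (H *ᵥ v)| ≤ κ * (∑ j, |v j|) ^ 2 := by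
  have e : ∑ i, c i * (v ⬝ᵥ x i) ^ 2 - v ⬝ᵥ (H *ᵥ v) =
      v ⬝ᵥ fun j => v ⬝ᵥ fun l => ∑ i, c i * (x i j * x i l) - H j l := by
    have e1 : ∑ i, c i * (v ⬝ᵥ x i) ^ 2 =
        ∑ j, ∑ l, v j * (v l * ∑ i, c i * (x i j * x i l)) := by
      simp only [Finset.mul_sum]
      have : ∀ i, c i * (v ⬝ᵥ x i) ^ 2 = ∑ j, ∑ l, v j * (v l * (c i * (x i j * x i l))) := by
        intro i
        rw [sq, dotProduct, Finset.sum_mul_sum, Finset.mul_sum]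
        refine Finset.sum_congr rfl fun j _ => ?_
        rw [Finset.mul_sum]
        exact Finset.sum_congr rfl fun l _ => by ring
      simp_rw [this]
      rw [Finset.sum_comm]
      exact Finset.sum_congr rfl fun j _ => Finset.sum_comm
    rw [e1]
    simp only [dotProduct, Matrix.mulVec, mul_sub, Finset.mul_sum, Finset.sum_sub_distrib]
    congr 1
    exact Finset.sum_congr rfl fun j _ => Finset.sum_congr rfl fun l _ => by ring
  rw [e, sq, ← mul_assoc]
  exact abs_dotProduct_le fun j => abs_dotProduct_le fun l => h j l

/-- The restricted eigenvalue condition for the unweighted design. -/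
theorem restricted_eigenvalue {a q : ι → ℝ} {x : ι → J → ℝ} {H : Matrix J J ℝ} {κ C₁ L : ℝ}
    (ha : ∀ i, 0 ≤ a i) (hL : 0 < L) (hq : ∀ i, q i ≤ L)
    (hH : ∀ v : J → ℝ, C₁ * ∑ j, v j ^ 2 ≤ v ⬝ᵥ (H *ᵥ v))
    (h : ∀ j l, |∑ i, a i * q i * (x i j * x i l) - H j l| ≤ κ) (v : J → ℝ) :
    C₁ / L * ∑ j, v j ^ 2 - κ / L * (∑ j, |v j|) ^ 2 ≤ ∑ i, a i * (v ⬝ᵥ x i) ^ 2 := by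
  have h1 := abs_le.1 (abs_sum_mul_sq_sub_le h v)
  have h2 : ∑ i, a i * q i * (v ⬝ᵥ x i) ^ 2 ≤ L * ∑ i, a i * (v ⬝ᵥ x i) ^ 2 := by
    rw [Finset.mul_sum]
    refine Finset.sum_le_sum fun i _ => ?_
    have := mul_le_mul_of_nonneg_left (hq i) (mul_nonneg (ha i) (sq_nonneg (v ⬝ᵥ x i)))
    linarith
  have h3 := hH v
  have h4 : C₁ * ∑ j, v j ^ 2 - κ * (∑ j, |v j|) ^ 2 ≤ L * ∑ i, a i * (v ⬝ᵥ x i) ^ 2 := by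
    linarith [h1.1]
  rw [← sub_nonneg] at h4 ⊢
  have : ∑ i, a i * (v ⬝ᵥ x i) ^ 2 - (C₁ / L * ∑ j, v j ^ 2 - κ / L * (∑ j, |v j|) ^ 2) =
    (L * ∑ i, a i * (v ⬝ᵥ x i) ^ 2 - (C₁ * ∑ j, v j ^ 2 - κ * (∑ j, |v j|) ^ 2)) / L := by
    field_simp
  rw [this]
  positivity

/-- The `ℓ¹`-penalised weighted negative log-likelihood of a canonical generalised linear model. -/
def penalizedLoss (b : ℝ → ℝ) (a y : ι → ℝ) (x : ι → J → ℝ) (lam : ℝ) (β : J → ℝ) : ℝ :=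
  ∑ i, a i * (b (β ⬝ᵥ x i) - y i * (β ⬝ᵥ x i)) + lam * ∑ j, |β j|

section GLM

variable {b : ℝ → ℝ} {R₁ R₂ ε c₀ L : ℝ} {a y : ι → ℝ} {x : ι → J → ℝ} {lam : ℝ} {β₀ : J → ℝ}

theorem continuous_penalizedLoss (hb : Continuous b) : Continuous (penalizedLoss b a y x lam) := by
  unfold penalizedLoss dotProduct
  fun_prop

theorem penalizedLoss_segment_le (hb : ConvexOn ℝ Set.univ b) (ha : ∀ i, 0 ≤ a i)
    (hlam : 0 ≤ lam) (β : J → ℝ) {t : ℝ} (ht0 : 0 ≤ t) (ht1 : t ≤ 1) :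
    penalizedLoss b a y x lam (β₀ + t • (β - β₀)) ≤
      (1 - t) * penalizedLoss b a y x lam β₀ + t * penalizedLoss b a y x lam β := by
  have h1 : ∀ i, (β₀ + t • (β - β₀)) ⬝ᵥ x i = (1 - t) * (β₀ ⬝ᵥ x i) + t * (β ⬝ᵥ x i) := by
    intro i
    rw [add_dotProduct, smul_dotProduct, sub_dotProduct, smul_eq_mul]; ring
  unfold penalizedLoss
  simp_rw [h1]
  have h2 : ∑ i, a i * (b ((1 - t) * (β₀ ⬝ᵥ x i) + t * (β ⬝ᵥ x i)) -
      y i * ((1 - t) * (β₀ ⬝ᵥ x i) + t * (β ⬝ᵥ x i))) ≤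
      (1 - t) * ∑ i, a i * (b (β₀ ⬝ᵥ x i) - y i * (β₀ ⬝ᵥ x i)) +
      t * ∑ i, a i * (b (β ⬝ᵥ x i) - y i * (β ⬝ᵥ x i)) := by
    rw [Finset.mul_sum, Finset.mul_sum, ← Finset.sum_add_distrib]
    refine Finset.sum_le_sum fun i _ => ?_
    have := hb.2 (Set.mem_univ (β₀ ⬝ᵥ x i)) (Set.mem_univ (β ⬝ᵥ x i))
      (sub_nonneg.2 ht1) ht0 (by ring)
    simp only [smul_eq_mul] at this
    nlinarith [mul_le_mul_of_nonneg_left this (ha i)]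
  have h3 : ∑ j, |(β₀ + t • (β - β₀)) j| ≤ (1 - t) * ∑ j, |β₀ j| + t * ∑ j, |β j| := by
    rw [Finset.mul_sum, Finset.mul_sum, ← Finset.sum_add_distrib]
    refine Finset.sum_le_sum fun j _ => ?_
    have : (β₀ + t • (β - β₀)) j = (1 - t) * β₀ j + t * β j := by
      simp only [Pi.add_apply, Pi.smul_apply, Pi.sub_apply, smul_eq_mul]; ring
    rw [this]
    refine (abs_add_le _ _).trans ?_
    rw [abs_mul, abs_mul, abs_of_nonneg ht0, abs_of_nonneg (sub_nonneg.2 ht1)]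
  nlinarith [mul_le_mul_of_nonneg_left h3 hlam]

variable {B s c₁ η : ℝ} {S : Finset J}

/-- A parameter close to `β₀` that does not increase the penalised loss obeys the Lasso rates. -/
theorem penalizedLoss_local_bound (hb : LinkBounds b R₁ R₂ ε c₀ L) (ha : ∀ i, 0 ≤ a i)
    (hlam : 0 < lam) (hc₁ : 0 < c₁) (hη0 : 0 ≤ η) (hx : ∀ i j, |x i j| ≤ B)
    (hβ₀ : ∀ i, β₀ ⬝ᵥ x i ∈ Set.Icc R₁ R₂) (hS : ∀ j ∉ S, β₀ j = 0) (hs : (S.card : ℝ) ≤ s)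
    (hscore : ∀ j, |∑ i, a i * (deriv b (β₀ ⬝ᵥ x i) - y i) * x i j| ≤ lam / 2)
    (hRE : ∀ v : J → ℝ, c₁ * ∑ j, v j ^ 2 - η * (∑ j, |v j|) ^ 2 ≤ ∑ i, a i * (v ⬝ᵥ x i) ^ 2)
    (hη : 50 * η * s ≤ c₁) {Δ : J → ℝ} (hΔ : B * ∑ j, |Δ j| ≤ ε)
    (hle : penalizedLoss b a y x lam (β₀ + Δ) ≤ penalizedLoss b a y x lam β₀) :
    ∑ i, a i * (Δ ⬝ᵥ x i) ^ 2 ≤ 32 * s * lam ^ 2 / (c₁ * c₀ ^ 2) ∧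
      ∑ j, |Δ j| ≤ 40 * s * lam / (c₁ * c₀) := by
  have hc₀ := hb.lower_pos
  have hD : 0 ≤ ∑ i, a i * (Δ ⬝ᵥ x i) ^ 2 :=
    Finset.sum_nonneg fun i _ => mul_nonneg (ha i) (sq_nonneg _)
  have hsc := abs_sum_mul_dotProduct_le (v := Δ) hscore
  have hloss : ∑ i, a i * (deriv b (β₀ ⬝ᵥ x i) - y i) * (Δ ⬝ᵥ x i) +
      c₀ / 2 * ∑ i, a i * (Δ ⬝ᵥ x i) ^ 2 ≤
      ∑ i, a i * (b ((β₀ + Δ) ⬝ᵥ x i) - y i * ((β₀ + Δ) ⬝ᵥ x i)) -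
      ∑ i, a i * (b (β₀ ⬝ᵥ x i) - y i * (β₀ ⬝ᵥ x i)) := by
    rw [Finset.mul_sum, ← Finset.sum_add_distrib, ← Finset.sum_sub_distrib]
    refine Finset.sum_le_sum fun i _ => ?_
    have h1 : |Δ ⬝ᵥ x i| ≤ ε := (abs_dotProduct_le (hx i)).trans hΔ
    have h2 := hb.add_sq_le (hβ₀ i) h1
    rw [add_dotProduct]
    nlinarith [mul_le_mul_of_nonneg_left h2 (ha i)]
  have hbasic : c₀ / 2 * ∑ i, a i * (Δ ⬝ᵥ x i) ^ 2 +
      lam * (∑ j, |β₀ j + Δ j| - ∑ j, |β₀ j|) ≤ lam / 2 * ∑ j, |Δ j| + 0 := by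
    unfold penalizedLoss at hle
    simp only [Pi.add_apply] at hle
    linarith [(abs_le.1 hsc).1]
  have := lasso_oracle_bound hS hs (by positivity) hlam hc₁ hη0 le_rfl hD hbasic (hRE Δ) hη
  refine ⟨this.1.trans (le_of_eq ?_), this.2.trans (le_of_eq ?_)⟩ <;> field_simp <;> ring

/-- Rates for the Lasso in a canonical generalised linear model. The loss is strongly convex only
near `β₀`; convexity forces every point of the sublevel set of `β₀` into this neighbourhood, which
also yields the existence of a minimiser. -/
theorem lasso_rates (hb : LinkBounds b R₁ R₂ ε c₀ L) (hconv : ConvexOn ℝ Set.univ b)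
    (ha : ∀ i, 0 ≤ a i)
    (hlam : 0 < lam) (hc₁ : 0 < c₁) (hη0 : 0 ≤ η) (hB : 0 < B) (hx : ∀ i j, |x i j| ≤ B)
    (hβ₀ : ∀ i, β₀ ⬝ᵥ x i ∈ Set.Icc R₁ R₂) (hS : ∀ j ∉ S, β₀ j = 0) (hs : (S.card : ℝ) ≤ s)
    (hscore : ∀ j, |∑ i, a i * (deriv b (β₀ ⬝ᵥ x i) - y i) * x i j| ≤ lam / 2)
    (hRE : ∀ v : J → ℝ, c₁ * ∑ j, v j ^ 2 - η * (∑ j, |v j|) ^ 2 ≤ ∑ i, a i * (v ⬝ᵥ x i) ^ 2)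
    (hη : 50 * η * s ≤ c₁) (hsmall : 40 * s * lam / (c₁ * c₀) < ε / B) {β : J → ℝ}
    (hβ : SelectsArgmin (penalizedLoss b a y x lam) Set.univ β) :
    ∑ i, a i * ((β - β₀) ⬝ᵥ x i) ^ 2 ≤ 32 * s * lam ^ 2 / (c₁ * c₀ ^ 2) ∧
      ∑ j, |(β - β₀) j| ≤ 40 * s * lam / (c₁ * c₀) := by
  set f := penalizedLoss b a y x lam with hf
  have hlocal : ∀ Δ : J → ℝ, ∑ j, |Δ j| ≤ ε / B → f (β₀ + Δ) ≤ f β₀ →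
      ∑ i, a i * (Δ ⬝ᵥ x i) ^ 2 ≤ 32 * s * lam ^ 2 / (c₁ * c₀ ^ 2) ∧
      ∑ j, |Δ j| ≤ 40 * s * lam / (c₁ * c₀) := fun Δ h1 h2 =>
    penalizedLoss_local_bound hb ha hlam hc₁ hη0 hx hβ₀ hS hs hscore hRE hη
      (by rwa [le_div_iff₀' hB] at h1) h2
  have hεB : 0 < ε / B := div_pos hb.eps_pos hB
  have hA : ∀ β, f β ≤ f β₀ → ∑ j, |(β - β₀) j| ≤ ε / B := by
    intro β hle
    by_contra! hN
    set N := ∑ j, |(β - β₀) j| with hNdef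
    have hN0 : 0 < N := hεB.trans hN
    set t := ε / B / N with ht
    have ht0 : 0 ≤ t := by positivity
    have ht1 : t ≤ 1 := by rw [ht, div_le_one hN0]; exact hN.le
    have h1 := penalizedLoss_segment_le (x := x) (y := y) (β₀ := β₀) hconv ha hlam.le β ht0 ht1
    have h2 : ∑ j, |(t • (β - β₀)) j| = ε / B := by
      simp only [Pi.smul_apply, smul_eq_mul, abs_mul, abs_of_nonneg ht0]
      rw [← Finset.mul_sum, ← hNdef, ht]; field_simp
    have h3 := (hlocal _ h2.le (h1.trans (by nlinarith))).2
    rw [h2] at h3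
    linarith
  have hex : ∃ z ∈ Set.univ, IsMinOn f Set.univ z := by
    set K : Set (J → ℝ) := {β | ∑ j, |(β - β₀) j| ≤ ε / B} with hK
    have hKc : IsCompact K := by
      apply Metric.isCompact_of_isClosed_isBounded
      · exact isClosed_le (by fun_prop) continuous_const
      · refine (Metric.isBounded_closedBall (x := β₀) (r := ε / B)).subset fun β hβ => ?_
        rw [mem_closedBall_iff_norm, pi_norm_le_iff_of_nonneg hεB.le]
        exact fun j => (Finset.single_le_sum (f := fun j => |(β - β₀) j|)
          (fun _ _ => abs_nonneg _) (Finset.mem_univ j)).trans hβ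
    have hmem : β₀ ∈ K := by simp [hK, hεB.le]
    obtain ⟨z, hz, hmin⟩ := hKc.exists_isMinOn ⟨β₀, hmem⟩
      (continuous_penalizedLoss hb.differentiable.continuous).continuousOn (f := f)
    refine ⟨z, trivial, fun β _ => ?_⟩
    by_cases hβ : β ∈ K
    · exact hmin hβ
    · refine (show f z ≤ f β₀ from hmin hmem).trans ?_
      by_contra hlt
      exact hβ (hA β (not_le.1 hlt).le)
  have hle : f β ≤ f β₀ := (hβ hex).2 (Set.mem_univ β₀)
  exact hlocal _ (hA β hle) (by rwa [add_sub_cancel])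

end GLM

/-- Rates for one row of the projection Lasso, whose weights `q'` are estimates of `q`: the
estimation error of the weights enters through the prediction error `E` of the pilot. -/
theorem weighted_lasso_rates {a q q' z h : ι → ℝ} {u : ι → J → ℝ} {w w₀ : J → ℝ}
    {S : Finset J} {s τ c₀ c₁ η L B E : ℝ} (ha : ∀ i, 0 ≤ a i) (hc₀ : 0 < c₀) (hL : 0 ≤ L)
    (hτ : 0 < τ) (hc₁ : 0 < c₁) (hη0 : 0 ≤ η) (hq' : ∀ i, c₀ ≤ q' i)
    (hqq : ∀ i, |q' i - q i| ≤ L * |h i|) (hE : ∑ i, a i * h i ^ 2 ≤ E)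
    (hres : ∀ i, |z i - w₀ ⬝ᵥ u i| ≤ 2 * B)
    (hscore : ∀ j, |∑ i, a i * q i * (z i - w₀ ⬝ᵥ u i) * u i j| ≤ τ / 4)
    (hS : ∀ j ∉ S, w₀ j = 0) (hs : (S.card : ℝ) ≤ s)
    (hRE : ∀ v : J → ℝ, c₁ * ∑ j, v j ^ 2 - η * (∑ j, |v j|) ^ 2 ≤ ∑ i, a i * (v ⬝ᵥ u i) ^ 2)
    (hη : 50 * η * s ≤ c₁)
    (hle : ∑ i, a i * (q' i * (z i - w ⬝ᵥ u i) ^ 2) + τ * ∑ j, |w j| ≤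
      ∑ i, a i * (q' i * (z i - w₀ ⬝ᵥ u i) ^ 2) + τ * ∑ j, |w₀ j|) :
    ∑ i, a i * ((w - w₀) ⬝ᵥ u i) ^ 2 ≤
        32 * s * τ ^ 2 / (c₁ * c₀ ^ 2) + 64 * B ^ 2 * L ^ 2 * E / c₀ ^ 2 ∧
      ∑ j, |(w - w₀) j| ≤ 40 * s * τ / (c₁ * c₀) + 80 * B ^ 2 * L ^ 2 * E / (c₀ * τ) := by
  set Δ := w - w₀ with hΔ
  have hE0 : 0 ≤ E := (Finset.sum_nonneg fun i _ => mul_nonneg (ha i) (sq_nonneg _)).trans hE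
  have hD : 0 ≤ ∑ i, a i * (Δ ⬝ᵥ u i) ^ 2 :=
    Finset.sum_nonneg fun i _ => mul_nonneg (ha i) (sq_nonneg _)
  have hsc := abs_sum_mul_dotProduct_le (v := Δ) hscore
  have hpt : ∑ i, a i * (q' i * (z i - w₀ ⬝ᵥ u i) ^ 2) +
      (c₀ / 2 * ∑ i, a i * (Δ ⬝ᵥ u i) ^ 2 -
        2 * ∑ i, a i * q i * (z i - w₀ ⬝ᵥ u i) * (Δ ⬝ᵥ u i) -
        8 * B ^ 2 * L ^ 2 / c₀ * ∑ i, a i * h i ^ 2) ≤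
      ∑ i, a i * (q' i * (z i - w ⬝ᵥ u i) ^ 2) := by
    rw [Finset.mul_sum, Finset.mul_sum, Finset.mul_sum, ← Finset.sum_sub_distrib,
      ← Finset.sum_sub_distrib, ← Finset.sum_add_distrib]
    refine Finset.sum_le_sum fun i _ => ?_
    have e1 : w ⬝ᵥ u i = w₀ ⬝ᵥ u i + Δ ⬝ᵥ u i := by rw [hΔ, sub_dotProduct]; ring
    set e := z i - w₀ ⬝ᵥ u i with he
    set v := Δ ⬝ᵥ u i with hv
    have e2 : z i - w ⬝ᵥ u i = e - v := by rw [e1, he]; ring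
    rw [e2]
    have h1 : |(q' i - q i) * e * v| ≤ L * |h i| * (2 * B) * |v| := by
      rw [abs_mul, abs_mul]
      gcongr
      · exact hqq i
      · exact hres i
    -- Young's inequality, with the weight that absorbs half of the curvature
    have h2 : 2 * (L * |h i| * (2 * B) * |v|) ≤
        c₀ / 2 * v ^ 2 + 8 * B ^ 2 * L ^ 2 / c₀ * h i ^ 2 := by
      have h3 : 0 ≤ (c₀ * |v| - 4 * B * L * |h i|) ^ 2 / (2 * c₀) := by positivity
      have h4 : (c₀ * |v| - 4 * B * L * |h i|) ^ 2 / (2 * c₀) =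
          c₀ / 2 * |v| ^ 2 + 8 * B ^ 2 * L ^ 2 / c₀ * |h i| ^ 2 -
          2 * (L * |h i| * (2 * B) * |v|) := by field_simp; ring
      rw [h4, sq_abs, sq_abs] at h3
      linarith
    have h5 : q' i * e ^ 2 + (c₀ / 2 * v ^ 2 - 2 * (q i * e * v) -
        8 * B ^ 2 * L ^ 2 / c₀ * h i ^ 2) ≤ q' i * (e - v) ^ 2 := by
      have h6 := mul_le_mul_of_nonneg_right (hq' i) (sq_nonneg v)
      have h7 := (abs_le.1 h1).2
      nlinarith
    have := mul_le_mul_of_nonneg_left h5 (ha i)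
    linarith
  have hEE : 8 * B ^ 2 * L ^ 2 / c₀ * ∑ i, a i * h i ^ 2 ≤ 8 * B ^ 2 * L ^ 2 / c₀ * E := by gcongr
  have hw : ∀ j, w j = w₀ j + Δ j := fun j => by simp [hΔ]
  have hbasic : c₀ / 2 * ∑ i, a i * (Δ ⬝ᵥ u i) ^ 2 +
      τ * (∑ j, |w₀ j + Δ j| - ∑ j, |w₀ j|) ≤
      τ / 2 * ∑ j, |Δ j| + 8 * B ^ 2 * L ^ 2 / c₀ * E := by
    simp_rw [← hw]
    linarith [(abs_le.1 hsc).2]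
  have := lasso_oracle_bound hS hs (by positivity) hτ hc₁ hη0 (by positivity) hD hbasic (hRE Δ) hη
  refine ⟨this.1.trans (le_of_eq ?_), this.2.trans (le_of_eq ?_)⟩ <;> field_simp <;> ring

end Lasso

/-! ### The approximate inverse of the information matrix -/

section Clime

theorem exists_isMinOn_of_l1_le {α β : Type*} [Fintype α] [Fintype β] {s : Set (α → β → ℝ)}
    (hs : IsClosed s) (hne : s.Nonempty) {f : (α → β → ℝ) → ℝ} (hf : Continuous f) {τ : ℝ}
    (hτ : 0 < τ) (hle : ∀ w, τ * ∑ k, ∑ j, |w k j| ≤ f w) : ∃ y ∈ s, IsMinOn f s y := by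
  obtain ⟨w₀, hw₀⟩ := hne
  set K : Set (α → β → ℝ) := {w | τ * ∑ k, ∑ j, |w k j| ≤ f w₀} with hK
  have hKc : IsCompact K := by
    apply Metric.isCompact_of_isClosed_isBounded
    · exact isClosed_le (by fun_prop) continuous_const
    · have hf0 : 0 ≤ f w₀ / τ := div_nonneg
        ((by positivity : (0 : ℝ) ≤ τ * ∑ k, ∑ j, |w₀ k j|).trans (hle w₀)) hτ.le
      refine (Metric.isBounded_closedBall (x := (0 : α → β → ℝ)) (r := f w₀ / τ)).subset
        fun w hw => ?_
      rw [mem_closedBall_zero_iff, pi_norm_le_iff_of_nonneg hf0]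
      intro k
      rw [pi_norm_le_iff_of_nonneg hf0]
      intro j
      rw [le_div_iff₀' hτ]
      refine le_trans (mul_le_mul_of_nonneg_left ?_ hτ.le) hw
      rw [Real.norm_eq_abs]
      exact (Finset.single_le_sum (f := fun j => |w k j|) (fun _ _ => abs_nonneg _)
        (Finset.mem_univ j)).trans (Finset.single_le_sum (f := fun k => ∑ j, |w k j|)
        (fun _ _ => Finset.sum_nonneg fun _ _ => abs_nonneg _) (Finset.mem_univ k))
  obtain ⟨z, hz, hmin⟩ := (hKc.inter_left hs).exists_isMinOn ⟨w₀, hw₀, hle w₀⟩ hf.continuousOn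
  refine ⟨z, hz.1, fun w hw => ?_⟩
  by_cases hwK : w ∈ K
  · exact hmin ⟨hw, hwK⟩
  · refine (show f z ≤ f w₀ from hmin ⟨hw₀, hle w₀⟩).trans ?_
    exact (not_le.1 hwK).le.trans (hle w)

variable {d : ℕ} {Φ Θ A G : Matrix (Fin d) (Fin d) ℝ} {B₁ η g : ℝ}

theorem abs_mul_apply_le {M N : Matrix (Fin d) (Fin d) ℝ} {η : ℝ} (h : ∀ k l, |N k l| ≤ η)
    (k l : Fin d) : |(M * N) k l| ≤ η * ∑ j, |M k j| := by
  rw [Matrix.mul_apply']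
  exact abs_dotProduct_le fun j => h j l

/-- The estimation error of a minimiser of the entrywise `ℓ¹` norm under the max-norm constraint.
Constraint and objective decouple over rows, so that every row of the minimiser has at most the
`ℓ¹` norm of the corresponding row of the true inverse `Θ`. -/
theorem clime_bounds (hΘΦ : Θ * Φ = 1) (hΦΘ : Φ * Θ = 1) (hsymm : ∀ k l, Θ k l = Θ l k)
    (hη0 : 0 ≤ η) (hrow : ∀ k, ∑ l, |Θ k l| ≤ B₁) (hA : ∀ k l, |A k l - Φ k l| ≤ η)
    (hg : B₁ * η ≤ g) (hG : SelectsArgmin entrywiseL1 (climeFeasible A g) G) :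
    (∀ k, ∑ l, |G k l| ≤ ∑ l, |Θ k l|) ∧
      ∀ k l, |G k l - Θ k l| ≤ B₁ * (g + B₁ * η) := by
  have hdiff : ∀ k l, |(A - Φ) k l| ≤ η := hA
  have hΘA : ∀ k l, |(Θ * A - 1) k l| ≤ g := fun k l => by
    have e : Θ * A - 1 = Θ * (A - Φ) := by rw [mul_sub, hΘΦ]
    rw [e]
    refine (abs_mul_apply_le hdiff k l).trans (le_trans ?_ hg)
    rw [mul_comm]
    exact mul_le_mul_of_nonneg_right (hrow k) hη0
  have hclosed : IsClosed (climeFeasible A g) := by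
    simp only [climeFeasible, Set.ofPred_forall]
    refine isClosed_iInter fun k => isClosed_iInter fun l => ?_
    refine isClosed_le ?_ continuous_const
    simp only [Matrix.sub_apply, Matrix.mul_apply]
    fun_prop
  have hcont : Continuous (entrywiseL1 : Matrix (Fin d) (Fin d) ℝ → ℝ) := by
    unfold entrywiseL1
    fun_prop
  obtain ⟨hGf, hGmin⟩ := hG (exists_isMinOn_of_l1_le hclosed ⟨Θ, hΘA⟩ hcont one_pos
    fun w => by rw [one_mul]; exact le_rfl)
  have hrows : ∀ k, ∑ l, |G k l| ≤ ∑ l, |Θ k l| := by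
    intro k
    have hfeas : G.updateRow k (Θ k) ∈ climeFeasible A g := by
      intro k' l
      by_cases hk : k' = k
      · subst hk
        have := hΘA k' l
        simpa [Matrix.mul_apply, Matrix.updateRow_self] using this
      · have := hGf k' l
        simpa [Matrix.mul_apply, Matrix.updateRow_ne hk] using this
    have h1 : entrywiseL1 G ≤ entrywiseL1 (G.updateRow k (Θ k)) := hGmin hfeas
    simp only [entrywiseL1] at h1
    rw [← Finset.add_sum_erase _ _ (Finset.mem_univ k),
      ← Finset.add_sum_erase (a := k) _ (fun k' => ∑ l, |G.updateRow k (Θ k) k' l|)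
        (Finset.mem_univ k)] at h1
    have h2 : ∑ k' ∈ Finset.univ.erase k, ∑ l, |G.updateRow k (Θ k) k' l| =
        ∑ k' ∈ Finset.univ.erase k, ∑ l, |G k' l| :=
      Finset.sum_congr rfl fun k' hk' => by
        rw [Matrix.updateRow_ne (Finset.ne_of_mem_erase hk')]
    rw [h2, Matrix.updateRow_self] at h1
    linarith
  refine ⟨hrows, fun k l => ?_⟩
  have h1 : ∀ k l, |(G * Φ - 1) k l| ≤ g + B₁ * η := fun k l => by
    have e : G * Φ - 1 = (G * A - 1) - G * (A - Φ) := by rw [mul_sub]; abel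
    rw [e, Matrix.sub_apply]
    refine (abs_sub _ _).trans (add_le_add (hGf k l) ((abs_mul_apply_le hdiff k l).trans ?_))
    rw [mul_comm]
    exact mul_le_mul_of_nonneg_right ((hrows k).trans (hrow k)) hη0
  have e : G - Θ = (G * Φ - 1) * Θ := by
    rw [sub_mul, mul_assoc, hΦΘ, mul_one, one_mul]
  have hg0 : 0 ≤ g + B₁ * η := (abs_nonneg _).trans (h1 k l)
  rw [← Matrix.sub_apply, e, Matrix.mul_apply', dotProduct_comm]
  refine (abs_dotProduct_le (h1 k)).trans ?_
  rw [mul_comm]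
  refine mul_le_mul_of_nonneg_right ?_ hg0
  simp_rw [fun j => hsymm j l]
  exact hrow l

theorem abs_symmetrize_le (k l : Fin d) : |symmetrize G k l| ≤ |G k l| := by
  unfold symmetrize
  split_ifs with h
  · exact le_rfl
  · exact (not_le.1 h).le

theorem abs_symmetrize_sub_le {ζ : ℝ} (hsymm : ∀ k l, Θ k l = Θ l k)
    (h : ∀ k l, |G k l - Θ k l| ≤ ζ) (k l : Fin d) : |symmetrize G k l - Θ k l| ≤ ζ := by
  unfold symmetrize
  split_ifs
  · exact h k l
  · rw [hsymm]; exact h l k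

theorem sum_abs_le_of_sparse {J : Type*} [Fintype J] {θ : J → ℝ} {ζ C : ℝ} (hζ : 0 ≤ ζ)
    (hle : ∀ j, |θ j| ≤ ζ) (hsparse : ({j | θ j ≠ 0}.ncard : ℝ) ≤ C) : ∑ j, |θ j| ≤ C * ζ := by
  classical
  have hcard : {j | θ j ≠ 0}.ncard = (Finset.univ.filter fun j => θ j ≠ 0).card := by
    rw [← Set.ncard_coe_finset]; congr 1; ext j; simp
  rw [hcard] at hsparse
  rw [← Finset.sum_filter_of_ne (p := fun j => θ j ≠ 0) fun j _ h => by simpa using h]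
  refine (Finset.sum_le_card_nsmul _ _ ζ fun j _ => hle j).trans ?_
  rw [nsmul_eq_mul]
  gcongr

/-- A vector close to a sparse one in the max norm, and not larger in the `ℓ¹` norm, is close to it
in the `ℓ¹` norm. -/
theorem sum_abs_sub_le_of_sparse {J : Type*} [Fintype J] {v θ : J → ℝ} {ζ C : ℝ} (hζ : 0 ≤ ζ)
    (hle : ∑ j, |v j| ≤ ∑ j, |θ j|) (hclose : ∀ j, |v j - θ j| ≤ ζ)
    (hsparse : ({j | θ j ≠ 0}.ncard : ℝ) ≤ C) : ∑ j, |v j - θ j| ≤ 2 * C * ζ := by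
  classical
  set S : Finset J := Finset.univ.filter fun j => θ j ≠ 0 with hS
  have hcard : (S.card : ℝ) ≤ C := by
    have : {j | θ j ≠ 0}.ncard = S.card := by
      rw [← Set.ncard_coe_finset]; congr 1; ext j; simp [hS]
    rwa [this] at hsparse
  have hSc : ∀ j ∈ Sᶜ, θ j = 0 := fun j hj => by simpa [hS] using hj
  have h1 : ∑ j ∈ S, |v j - θ j| ≤ C * ζ := by
    calc ∑ j ∈ S, |v j - θ j| ≤ S.card • ζ := Finset.sum_le_card_nsmul _ _ _ fun j _ => hclose j
      _ ≤ C * ζ := by rw [nsmul_eq_mul]; gcongr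
  have h2 : ∑ j ∈ Sᶜ, |v j - θ j| = ∑ j ∈ Sᶜ, |v j| :=
    Finset.sum_congr rfl fun j hj => by rw [hSc j hj, sub_zero]
  have h3 : ∑ j ∈ Sᶜ, |θ j| = 0 := Finset.sum_eq_zero fun j hj => by rw [hSc j hj, abs_zero]
  have h4 : ∑ j ∈ S, |θ j| - ∑ j ∈ S, |v j| ≤ ∑ j ∈ S, |v j - θ j| := by
    rw [← Finset.sum_sub_distrib]
    refine Finset.sum_le_sum fun j _ => ?_
    rw [abs_sub_comm]
    exact abs_sub_abs_le_abs_sub _ _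
  rw [← Finset.sum_add_sum_compl S, ← Finset.sum_add_sum_compl S (fun j => |θ j|)] at hle
  rw [← Finset.sum_add_sum_compl S, h2]
  linarith

end Clime

/-! ### Deterministic bounds for the plug-in errors -/

section PlugIn

variable {ι : Type*} [Fintype ι] {a : ι → ℝ} {E D : ℝ}

/-- The weighted Cauchy–Schwarz inequality. -/
theorem sum_mul_abs_mul_abs_le (ha : ∀ i, 0 ≤ a i) {h v : ι → ℝ}
    (hE : ∑ i, a i * h i ^ 2 ≤ E) (hD : ∑ i, a i * v i ^ 2 ≤ D) :
    ∑ i, a i * (|h i| * |v i|) ≤ √(E * D) := by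
  have hE0 : 0 ≤ E := (Finset.sum_nonneg fun i _ => mul_nonneg (ha i) (sq_nonneg _)).trans hE
  have h1 := Real.sum_mul_le_sqrt_mul_sqrt Finset.univ (fun i => √(a i) * |h i|)
    (fun i => √(a i) * |v i|)
  have e1 : ∀ w : ι → ℝ, ∑ i, (√(a i) * |w i|) ^ 2 = ∑ i, a i * w i ^ 2 := fun w =>
    Finset.sum_congr rfl fun i _ => by rw [mul_pow, Real.sq_sqrt (ha i), sq_abs]
  have e2 : ∑ i, √(a i) * |h i| * (√(a i) * |v i|) = ∑ i, a i * (|h i| * |v i|) :=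
    Finset.sum_congr rfl fun i _ => by
      rw [show √(a i) * |h i| * (√(a i) * |v i|) = √(a i) * √(a i) * (|h i| * |v i|) by ring,
        Real.mul_self_sqrt (ha i)]
  rw [e1, e1, e2] at h1
  refine h1.trans ?_
  rw [Real.sqrt_mul hE0]
  gcongr

theorem sum_mul_abs_le (ha : ∀ i, 0 ≤ a i) {h : ι → ℝ} {A : ℝ} (hA : ∑ i, a i ≤ A)
    (hE : ∑ i, a i * h i ^ 2 ≤ E) : ∑ i, a i * |h i| ≤ √(A * E) := by
  have := sum_mul_abs_mul_abs_le ha (h := fun _ => 1) (v := h) (by simpa using hA) hE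
  simpa using this

variable {B L : ℝ} {q e h v : ι → ℝ}

/-- The first-order expansion of a coordinate of the score at estimated parameters. -/
theorem abs_score_remainder_le {ε ρ : ι → ℝ} {t κ₁ κ₂ : ℝ} (ha : ∀ i, 0 ≤ a i)
    (hL : 0 ≤ L) (hεv : |∑ i, a i * (ε i * v i)| ≤ κ₁)
    (hqe : |∑ i, a i * (q i * h i * e i) - t| ≤ κ₂) (hq : ∀ i, |q i| ≤ L)
    (hρ : ∀ i, |ρ i| ≤ L * h i ^ 2) (hev : ∀ i, |e i - v i| ≤ 3 * B)
    (hE : ∑ i, a i * h i ^ 2 ≤ E) (hD : ∑ i, a i * v i ^ 2 ≤ D) (hB : 0 ≤ B) :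
    |∑ i, a i * ((ε i + q i * h i + ρ i) * (e i - v i)) - ∑ i, a i * (ε i * e i) - t| ≤
      κ₁ + κ₂ + L * √(E * D) + 3 * B * L * E := by
  have h1 : |∑ i, a i * (q i * h i * v i)| ≤ L * √(E * D) := by
    calc |∑ i, a i * (q i * h i * v i)| ≤ ∑ i, |a i * (q i * h i * v i)| :=
          Finset.abs_sum_le_sum_abs _ _
      _ ≤ ∑ i, L * (a i * (|h i| * |v i|)) := by
          refine Finset.sum_le_sum fun i _ => ?_
          rw [abs_mul, abs_mul, abs_mul, abs_of_nonneg (ha i)]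
          have h2 : |q i| * (|h i| * |v i|) ≤ L * (|h i| * |v i|) := by gcongr; exact hq i
          nlinarith [mul_le_mul_of_nonneg_left h2 (ha i)]
      _ ≤ L * √(E * D) := by
          rw [← Finset.mul_sum]
          exact mul_le_mul_of_nonneg_left (sum_mul_abs_mul_abs_le ha hE hD) hL
  have h2 : |∑ i, a i * (ρ i * (e i - v i))| ≤ 3 * B * L * E := by
    calc |∑ i, a i * (ρ i * (e i - v i))| ≤ ∑ i, |a i * (ρ i * (e i - v i))| :=
          Finset.abs_sum_le_sum_abs _ _
      _ ≤ ∑ i, 3 * B * L * (a i * h i ^ 2) := by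
          refine Finset.sum_le_sum fun i _ => ?_
          rw [abs_mul, abs_mul, abs_of_nonneg (ha i)]
          have h3 : |ρ i| * |e i - v i| ≤ L * h i ^ 2 * (3 * B) := by
            gcongr
            · exact hρ i
            · exact hev i
          nlinarith [mul_le_mul_of_nonneg_left h3 (ha i)]
      _ ≤ 3 * B * L * E := by
          rw [← Finset.mul_sum]
          gcongr
  have e1 : ∑ i, a i * ((ε i + q i * h i + ρ i) * (e i - v i)) - ∑ i, a i * (ε i * e i) - t =
      -∑ i, a i * (ε i * v i) + (∑ i, a i * (q i * h i * e i) - t) -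
      ∑ i, a i * (q i * h i * v i) + ∑ i, a i * (ρ i * (e i - v i)) := by
    have : ∑ i, a i * ((ε i + q i * h i + ρ i) * (e i - v i)) = ∑ i, a i * (ε i * e i) -
        ∑ i, a i * (ε i * v i) + ∑ i, a i * (q i * h i * e i) -
        ∑ i, a i * (q i * h i * v i) + ∑ i, a i * (ρ i * (e i - v i)) := by
      simp only [← Finset.sum_add_distrib, ← Finset.sum_sub_distrib]
      exact Finset.sum_congr rfl fun i _ => by ring
    rw [this]; ring
  rw [e1]
  rw [abs_le] at *
  constructor <;> linarith [h1.1, h1.2, h2.1, h2.2]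

/-- The error of an entry of the plug-in information matrix. -/
theorem abs_information_plugin_sub_le {q' e' v' : ι → ℝ} {t κ D' : ℝ} (ha : ∀ i, 0 ≤ a i)
    (hA : ∑ i, a i ≤ 2) (hL : 0 ≤ L) (hB : 0 ≤ B) (hee : |∑ i, a i * (q i * (e i * e' i)) - t| ≤ κ)
    (hqq : ∀ i, |q' i - q i| ≤ L * |h i|) (hq' : ∀ i, |q' i| ≤ L)
    (he : ∀ i, |e i| ≤ 2 * B) (he' : ∀ i, |e' i| ≤ 2 * B) (hev' : ∀ i, |e' i - v' i| ≤ 3 * B)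
    (hE : ∑ i, a i * h i ^ 2 ≤ E) (hD : ∑ i, a i * v i ^ 2 ≤ D)
    (hD' : ∑ i, a i * v' i ^ 2 ≤ D') :
    |∑ i, a i * (q' i * ((e i - v i) * (e' i - v' i))) - t| ≤
      κ + 4 * B ^ 2 * L * √(2 * E) + 3 * B * L * (√(2 * D) + √(2 * D')) := by
  have hpt : ∀ i, |q' i * ((e i - v i) * (e' i - v' i)) - q i * (e i * e' i)| ≤
      4 * B ^ 2 * L * |h i| + 3 * B * L * (|v i| + |v' i|) := by
    intro i
    have e1 : q' i * ((e i - v i) * (e' i - v' i)) - q i * (e i * e' i) =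
        (q' i - q i) * (e i * e' i) + (-(q' i * (v i * (e' i - v' i))) - q' i * (e i * v' i)) := by
      ring
    rw [e1]
    have h1 : |(q' i - q i) * (e i * e' i)| ≤ L * |h i| * (2 * B * (2 * B)) := by
      rw [abs_mul, abs_mul]
      gcongr
      exacts [hqq i, he i, he' i]
    have h2 : |q' i * (v i * (e' i - v' i))| ≤ L * (|v i| * (3 * B)) := by
      rw [abs_mul, abs_mul]
      gcongr
      exacts [hq' i, hev' i]
    have h3 : |q' i * (e i * v' i)| ≤ L * (3 * B * |v' i|) := by
      rw [abs_mul, abs_mul]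
      gcongr
      exacts [hq' i, (he i).trans (by linarith)]
    refine (abs_add_le _ _).trans ?_
    have h4 := abs_sub (-(q' i * (v i * (e' i - v' i)))) (q' i * (e i * v' i))
    rw [abs_neg] at h4
    linarith
  have h1 : |∑ i, a i * (q' i * ((e i - v i) * (e' i - v' i))) -
      ∑ i, a i * (q i * (e i * e' i))| ≤
      4 * B ^ 2 * L * √(2 * E) + 3 * B * L * (√(2 * D) + √(2 * D')) := by
    rw [← Finset.sum_sub_distrib]
    calc _ ≤ ∑ i, |a i * (q' i * ((e i - v i) * (e' i - v' i))) - a i * (q i * (e i * e' i))| :=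
          Finset.abs_sum_le_sum_abs _ _
      _ ≤ ∑ i, (4 * B ^ 2 * L * (a i * |h i|) + 3 * B * L * (a i * |v i| + a i * |v' i|)) := by
          refine Finset.sum_le_sum fun i _ => ?_
          rw [← mul_sub, abs_mul, abs_of_nonneg (ha i)]
          have := mul_le_mul_of_nonneg_left (hpt i) (ha i)
          linarith
      _ = 4 * B ^ 2 * L * ∑ i, a i * |h i| +
          3 * B * L * (∑ i, a i * |v i| + ∑ i, a i * |v' i|) := by
          rw [Finset.sum_add_distrib, ← Finset.mul_sum, ← Finset.mul_sum, Finset.sum_add_distrib]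
      _ ≤ _ := by
          gcongr
          exacts [sum_mul_abs_le ha hA hE, sum_mul_abs_le ha hA hD, sum_mul_abs_le ha hA hD']
  have h2 := abs_sub_le (∑ i, a i * (q' i * ((e i - v i) * (e' i - v' i))))
    (∑ i, a i * (q i * (e i * e' i))) t
  linarith

/-- The debiased estimator, once its score is expanded up to `ω`. -/
theorem abs_debiased_remainder_le {d : ℕ} {Φ Θ G : Matrix (Fin d) (Fin d) ℝ}
    {T T' Δ : Fin d → ℝ} {κ ω ξ B₁ B₂ N : ℝ} (hΘΦ : Θ * Φ = 1) (hB₂ : 0 ≤ B₂) (hω : 0 ≤ ω)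
    (hT : ∀ k, |T k| ≤ κ) (hT' : ∀ k, |T' k - T k - (Φ *ᵥ Δ) k| ≤ ω)
    (hΦ : ∀ k l, |Φ k l| ≤ B₂) (hΔ : ∑ k, |Δ k| ≤ N) (hN : 0 ≤ κ)
    (hG : ∀ k, ∑ l, |G k l| ≤ B₁) (hGΘ : ∀ k, ∑ l, |G k l - Θ k l| ≤ ξ) (k : Fin d) :
    |(Δ - G *ᵥ T' + Θ *ᵥ T) k| ≤ ξ * (κ + B₂ * N) + B₁ * ω := by
  have e : Δ - G *ᵥ T' + Θ *ᵥ T = -((G - Θ) *ᵥ (T + Φ *ᵥ Δ)) - G *ᵥ (T' - T - Φ *ᵥ Δ) := by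
    have h1 : Θ *ᵥ (Φ *ᵥ Δ) = Δ := by rw [Matrix.mulVec_mulVec, hΘΦ, Matrix.one_mulVec]
    simp only [Matrix.sub_mulVec, Matrix.mulVec_add, Matrix.mulVec_sub, h1]
    abel
  rw [e, Pi.sub_apply, Pi.neg_apply]
  have hN0 : 0 ≤ N := (Finset.sum_nonneg fun _ _ => abs_nonneg _).trans hΔ
  have h1 : |((G - Θ) *ᵥ (T + Φ *ᵥ Δ)) k| ≤ ξ * (κ + B₂ * N) := by
    rw [Matrix.mulVec]
    refine (abs_dotProduct_le (B := κ + B₂ * N) fun j => ?_).trans ?_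
    · rw [Pi.add_apply]
      refine (abs_add_le _ _).trans (add_le_add (hT j) ?_)
      rw [Matrix.mulVec, dotProduct_comm]
      exact (abs_dotProduct_le (hΦ j)).trans (mul_le_mul_of_nonneg_left hΔ hB₂)
    · rw [mul_comm]
      exact mul_le_mul_of_nonneg_right (hGΘ k) (by positivity)
  have h2 : |(G *ᵥ (T' - T - Φ *ᵥ Δ)) k| ≤ B₁ * ω := by
    rw [Matrix.mulVec]
    refine (abs_dotProduct_le (B := ω) fun j => hT' j).trans ?_
    rw [mul_comm]
    exact mul_le_mul_of_nonneg_right (hG k) hω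
  have h3 := abs_sub (-((G - Θ) *ᵥ (T + Φ *ᵥ Δ)) k) ((G *ᵥ (T' - T - Φ *ᵥ Δ)) k)
  rw [abs_neg] at h3
  linarith

end PlugIn

/-! ### Population quantities -/

section Spectrum

variable {J : Type*} [Fintype J] [DecidableEq J]

/-- A lower bound on the spectrum of a symmetric matrix bounds its quadratic form from below. -/
theorem le_dotProduct_mulVec_of_spectrum {A : Matrix J J ℝ} (hA : A.IsHermitian) {c : ℝ}
    (h : ∀ a ∈ spectrum ℝ A, c ≤ a) (v : J → ℝ) : c * ∑ j, v j ^ 2 ≤ v ⬝ᵥ (A *ᵥ v) := by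
  have hpsd : (A - algebraMap ℝ (Matrix J J ℝ) c).PosSemidef := by
    rw [Matrix.posSemidef_iff_isHermitian_and_spectrum_nonneg]
    refine ⟨hA.sub ?_, ?_⟩
    · rw [Matrix.algebraMap_eq_diagonal]
      exact Matrix.isHermitian_diagonal _
    · rw [← spectrum.sub_singleton_eq]
      rintro _ ⟨a, ha, _, rfl, rfl⟩
      simpa using h a ha
  have h1 := hpsd.dotProduct_mulVec_nonneg v
  rw [Algebra.algebraMap_eq_smul_one, Matrix.sub_mulVec, Matrix.smul_mulVec, Matrix.one_mulVec,
    star_trivial, dotProduct_sub, dotProduct_smul, smul_eq_mul] at h1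
  have h2 : v ⬝ᵥ v = ∑ j, v j ^ 2 := by simp only [dotProduct, sq]
  rw [h2] at h1
  linarith

theorem isUnit_det_of_mulVec_injective {A : Matrix J J ℝ}
    (h : ∀ v, A *ᵥ v = 0 → v = 0) : IsUnit A.det := by
  rw [isUnit_iff_ne_zero]
  intro h0
  obtain ⟨v, hv, hv0⟩ := Matrix.exists_mulVec_eq_zero_iff.2 h0
  exact hv (h v hv0)

theorem eq_zero_of_mul_sum_sq_nonpos {J : Type*} [Fintype J] {c : ℝ} (hc : 0 < c) {v : J → ℝ}
    (h : c * ∑ j, v j ^ 2 ≤ 0) : v = 0 := by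
  have h1 : ∑ j, v j ^ 2 ≤ 0 := nonpos_of_mul_nonpos_right h hc
  have h2 := (Finset.sum_eq_zero_iff_of_nonneg fun j _ => sq_nonneg (v j)).1
    (le_antisymm h1 (Finset.sum_nonneg fun _ _ => sq_nonneg _))
  ext j
  simpa using h2 j (Finset.mem_univ j)

end Spectrum

section Population

variable {d m : ℕ}

theorem hessian_comm (b : ℝ → ℝ) (β₀ : Param d m) (P : Measure (Obs d m)) (i j) :
    hessian b β₀ P i j = hessian b β₀ P j i := by
  unfold hessian
  congr 1; ext o; ring

theorem decorrelated_apply (w : Matrix (Fin d) (Fin m) ℝ) (x : Fin d ⊕ Fin m → ℝ) (k : Fin d) :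
    decorrelated w x k = x (Sum.inl k) - w k ⬝ᵥ nuisance x := rfl

/-- The population conditions with a common bound `B ≥ 1`, and their pointwise consequences. -/
structure BoundedModel (b : ℝ → ℝ) (C₁ B R₁ R₂ κ Cg L : ℝ) (β₀ : Param d m)
    (P : Measure (Obs d m)) : Prop where
  eigenvalues : ∀ a ∈ spectrum ℝ (hessian b β₀ P), C₁ ≤ a
  covariates_le : ∀ᵐ o ∂P, ∀ j, |o.2 j| ≤ B
  decorrelated_le : ∀ᵐ o ∂P, ∀ k, |decorrelated (projection b β₀ P) o.2 k| ≤ 2 * B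
  predictor_mem : ∀ᵐ o ∂P, β₀ ⬝ᵥ o.2 ∈ Set.Icc R₁ R₂
  weight_le : ∀ᵐ o ∂P, |iteratedDeriv 2 b (β₀ ⬝ᵥ o.2)| ≤ L
  subexponential :
    ∫⁻ o, ENNReal.ofReal (Real.exp (|deriv b (β₀ ⬝ᵥ o.2) - o.1| / B)) ∂P ≤ 2
  singularValues : ∀ a ∈ spectrum ℝ ((information b β₀ P)ᵀ * information b β₀ P), κ ^ 2 ≤ a
  rows_sparse : ∀ k, ({l | (information b β₀ P)⁻¹ k l ≠ 0}.ncard : ℝ) ≤ Cg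

variable {b : ℝ → ℝ} {C₁ C₂ C R₁ R₂ κ Cg ε c₀ L B : ℝ} {β₀ : Param d m} {P : Measure (Obs d m)}

theorem lintegral_exp_le_of_psiOneNorm_lt {α : Type*} [MeasurableSpace α] {P : Measure α}
    {Y : α → ℝ} {B : ℝ} (h : psiOneNorm P Y < ENNReal.ofReal B) :
    ∫⁻ a, ENNReal.ofReal (Real.exp (|Y a| / B)) ∂P ≤ 2 := by
  simp only [psiOneNorm, iInf_lt_iff] at h
  obtain ⟨t, ht0, ht, htB⟩ := h
  have htB' : t ≤ B := (ENNReal.ofReal_lt_ofReal_iff_of_nonneg ht0.le |>.1 htB).le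
  refine (lintegral_mono fun a => ?_).trans ht
  apply ENNReal.ofReal_le_ofReal
  rw [Real.exp_le_exp]
  exact div_le_div_of_nonneg_left (abs_nonneg _) ht0 htB'

theorem PopulationConditions.boundedModel (hb : LinkBounds b R₁ R₂ ε c₀ L) (hκ : 0 < κ)
    (h : PopulationConditions b C₁ C₂ C R₁ R₂ κ Cg β₀ P) :
    BoundedModel b C₁ (|C| + 1) R₁ R₂ κ Cg L β₀ P where
  eigenvalues a ha := (h.eigenvalues ha).1
  covariates_le := h.covariates_le.mono fun o ho j => (ho j).trans (by linarith [le_abs_self C])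
  decorrelated_le := by
    filter_upwards [h.covariates_le, h.projection_le] with o h1 h2 k
    have h3 := abs_sub (o.2 (Sum.inl k)) ((projection b β₀ P *ᵥ nuisance o.2) k)
    have h4 : decorrelated (projection b β₀ P) o.2 k =
      o.2 (Sum.inl k) - (projection b β₀ P *ᵥ nuisance o.2) k := rfl
    rw [h4]
    linarith [h1 (Sum.inl k), h2 k, le_abs_self C]
  predictor_mem := h.predictor_mem
  weight_le := h.predictor_mem.mono fun o ho => by
    rw [abs_of_nonneg (hb.lower_pos.le.trans (hb.lower_le _ (hb.mem ho)))]
    exact hb.le_upper _ (hb.mem ho)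
  subexponential := by
    have h1 : psiOneNorm P (fun o => o.1 - deriv b (β₀ ⬝ᵥ o.2)) < ENNReal.ofReal (|C| + 1) := by
      refine h.residual_le.trans_lt ?_
      rw [ENNReal.ofReal_lt_ofReal_iff (by positivity)]
      linarith [le_abs_self C]
    have := lintegral_exp_le_of_psiOneNorm_lt h1
    simpa only [abs_sub_comm] using this
  singularValues a ha := by
    have h1 := h.singularValues a ha
    exact (Real.le_sqrt' hκ).1 h1
  rows_sparse k := (h.rows_sparse k).le

theorem measurable_dotProduct_snd (β₀ : Param d m) :
    Measurable fun o : Obs d m => β₀ ⬝ᵥ o.2 := by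
  simp only [dotProduct]
  fun_prop

theorem measurable_decorrelated (w : Matrix (Fin d) (Fin m) ℝ) (k : Fin d) :
    Measurable fun o : Obs d m => decorrelated w o.2 k := by
  simp only [decorrelated_apply, dotProduct, nuisance]
  fun_prop

namespace BoundedModel

theorem hessian_lower (h : BoundedModel b C₁ B R₁ R₂ κ Cg L β₀ P) (v : Fin d ⊕ Fin m → ℝ) :
    C₁ * ∑ j, v j ^ 2 ≤ v ⬝ᵥ (hessian b β₀ P *ᵥ v) :=
  le_dotProduct_mulVec_of_spectrum (by ext i j; simp [hessian_comm b β₀ P i j]) h.eigenvalues v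

theorem nuisance_lower (h : BoundedModel b C₁ B R₁ R₂ κ Cg L β₀ P) (v : Fin m → ℝ) :
    C₁ * ∑ j, v j ^ 2 ≤ v ⬝ᵥ ((hessian b β₀ P).toBlocks₂₂ *ᵥ v) := by
  have := h.hessian_lower (Sum.elim 0 v)
  simpa [dotProduct, Matrix.mulVec, Matrix.toBlocks₂₂] using this

theorem projection_mul (h : BoundedModel b C₁ B R₁ R₂ κ Cg L β₀ P) (hC₁ : 0 < C₁) :
    projection b β₀ P * (hessian b β₀ P).toBlocks₂₂ = (hessian b β₀ P).toBlocks₁₂ := by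
  have hu : IsUnit (hessian b β₀ P).toBlocks₂₂.det := by
    refine isUnit_det_of_mulVec_injective fun v hv => eq_zero_of_mul_sum_sq_nonpos hC₁ ?_
    have := h.nuisance_lower v
    rwa [hv, dotProduct_zero] at this
  rw [projection, Matrix.mul_assoc, Matrix.nonsing_inv_mul _ hu, Matrix.mul_one]

theorem measurable_weight (hb : LinkBounds b R₁ R₂ ε c₀ L) (β₀ : Param d m) :
    Measurable fun o : Obs d m => iteratedDeriv 2 b (β₀ ⬝ᵥ o.2) :=
  hb.differentiable_deriv2.continuous.measurable.comp (measurable_dotProduct_snd β₀)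

theorem measurable_score (hb : LinkBounds b R₁ R₂ ε c₀ L) (β₀ : Param d m) :
    Measurable fun o : Obs d m => deriv b (β₀ ⬝ᵥ o.2) - o.1 :=
  (hb.differentiable_deriv.continuous.measurable.comp (measurable_dotProduct_snd β₀)).sub
    measurable_fst

theorem abs_weight_mul_le (h : BoundedModel b C₁ B R₁ R₂ κ Cg L β₀ P) (hL : 0 ≤ L)
    {f g : Obs d m → ℝ} {M N : ℝ} (hM : 0 ≤ M) (hf : ∀ᵐ o ∂P, |f o| ≤ M)
    (hg : ∀ᵐ o ∂P, |g o| ≤ N) :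
    ∀ᵐ o ∂P, |iteratedDeriv 2 b (β₀ ⬝ᵥ o.2) * (f o * g o)| ≤ L * (M * N) := by
  filter_upwards [h.weight_le, hf, hg] with o h1 h2 h3
  rw [abs_mul, abs_mul]
  gcongr

theorem integrable_weight_mul [IsProbabilityMeasure P]
    (h : BoundedModel b C₁ B R₁ R₂ κ Cg L β₀ P)
    (hb : LinkBounds b R₁ R₂ ε c₀ L) {f g : Obs d m → ℝ} (hfm : Measurable f) (hgm : Measurable g)
    {M N : ℝ} (hM : 0 ≤ M) (hf : ∀ᵐ o ∂P, |f o| ≤ M) (hg : ∀ᵐ o ∂P, |g o| ≤ N) :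
    Integrable (fun o => iteratedDeriv 2 b (β₀ ⬝ᵥ o.2) * (f o * g o)) P :=
  Integrable.of_bound ((measurable_weight hb β₀).mul (hfm.mul hgm)).aestronglyMeasurable _
    (h.abs_weight_mul_le (by linarith [hb.one_le]) hM hf hg)

theorem measurable_covariate (j : Fin d ⊕ Fin m) : Measurable fun o : Obs d m => o.2 j :=
  (measurable_pi_apply j).comp measurable_snd

/-- Decorrelation acts linearly on the population moments. -/
theorem integral_weight_mul_decorrelated [IsProbabilityMeasure P]
    (h : BoundedModel b C₁ B R₁ R₂ κ Cg L β₀ P)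
    (hb : LinkBounds b R₁ R₂ ε c₀ L) {f : Obs d m → ℝ} (hfm : Measurable f)
    {M : ℝ} (hM : 0 ≤ M) (hf : ∀ᵐ o ∂P, |f o| ≤ M) (w : Matrix (Fin d) (Fin m) ℝ) (k : Fin d) :
    ∫ o, iteratedDeriv 2 b (β₀ ⬝ᵥ o.2) * (f o * decorrelated w o.2 k) ∂P =
      ∫ o, iteratedDeriv 2 b (β₀ ⬝ᵥ o.2) * (f o * o.2 (Sum.inl k)) ∂P -
      ∑ i, w k i * ∫ o, iteratedDeriv 2 b (β₀ ⬝ᵥ o.2) * (f o * o.2 (Sum.inr i)) ∂P := by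
  have hint : ∀ j, Integrable (fun o => iteratedDeriv 2 b (β₀ ⬝ᵥ o.2) * (f o * o.2 j)) P :=
    fun j => h.integrable_weight_mul hb hfm (measurable_covariate j) hM hf
      (h.covariates_le.mono fun o ho => ho j)
  have e : ∀ o : Obs d m, iteratedDeriv 2 b (β₀ ⬝ᵥ o.2) * (f o * decorrelated w o.2 k) =
      iteratedDeriv 2 b (β₀ ⬝ᵥ o.2) * (f o * o.2 (Sum.inl k)) -
      ∑ i, w k i * (iteratedDeriv 2 b (β₀ ⬝ᵥ o.2) * (f o * o.2 (Sum.inr i))) := by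
    intro o
    have e1 : w k ⬝ᵥ nuisance o.2 = ∑ i, w k i * o.2 (Sum.inr i) := rfl
    rw [decorrelated_apply, e1, mul_sub, mul_sub, Finset.mul_sum, Finset.mul_sum]
    congr 1
    exact Finset.sum_congr rfl fun i _ => by ring
  simp_rw [e]
  rw [integral_sub (hint _) (integrable_finsetSum _ fun i _ => (hint _).const_mul _),
    integral_finsetSum _ fun i _ => (hint _).const_mul _]
  simp_rw [integral_const_mul]

theorem integral_decorrelated_mul_nuisance [IsProbabilityMeasure P]
    (h : BoundedModel b C₁ B R₁ R₂ κ Cg L β₀ P)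
    (hb : LinkBounds b R₁ R₂ ε c₀ L) (hC₁ : 0 < C₁) (hB : 0 ≤ B) (k : Fin d) (j : Fin m) :
    ∫ o, iteratedDeriv 2 b (β₀ ⬝ᵥ o.2) *
      (decorrelated (projection b β₀ P) o.2 k * o.2 (Sum.inr j)) ∂P = 0 := by
  have h1 := h.integral_weight_mul_decorrelated hb (measurable_covariate (Sum.inr j)) hB
    (h.covariates_le.mono fun o ho => ho _) (projection b β₀ P) k
  simp_rw [mul_comm (decorrelated _ _ _)]
  rw [h1]
  have h2 := congrFun (congrFun (h.projection_mul hC₁) k) j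
  rw [Matrix.mul_apply] at h2
  simp only [Matrix.toBlocks₂₂, Matrix.toBlocks₁₂, Matrix.of_apply] at h2
  have e1 : ∫ o, iteratedDeriv 2 b (β₀ ⬝ᵥ o.2) * (o.2 (Sum.inr j) * o.2 (Sum.inl k)) ∂P =
    hessian b β₀ P (Sum.inl k) (Sum.inr j) := hessian_comm b β₀ P _ _
  have e2 : ∀ i, ∫ o, iteratedDeriv 2 b (β₀ ⬝ᵥ o.2) * (o.2 (Sum.inr j) * o.2 (Sum.inr i)) ∂P =
    hessian b β₀ P (Sum.inr i) (Sum.inr j) := fun i => hessian_comm b β₀ P _ _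
  simp_rw [e1, e2]
  rw [h2, sub_self]

/-- `Φ` is also the covariance of the decorrelated covariates, hence symmetric. -/
theorem integral_decorrelated_mul_decorrelated [IsProbabilityMeasure P]
    (h : BoundedModel b C₁ B R₁ R₂ κ Cg L β₀ P)
    (hb : LinkBounds b R₁ R₂ ε c₀ L) (hC₁ : 0 < C₁) (hB : 0 ≤ B) (k l : Fin d) :
    ∫ o, iteratedDeriv 2 b (β₀ ⬝ᵥ o.2) * (decorrelated (projection b β₀ P) o.2 k *
      decorrelated (projection b β₀ P) o.2 l) ∂P = information b β₀ P k l := by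
  rw [h.integral_weight_mul_decorrelated hb (measurable_decorrelated _ k) (M := 2 * B)
    (by positivity) (h.decorrelated_le.mono fun o ho => ho k)]
  simp_rw [h.integral_decorrelated_mul_nuisance hb hC₁ hB]
  simp [information, target]

theorem information_comm [IsProbabilityMeasure P]
    (h : BoundedModel b C₁ B R₁ R₂ κ Cg L β₀ P)
    (hb : LinkBounds b R₁ R₂ ε c₀ L) (hC₁ : 0 < C₁) (hB : 0 ≤ B) (k l : Fin d) :
    information b β₀ P k l = information b β₀ P l k := by
  rw [← h.integral_decorrelated_mul_decorrelated hb hC₁ hB,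
    ← h.integral_decorrelated_mul_decorrelated hb hC₁ hB]
  simp_rw [mul_comm (decorrelated (projection b β₀ P) _ k)]

theorem abs_information_le [IsProbabilityMeasure P]
    (h : BoundedModel b C₁ B R₁ R₂ κ Cg L β₀ P)
    (hb : LinkBounds b R₁ R₂ ε c₀ L) (hB : 0 ≤ B) (k l : Fin d) :
    |information b β₀ P k l| ≤ L * (2 * B * B) := by
  have h1 := h.abs_weight_mul_le (by linarith [hb.one_le]) (M := 2 * B) (by positivity)
    (h.decorrelated_le.mono fun o ho => ho k) (h.covariates_le.mono fun o ho => ho (Sum.inl l))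
  have := norm_integral_le_of_norm_le_const (h1.mono fun o ho => (Real.norm_eq_abs _).trans_le ho)
  simpa [information, target] using this

theorem information_lower (h : BoundedModel b C₁ B R₁ R₂ κ Cg L β₀ P) (v : Fin d → ℝ) :
    κ ^ 2 * ∑ k, v k ^ 2 ≤ ∑ k, (information b β₀ P *ᵥ v) k ^ 2 := by
  have h1 := le_dotProduct_mulVec_of_spectrum
    (Matrix.isHermitian_conjTranspose_mul_self (information b β₀ P)) h.singularValues v
  rw [Matrix.conjTranspose_eq_transpose_of_trivial, ← Matrix.mulVec_mulVec,
    Matrix.dotProduct_mulVec, Matrix.vecMul_transpose] at h1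
  simpa only [dotProduct, ← sq] using h1

theorem isUnit_det_information (h : BoundedModel b C₁ B R₁ R₂ κ Cg L β₀ P) (hκ : 0 < κ) :
    IsUnit (information b β₀ P).det := by
  refine isUnit_det_of_mulVec_injective fun v hv =>
    eq_zero_of_mul_sum_sq_nonpos (pow_pos hκ 2) ?_
  have := h.information_lower v
  simpa [hv] using this

theorem inv_information_comm [IsProbabilityMeasure P]
    (h : BoundedModel b C₁ B R₁ R₂ κ Cg L β₀ P)
    (hb : LinkBounds b R₁ R₂ ε c₀ L) (hC₁ : 0 < C₁) (hB : 0 ≤ B) (k l : Fin d) :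
    (information b β₀ P)⁻¹ k l = (information b β₀ P)⁻¹ l k := by
  have h1 : (information b β₀ P)ᵀ = information b β₀ P := by
    ext k l; exact h.information_comm hb hC₁ hB l k
  have h2 := Matrix.transpose_nonsing_inv (information b β₀ P)
  rw [h1] at h2
  exact congrFun (congrFun h2 l) k

/-- Sparsity of the rows and the bound on the operator norm bound the `ℓ¹` norms of the rows. -/
theorem sum_abs_inv_information_le [IsProbabilityMeasure P]
    (h : BoundedModel b C₁ B R₁ R₂ κ Cg L β₀ P)
    (hb : LinkBounds b R₁ R₂ ε c₀ L) (hC₁ : 0 < C₁) (hB : 0 ≤ B) (hκ : 0 < κ) (k : Fin d) :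
    ∑ l, |(information b β₀ P)⁻¹ k l| ≤ |Cg| / κ := by
  set Θ := (information b β₀ P)⁻¹ with hΘ
  have hmul : information b β₀ P * Θ = 1 := Matrix.mul_nonsing_inv _ (h.isUnit_det_information hκ)
  have h1 := h.information_lower (Θ *ᵥ Pi.single k 1)
  rw [Matrix.mulVec_mulVec, hmul, Matrix.one_mulVec] at h1
  have h2 : ∑ l, (Pi.single k 1 : Fin d → ℝ) l ^ 2 = 1 := by
    simp [Pi.single_apply]
  rw [h2] at h1
  have hentry : ∀ l, |Θ k l| ≤ 1 / κ := by
    intro l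
    have h3 : (Θ *ᵥ Pi.single k 1) l = Θ k l := by
      rw [Matrix.mulVec_single_one]
      exact h.inv_information_comm hb hC₁ hB l k
    have h4 : Θ k l ^ 2 ≤ ∑ l, (Θ *ᵥ Pi.single k 1) l ^ 2 := by
      rw [← h3]
      exact Finset.single_le_sum (f := fun l => (Θ *ᵥ Pi.single k 1) l ^ 2)
        (fun _ _ => sq_nonneg _) (Finset.mem_univ l)
    rw [le_div_iff₀ hκ]
    apply abs_le_of_sq_le_sq' _ zero_le_one |>.2
    rw [mul_pow, sq_abs]
    nlinarith [mul_le_mul_of_nonneg_left h4 (sq_nonneg κ)]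
  have h5 := sum_abs_le_of_sparse (by positivity) hentry
    ((h.rows_sparse k).trans (le_abs_self _))
  rwa [mul_one_div] at h5

end BoundedModel

end Population

/-! ### Samples whose empirical moments are close to the population moments -/

/-- The weights of the observations in `subsampleMean`. -/
noncomputable def sampleWeight {n : ℕ} (r : ℝ) (δ : Fin n → Bool) (i : Fin n) : ℝ :=
  if δ i = true then 1 / r else 0

theorem subsampleMean_eq_sum {d m n : ℕ} (r : ℝ) (o : Fin n → Obs d m) (δ : Fin n → Bool)
    (F : Obs d m → ℝ) : subsampleMean r o δ F = ∑ i, sampleWeight r δ i * F (o i) := by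
  rw [subsampleMean, Finset.mul_sum]
  exact Finset.sum_congr rfl fun i _ => by unfold sampleWeight; split_ifs <;> simp

theorem sampleWeight_nonneg {n : ℕ} {r : ℝ} (hr : 0 < r) (δ : Fin n → Bool) (i : Fin n) :
    0 ≤ sampleWeight r δ i := by
  unfold sampleWeight; split_ifs <;> positivity

/-- Index set of the empirical moments entering the analysis. -/
abbrev MomentIndex (d m : ℕ) : Type :=
  Unit ⊕ ((Fin d ⊕ Fin m) × (Fin d ⊕ Fin m)) ⊕ (Fin d × (Fin d ⊕ Fin m)) ⊕ (Fin d × Fin d) ⊕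
    (Fin d ⊕ Fin m) ⊕ Fin d

/-- The functions whose empirical means have to concentrate: the constant `1`, the entries of the
Hessian, of the cross moments of the decorrelated covariates with all covariates, of the information
matrix, and the scores with respect to the covariates and to the decorrelated covariates. -/
noncomputable def momentFunction {d m : ℕ} (b : ℝ → ℝ) (β₀ : Param d m) (w : Matrix (Fin d) (Fin m) ℝ) :
    MomentIndex d m → Obs d m → ℝ
  | .inl _ => fun _ => 1
  | .inr (.inl q) => fun o => iteratedDeriv 2 b (β₀ ⬝ᵥ o.2) * (o.2 q.1 * o.2 q.2)
  | .inr (.inr (.inl q)) => fun o =>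
      iteratedDeriv 2 b (β₀ ⬝ᵥ o.2) * (decorrelated w o.2 q.1 * o.2 q.2)
  | .inr (.inr (.inr (.inl q))) => fun o =>
      iteratedDeriv 2 b (β₀ ⬝ᵥ o.2) * (decorrelated w o.2 q.1 * decorrelated w o.2 q.2)
  | .inr (.inr (.inr (.inr (.inl j)))) => fun o => (deriv b (β₀ ⬝ᵥ o.2) - o.1) * o.2 j
  | .inr (.inr (.inr (.inr (.inr k)))) => fun o =>
      (deriv b (β₀ ⬝ᵥ o.2) - o.1) * decorrelated w o.2 k

theorem card_momentIndex_le {d m : ℕ} (h : 1 ≤ d + m) :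
    (Fintype.card (MomentIndex d m) : ℝ) ≤ 6 * ((d + m : ℕ) : ℝ) ^ 2 := by
  have : Fintype.card (MomentIndex d m) ≤ 6 * (d + m) ^ 2 := by
    simp only [MomentIndex, Fintype.card_sum, Fintype.card_prod, Fintype.card_unit,
      Fintype.card_fin]
    nlinarith [Nat.zero_le (d * m), Nat.zero_le (m * m)]
  exact_mod_cast this

section Moments

variable {d m n : ℕ} {b : ℝ → ℝ} {C₁ R₁ R₂ κ Cg ε c₀ L B : ℝ} {β₀ : Param d m}
  {P : Measure (Obs d m)}

theorem measurable_momentFunction (hb : LinkBounds b R₁ R₂ ε c₀ L)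
    (w : Matrix (Fin d) (Fin m) ℝ) (M : MomentIndex d m) :
    Measurable (momentFunction b β₀ w M) := by
  have h1 := BoundedModel.measurable_weight (d := d) (m := m) hb β₀
  have h2 := BoundedModel.measurable_score (d := d) (m := m) hb β₀
  have h3 := BoundedModel.measurable_covariate (d := d) (m := m)
  have h4 := measurable_decorrelated w
  rcases M with _ | ⟨j, l⟩ | ⟨k, j⟩ | ⟨k, l⟩ | j | k
  · exact measurable_const
  · exact h1.mul ((h3 j).mul (h3 l))
  · exact h1.mul ((h4 k).mul (h3 j))
  · exact h1.mul ((h4 k).mul (h4 l))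
  · exact h2.mul (h3 j)
  · exact h2.mul (h4 k)

theorem BoundedModel.lintegral_exp_score_mul_le (h : BoundedModel b C₁ B R₁ R₂ κ Cg L β₀ P)
    (hB : 1 ≤ B) (hL : 1 ≤ L) {f : Obs d m → ℝ} (hf : ∀ᵐ o ∂P, |f o| ≤ 2 * B) :
    ∫⁻ o, ENNReal.ofReal (Real.exp (|(deriv b (β₀ ⬝ᵥ o.2) - o.1) * f o| / (8 * L * B ^ 2))) ∂P
      ≤ 2 := by
  refine (lintegral_mono_ae (hf.mono fun o ho => ?_)).trans h.subexponential
  apply ENNReal.ofReal_le_ofReal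
  rw [Real.exp_le_exp, abs_mul, div_le_div_iff₀ (by positivity) (by positivity)]
  have h1 : |f o| * B ≤ 8 * L * B ^ 2 := by nlinarith
  nlinarith [mul_le_mul_of_nonneg_left h1 (abs_nonneg (deriv b (β₀ ⬝ᵥ o.2) - o.1))]

theorem BoundedModel.lintegral_exp_momentFunction_le [IsProbabilityMeasure P]
    (h : BoundedModel b C₁ B R₁ R₂ κ Cg L β₀ P) (hB : 1 ≤ B) (hL : 1 ≤ L) (M : MomentIndex d m) :
    ∫⁻ o, ENNReal.ofReal
      (Real.exp (|momentFunction b β₀ (projection b β₀ P) M o| / (8 * L * B ^ 2))) ∂P ≤ 2 := by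
  have hS : 0 < 8 * L * B ^ 2 := by positivity
  have hx : ∀ j, ∀ᵐ o ∂P, |o.2 j| ≤ B := fun j => h.covariates_le.mono fun o ho => ho j
  have he : ∀ k, ∀ᵐ o ∂P, |decorrelated (projection b β₀ P) o.2 k| ≤ 2 * B :=
    fun k => h.decorrelated_le.mono fun o ho => ho k
  have hL0 : 0 ≤ L := by linarith
  have hB0 : 0 ≤ B := by linarith
  rcases M with _ | ⟨j, l⟩ | ⟨k, j⟩ | ⟨k, l⟩ | j | k
  · refine lintegral_exp_abs_div_le_of_bounded hS (ae_of_all _ fun o => ?_)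
    simp only [momentFunction, abs_one]
    nlinarith [mul_le_mul hL hB zero_le_one hL0]
  · refine lintegral_exp_abs_div_le_of_bounded hS
      ((h.abs_weight_mul_le hL0 hB0 (hx j) (hx l)).mono fun o ho => ?_)
    simp only [momentFunction]
    nlinarith [mul_nonneg hL0 (sq_nonneg B)]
  · refine lintegral_exp_abs_div_le_of_bounded hS
      ((h.abs_weight_mul_le hL0 (by positivity) (he k) (hx j)).mono fun o ho => ?_)
    simp only [momentFunction]
    nlinarith [mul_nonneg hL0 (sq_nonneg B)]
  · refine lintegral_exp_abs_div_le_of_bounded hS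
      ((h.abs_weight_mul_le hL0 (by positivity) (he k) (he l)).mono fun o ho => ?_)
    simp only [momentFunction]
    nlinarith [mul_nonneg hL0 (sq_nonneg B)]
  · exact h.lintegral_exp_score_mul_le hB hL ((hx j).mono fun o ho => by linarith)
  · exact h.lintegral_exp_score_mul_le hB hL (he k)

/-- The empirical moments with weights `a` are within `κ₁` of the population moments. -/
structure ConcentratedMoments (b : ℝ → ℝ) (β₀ : Param d m) (P : Measure (Obs d m)) (κ₁ : ℝ)
    (a : Fin n → ℝ) (o : Fin n → Obs d m) : Prop where
  total : |∑ i, a i - 1| ≤ κ₁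
  gram : ∀ j l, |∑ i, a i * iteratedDeriv 2 b (β₀ ⬝ᵥ (o i).2) * ((o i).2 j * (o i).2 l) -
    hessian b β₀ P j l| ≤ κ₁
  cross_target : ∀ k l, |∑ i, a i * (iteratedDeriv 2 b (β₀ ⬝ᵥ (o i).2) *
    (decorrelated (projection b β₀ P) (o i).2 k * (o i).2 (Sum.inl l))) -
    information b β₀ P k l| ≤ κ₁
  cross_nuisance : ∀ k j, |∑ i, a i * (iteratedDeriv 2 b (β₀ ⬝ᵥ (o i).2) *
    (decorrelated (projection b β₀ P) (o i).2 k * (o i).2 (Sum.inr j)))| ≤ κ₁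
  info : ∀ k l, |∑ i, a i * (iteratedDeriv 2 b (β₀ ⬝ᵥ (o i).2) *
    (decorrelated (projection b β₀ P) (o i).2 k * decorrelated (projection b β₀ P) (o i).2 l)) -
    information b β₀ P k l| ≤ κ₁
  score : ∀ j, |∑ i, a i * ((deriv b (β₀ ⬝ᵥ (o i).2) - (o i).1) * (o i).2 j)| ≤ κ₁
  decorrelated_score : ∀ k, |∑ i, a i * ((deriv b (β₀ ⬝ᵥ (o i).2) - (o i).1) *
    decorrelated (projection b β₀ P) (o i).2 k)| ≤ κ₁

theorem BoundedModel.concentratedMoments [IsProbabilityMeasure P] {c : ℝ} {ν : Measure ℝ}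
    [SigmaFinite ν] (h : BoundedModel b C₁ B R₁ R₂ κ Cg L β₀ P) (hb : LinkBounds b R₁ R₂ ε c₀ L)
    (hP : IsCanonicalGLM b c ν β₀ P) (hν : IsCumulantFunction b c ν) (hc : 0 < c) (hC₁ : 0 < C₁)
    (hB : 1 ≤ B) {κ₁ r : ℝ} {o : Fin n → Obs d m} {δ : Fin n → Bool}
    (hM : ∀ M, |subsampleMean r o δ (momentFunction b β₀ (projection b β₀ P) M) -
      ∫ a, momentFunction b β₀ (projection b β₀ P) M a ∂P| ≤ κ₁) :
    ConcentratedMoments b β₀ P κ₁ (sampleWeight r δ) o := by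
  have hB0 : 0 ≤ B := by linarith
  simp only [subsampleMean_eq_sum] at hM
  have hint : ∀ M, Integrable (momentFunction b β₀ (projection b β₀ P) M) P := fun M =>
    integrable_of_exp_abs (measurable_momentFunction hb _ M)
      (by have := hb.one_le; positivity : 0 < 8 * L * B ^ 2)
      (h.lintegral_exp_momentFunction_le hB hb.one_le M)
  refine ⟨?_, fun j l => ?_, fun k l => ?_, fun k j => ?_, fun k l => ?_, fun j => ?_, fun k => ?_⟩
  · simpa [momentFunction] using hM (.inl ())
  · have := hM (.inr (.inl (j, l)))
    simp only [momentFunction, ← mul_assoc] at this ⊢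
    simpa only [hessian, ← mul_assoc] using this
  · exact hM (.inr (.inr (.inl (k, .inl l))))
  · have := hM (.inr (.inr (.inl (k, .inr j))))
    simp only [momentFunction] at this
    rwa [h.integral_decorrelated_mul_nuisance hb hC₁ hB0, sub_zero] at this
  · have := hM (.inr (.inr (.inr (.inl (k, l)))))
    simp only [momentFunction] at this
    rwa [h.integral_decorrelated_mul_decorrelated hb hC₁ hB0] at this
  · have := hM (.inr (.inr (.inr (.inr (.inl j)))))
    simp only [momentFunction] at this
    rwa [hP.integral_score_mul_eq_zero hν hc hb.differentiable (φ := fun x => x j)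
      (hint (.inr (.inr (.inr (.inr (.inl j)))))), sub_zero] at this
  · have := hM (.inr (.inr (.inr (.inr (.inr k)))))
    simp only [momentFunction] at this
    rwa [hP.integral_score_mul_eq_zero hν hc hb.differentiable
      (φ := fun x => decorrelated (projection b β₀ P) x k)
      (hint (.inr (.inr (.inr (.inr (.inr k)))))), sub_zero] at this

/-- The constant in front of `√(log p / r)` in the uniform concentration bound. -/
def concentrationConst (L B : ℝ) : ℝ := 16 * (8 * L * B ^ 2)

/-- All empirical moments concentrate at rate `√(log p / r)`, except with probability `12 / p²`. -/
theorem BoundedModel.measure_not_concentrated_le [IsProbabilityMeasure P] {c : ℝ} {ν : Measure ℝ}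
    [SigmaFinite ν] (h : BoundedModel b C₁ B R₁ R₂ κ Cg L β₀ P) (hb : LinkBounds b R₁ R₂ ε c₀ L)
    (hP : IsCanonicalGLM b c ν β₀ P) (hν : IsCumulantFunction b c ν) (hc : 0 < c) (hC₁ : 0 < C₁)
    (hB : 1 ≤ B) {Ω : Type*} [MeasurableSpace Ω] {μ : Measure Ω} [IsProbabilityMeasure μ] {r : ℝ}
    {O : Fin n → Ω → Obs d m} {δ : Fin n → Ω → Bool} (hO : IsPoissonSubsample μ P r O δ)
    (hr : 0 < r) (hn : n ≠ 0) (hp : 1 ≤ d + m)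
    (hρ : √(Real.log (d + m : ℕ) / r) ≤ 1) :
    μ {ω | ¬ ConcentratedMoments b β₀ P (concentrationConst L B * √(Real.log (d + m : ℕ) / r))
      (sampleWeight r fun i => δ i ω) (fun i => O i ω)} ≤
      ENNReal.ofReal (12 / ((d + m : ℕ) : ℝ) ^ 2) := by
  set p : ℝ := ((d + m : ℕ) : ℝ) with hp_def
  have hp1 : 1 ≤ p := by rw [hp_def]; exact_mod_cast hp
  have hL := hb.one_le
  have hS : 0 < 8 * L * B ^ 2 := by positivity
  have h1 := hO.measure_exists_abs_mean_sub_gt_le hr hn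
    (fun M => measurable_momentFunction (β₀ := β₀) hb (projection b β₀ P) M) hS
    (fun M => h.lintegral_exp_momentFunction_le hB hL M)
    (u := concentrationConst L B * √(Real.log p / r))
    (by unfold concentrationConst; positivity)
    (by unfold concentrationConst; exact mul_le_of_le_one_right (by positivity) hρ)
  refine (measure_mono fun ω hω => ?_).trans (h1.trans (ENNReal.ofReal_le_ofReal ?_))
  · simp only [Set.mem_ofPred_eq] at hω ⊢
    by_contra hcon
    push Not at hcon
    exact hω (h.concentratedMoments hb hP hν hc hC₁ hB hcon)
  · have hlog : 0 ≤ Real.log p := Real.log_nonneg hp1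
    have e1 : r * (concentrationConst L B * √(Real.log p / r)) ^ 2 / (64 * (8 * L * B ^ 2) ^ 2) =
        4 * Real.log p := by
      rw [mul_pow, Real.sq_sqrt (by positivity), concentrationConst]
      field_simp; ring
    have e2 : Real.exp (-(4 * Real.log p)) = 1 / p ^ 4 := by
      rw [Real.exp_neg, show (4 : ℝ) * Real.log p = (4 : ℕ) * Real.log p by norm_num,
        Real.exp_nat_mul, Real.exp_log (by linarith), one_div]
    rw [e1, e2]
    have h2 := card_momentIndex_le hp
    rw [← hp_def] at h2
    calc _ ≤ 6 * p ^ 2 * (2 * (1 / p ^ 4)) := by gcongr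
      _ = 12 / p ^ 2 := by field_simp; ring

end Moments

/-! ### Rates of the pilot estimators on a regular sample -/

section Rates

variable {d m n : ℕ} {b : ℝ → ℝ} {C₁ R₁ R₂ κ Cg ε c₀ L B : ℝ} {β₀ : Param d m}
  {P : Measure (Obs d m)} {κ₁ κ₂ : ℝ} {a a' : Fin n → ℝ} {o : Fin n → Obs d m}

/-- A weighted sample that satisfies the almost sure bounds of the model and whose moments are
concentrated. -/
structure RegularSample (b : ℝ → ℝ) (B R₁ R₂ : ℝ) (β₀ : Param d m) (P : Measure (Obs d m))
    (κ₁ : ℝ) (a : Fin n → ℝ) (o : Fin n → Obs d m) : Prop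
    extends ConcentratedMoments b β₀ P κ₁ a o where
  weight_nonneg : ∀ i, 0 ≤ a i
  covariate_le : ∀ i j, |(o i).2 j| ≤ B
  decorrelated_le : ∀ i k, |decorrelated (projection b β₀ P) (o i).2 k| ≤ 2 * B
  predictor_mem : ∀ i, β₀ ⬝ᵥ (o i).2 ∈ Set.Icc R₁ R₂

theorem elim_zero_dotProduct (v : Fin m → ℝ) (x : Fin d ⊕ Fin m → ℝ) :
    (Sum.elim 0 v : Fin d ⊕ Fin m → ℝ) ⬝ᵥ x = v ⬝ᵥ nuisance x := by
  simp [dotProduct, nuisance]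

theorem exists_finset_support {J : Type*} [Finite J] (p : J → Prop) :
    ∃ S : Finset J, (∀ j, j ∉ S → ¬ p j) ∧ S.card = {j | p j}.ncard :=
  ⟨(Set.toFinite {j | p j}).toFinset, fun j hj => by simpa using hj,
    (Set.ncard_eq_toFinset_card _ _).symm⟩

namespace RegularSample

theorem deviation_nonneg (hs : RegularSample b B R₁ R₂ β₀ P κ₁ a o) : 0 ≤ κ₁ :=
  (abs_nonneg _).trans hs.total

theorem weight_mem (hs : RegularSample b B R₁ R₂ β₀ P κ₁ a o) (hb : LinkBounds b R₁ R₂ ε c₀ L)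
    (i : Fin n) : iteratedDeriv 2 b (β₀ ⬝ᵥ (o i).2) ∈ Set.Icc c₀ L :=
  ⟨hb.lower_le _ (hb.mem (hs.predictor_mem i)), hb.le_upper _ (hb.mem (hs.predictor_mem i))⟩

theorem restricted_eigenvalue (hs : RegularSample b B R₁ R₂ β₀ P κ₁ a o)
    (hb : LinkBounds b R₁ R₂ ε c₀ L) (h : BoundedModel b C₁ B R₁ R₂ κ Cg L β₀ P)
    (v : Fin d ⊕ Fin m → ℝ) :
    C₁ / L * ∑ j, v j ^ 2 - κ₁ / L * (∑ j, |v j|) ^ 2 ≤ ∑ i, a i * (v ⬝ᵥ (o i).2) ^ 2 :=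
  SubsampledGLM.restricted_eigenvalue hs.weight_nonneg (by linarith [hb.one_le])
    (fun i => (hs.weight_mem hb i).2) h.hessian_lower hs.gram v

theorem restricted_eigenvalue_nuisance (hs : RegularSample b B R₁ R₂ β₀ P κ₁ a o)
    (hb : LinkBounds b R₁ R₂ ε c₀ L) (h : BoundedModel b C₁ B R₁ R₂ κ Cg L β₀ P)
    (v : Fin m → ℝ) :
    C₁ / L * ∑ j, v j ^ 2 - κ₁ / L * (∑ j, |v j|) ^ 2 ≤
      ∑ i, a i * (v ⬝ᵥ nuisance (o i).2) ^ 2 := by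
  have := hs.restricted_eigenvalue hb h (Sum.elim 0 v)
  simpa [elim_zero_dotProduct] using this

/-- Prediction errors on two regular samples are comparable. -/
theorem prediction_error_le (hs : RegularSample b B R₁ R₂ β₀ P κ₁ a o)
    (hs' : RegularSample b B R₁ R₂ β₀ P κ₂ a' o) (hb : LinkBounds b R₁ R₂ ε c₀ L)
    (hκ : κ₂ ≤ κ₁) {v : Fin d ⊕ Fin m → ℝ} {E N : ℝ} (hN : ∑ j, |v j| ≤ N)
    (hE : ∑ i, a i * (v ⬝ᵥ (o i).2) ^ 2 ≤ E) :
    ∑ i, a' i * (v ⬝ᵥ (o i).2) ^ 2 ≤ (L * E + 2 * κ₁ * N ^ 2) / c₀ := by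
  have hc₀ := hb.lower_pos
  have hL := hb.one_le
  have h1 := (abs_le.1 (abs_sum_mul_sq_sub_le hs.gram v)).1
  have h2 := (abs_le.1 (abs_sum_mul_sq_sub_le hs'.gram v)).2
  have hN2 : (∑ j, |v j|) ^ 2 ≤ N ^ 2 := by gcongr
  have h3 : c₀ * ∑ i, a' i * (v ⬝ᵥ (o i).2) ^ 2 ≤
      ∑ i, a' i * iteratedDeriv 2 b (β₀ ⬝ᵥ (o i).2) * (v ⬝ᵥ (o i).2) ^ 2 := by
    rw [Finset.mul_sum]
    refine Finset.sum_le_sum fun i _ => ?_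
    have := mul_le_mul_of_nonneg_left (hs.weight_mem hb i).1
      (mul_nonneg (hs'.weight_nonneg i) (sq_nonneg (v ⬝ᵥ (o i).2)))
    linarith
  have h4 : ∑ i, a i * iteratedDeriv 2 b (β₀ ⬝ᵥ (o i).2) * (v ⬝ᵥ (o i).2) ^ 2 ≤
      L * ∑ i, a i * (v ⬝ᵥ (o i).2) ^ 2 := by
    rw [Finset.mul_sum]
    refine Finset.sum_le_sum fun i _ => ?_
    have := mul_le_mul_of_nonneg_left (hs.weight_mem hb i).2
      (mul_nonneg (hs.weight_nonneg i) (sq_nonneg (v ⬝ᵥ (o i).2)))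
    linarith
  have h5 : L * ∑ i, a i * (v ⬝ᵥ (o i).2) ^ 2 ≤ L * E := by gcongr
  have h6 : κ₁ * (∑ j, |v j|) ^ 2 ≤ κ₁ * N ^ 2 :=
    mul_le_mul_of_nonneg_left hN2 hs.deviation_nonneg
  have h7 : κ₂ * (∑ j, |v j|) ^ 2 ≤ κ₁ * (∑ j, |v j|) ^ 2 := by gcongr
  rw [le_div_iff₀ hc₀]
  linarith

theorem prediction_error_nuisance_le (hs : RegularSample b B R₁ R₂ β₀ P κ₁ a o)
    (hs' : RegularSample b B R₁ R₂ β₀ P κ₂ a' o) (hb : LinkBounds b R₁ R₂ ε c₀ L)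
    (hκ : κ₂ ≤ κ₁) {v : Fin m → ℝ} {E N : ℝ} (hN : ∑ j, |v j| ≤ N)
    (hE : ∑ i, a i * (v ⬝ᵥ nuisance (o i).2) ^ 2 ≤ E) :
    ∑ i, a' i * (v ⬝ᵥ nuisance (o i).2) ^ 2 ≤ (L * E + 2 * κ₁ * N ^ 2) / c₀ := by
  have := hs.prediction_error_le hs' hb hκ (v := Sum.elim 0 v) (E := E) (N := N)
    (by simpa using hN) (by simpa only [elim_zero_dotProduct] using hE)
  simpa only [elim_zero_dotProduct] using this

theorem pilot_rates {r lam s₁ : ℝ} {δ : Fin n → Bool}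
    (hs : RegularSample b B R₁ R₂ β₀ P κ₁ (sampleWeight r δ) o)
    (hb : LinkBounds b R₁ R₂ ε c₀ L) (h : BoundedModel b C₁ B R₁ R₂ κ Cg L β₀ P)
    (hconv : ConvexOn ℝ Set.univ b) (hC₁ : 0 < C₁) (hB : 1 ≤ B) (hlam : 0 < lam)
    (hκlam : 2 * κ₁ ≤ lam) (hs₁ : s₁ = supportSize β₀) (hη : 50 * κ₁ * s₁ ≤ C₁)
    (hsmall : 40 * s₁ * lam / (C₁ / L * c₀) < ε / B) {β : Param d m}
    (hβ : SelectsArgmin (lassoObjective b r lam o δ) Set.univ β) :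
    ∑ i, sampleWeight r δ i * ((β - β₀) ⬝ᵥ (o i).2) ^ 2 ≤
        32 * s₁ * lam ^ 2 / (C₁ / L * c₀ ^ 2) ∧
      ∑ j, |(β - β₀) j| ≤ 40 * s₁ * lam / (C₁ / L * c₀) := by
  have hL : 0 < L := by linarith [hb.one_le]
  have e : lassoObjective b r lam o δ =
      penalizedLoss b (sampleWeight r δ) (fun i => (o i).1) (fun i => (o i).2) lam := by
    ext β
    rw [lassoObjective, subsampleMean_eq_sum, penalizedLoss]
  rw [e] at hβ
  obtain ⟨S, hS, hcard⟩ := exists_finset_support fun j => β₀ j ≠ 0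
  refine lasso_rates (S := S) hb hconv hs.weight_nonneg hlam (div_pos hC₁ hL)
    (div_nonneg hs.deviation_nonneg hL.le) (by linarith) hs.covariate_le hs.predictor_mem
    (fun j hj => not_not.1 (hS j hj)) ?_ (fun j => ?_) (hs.restricted_eigenvalue hb h) ?_ hsmall hβ
  · rw [hcard, hs₁]; rfl
  · have := hs.score j
    simp only [← mul_assoc] at this
    linarith
  · rw [show 50 * (κ₁ / L) * s₁ = (50 * κ₁ * s₁) / L by ring]
    gcongr

/-- The weights `b''` at a parameter close to `β₀`. -/
theorem estimated_weight_bounds (hs : RegularSample b B R₁ R₂ β₀ P κ₁ a o)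
    (hb : LinkBounds b R₁ R₂ ε c₀ L) {β : Param d m} (hB : 0 < B)
    (hβ : ∑ j, |(β - β₀) j| ≤ ε / B) (i : Fin n) :
    iteratedDeriv 2 b (β ⬝ᵥ (o i).2) ∈ Set.Icc c₀ L ∧
    |iteratedDeriv 2 b (β ⬝ᵥ (o i).2) - iteratedDeriv 2 b (β₀ ⬝ᵥ (o i).2)| ≤
      L * |(β - β₀) ⬝ᵥ (o i).2| ∧
    |deriv b (β ⬝ᵥ (o i).2) - deriv b (β₀ ⬝ᵥ (o i).2) -
      iteratedDeriv 2 b (β₀ ⬝ᵥ (o i).2) * ((β - β₀) ⬝ᵥ (o i).2)| ≤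
      L * ((β - β₀) ⬝ᵥ (o i).2) ^ 2 := by
  have h1 : |(β - β₀) ⬝ᵥ (o i).2| ≤ ε :=
    (abs_dotProduct_le (hs.covariate_le i)).trans (by rwa [le_div_iff₀' hB] at hβ)
  have e : β ⬝ᵥ (o i).2 = β₀ ⬝ᵥ (o i).2 + (β - β₀) ⬝ᵥ (o i).2 := by rw [sub_dotProduct]; ring
  have ht := hs.predictor_mem i
  rw [e]
  exact ⟨⟨hb.lower_le _ (hb.add_mem ht h1), hb.le_upper _ (hb.add_mem ht h1)⟩,
    hb.abs_deriv2_sub_le ht h1, hb.abs_deriv_taylor_le ht h1⟩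

/-- A minimiser of the projection objective exists, and minimises it row by row. -/
theorem projectionObjective_row_le {r τ : ℝ} {δ : Fin n → Bool} {β : Param d m}
    {w : Matrix (Fin d) (Fin m) ℝ} (ha : ∀ i, 0 ≤ sampleWeight r δ i)
    (hq : ∀ i, 0 ≤ iteratedDeriv 2 b (β ⬝ᵥ (o i).2)) (hτ : 0 < τ)
    (hw : SelectsArgmin (projectionObjective b r τ o δ β) Set.univ w) (k : Fin d)
    (v : Fin m → ℝ) :
    ∑ i, sampleWeight r δ i * (iteratedDeriv 2 b (β ⬝ᵥ (o i).2) *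
      ((o i).2 (Sum.inl k) - w k ⬝ᵥ nuisance (o i).2) ^ 2) + τ * ∑ j, |w k j| ≤
    ∑ i, sampleWeight r δ i * (iteratedDeriv 2 b (β ⬝ᵥ (o i).2) *
      ((o i).2 (Sum.inl k) - v ⬝ᵥ nuisance (o i).2) ^ 2) + τ * ∑ j, |v j| := by
  let row : Fin d → (Fin m → ℝ) → ℝ := fun k v =>
    ∑ i, sampleWeight r δ i * (iteratedDeriv 2 b (β ⬝ᵥ (o i).2) *
      ((o i).2 (Sum.inl k) - v ⬝ᵥ nuisance (o i).2) ^ 2) + τ * ∑ j, |v j|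
  have hrow : ∀ w : Matrix (Fin d) (Fin m) ℝ,
      projectionObjective b r τ o δ β w = ∑ k, row k (w k) := by
    intro w
    simp only [projectionObjective, subsampleMean_eq_sum, row]
    rw [Finset.sum_add_distrib, ← Finset.mul_sum, Finset.sum_comm (f := fun j k => |w k j|)]
    congr 1
    rw [Finset.sum_comm]
    refine Finset.sum_congr rfl fun i _ => ?_
    rw [Finset.mul_sum, Finset.mul_sum]
    rfl
  have hex : ∃ y ∈ Set.univ, IsMinOn (projectionObjective b r τ o δ β) Set.univ y := by
    refine exists_isMinOn_of_l1_le (α := Fin d) (β := Fin m) isClosed_univ Set.univ_nonempty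
      ?_ hτ fun w => ?_
    · rw [funext hrow]
      simp only [row, dotProduct]
      fun_prop
    · rw [hrow w, Finset.mul_sum]
      refine Finset.sum_le_sum fun k _ => le_add_of_nonneg_left ?_
      exact Finset.sum_nonneg fun i _ => mul_nonneg (ha i) (mul_nonneg (hq i) (sq_nonneg _))
  have hle : projectionObjective b r τ o δ β w ≤ projectionObjective b r τ o δ β (w.updateRow k v) :=
    (hw hex).2 (Set.mem_univ _)
  rw [hrow, hrow, ← Finset.add_sum_erase _ _ (Finset.mem_univ k),
    ← Finset.add_sum_erase (a := k) _ (fun k' => row k' (w.updateRow k v k'))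
      (Finset.mem_univ k)] at hle
  have h2 : ∑ k' ∈ Finset.univ.erase k, row k' (w.updateRow k v k') =
      ∑ k' ∈ Finset.univ.erase k, row k' (w k') :=
    Finset.sum_congr rfl fun k' hk' => by
      rw [Matrix.updateRow_ne (Finset.ne_of_mem_erase hk')]
  rw [h2, Matrix.updateRow_self] at hle
  exact le_of_add_le_add_right hle

theorem projection_rates {r τ s₂ E : ℝ} {δ : Fin n → Bool}
    (hs : RegularSample b B R₁ R₂ β₀ P κ₁ (sampleWeight r δ) o)
    (hb : LinkBounds b R₁ R₂ ε c₀ L) (h : BoundedModel b C₁ B R₁ R₂ κ Cg L β₀ P)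
    (hC₁ : 0 < C₁) (hB : 1 ≤ B) (hτ : 0 < τ) (hκτ : 4 * κ₁ ≤ τ)
    (hs₂ : s₂ = columnSupportSize (projection b β₀ P)) (hη : 50 * κ₁ * s₂ ≤ C₁)
    {β : Param d m} (hβ : ∑ j, |(β - β₀) j| ≤ ε / B)
    (hE : ∑ i, sampleWeight r δ i * ((β - β₀) ⬝ᵥ (o i).2) ^ 2 ≤ E)
    {w : Matrix (Fin d) (Fin m) ℝ}
    (hw : SelectsArgmin (projectionObjective b r τ o δ β) Set.univ w) (k : Fin d) :
    ∑ i, sampleWeight r δ i * ((w k - projection b β₀ P k) ⬝ᵥ nuisance (o i).2) ^ 2 ≤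
        32 * s₂ * τ ^ 2 / (C₁ / L * c₀ ^ 2) + 64 * B ^ 2 * L ^ 2 * E / c₀ ^ 2 ∧
      ∑ j, |(w k - projection b β₀ P k) j| ≤
        40 * s₂ * τ / (C₁ / L * c₀) + 80 * B ^ 2 * L ^ 2 * E / (c₀ * τ) := by
  have hL : 0 < L := by linarith [hb.one_le]
  have hq := fun i => hs.estimated_weight_bounds hb (by linarith) hβ i
  obtain ⟨S, hS, hcard⟩ := exists_finset_support fun j => (fun k => projection b β₀ P k j) ≠ 0
  refine weighted_lasso_rates (S := S)
    (q := fun i => iteratedDeriv 2 b (β₀ ⬝ᵥ (o i).2))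
    (q' := fun i => iteratedDeriv 2 b (β ⬝ᵥ (o i).2))
    (z := fun i => (o i).2 (Sum.inl k)) (h := fun i => (β - β₀) ⬝ᵥ (o i).2)
    hs.weight_nonneg hb.lower_pos hL.le hτ (div_pos hC₁ hL)
    (div_nonneg hs.deviation_nonneg hL.le) (fun i => (hq i).1.1) (fun i => (hq i).2.1) hE
    (fun i => hs.decorrelated_le i k) (fun j => ?_)
    (fun j hj => congrFun (not_not.1 (hS j hj)) k) ?_ (hs.restricted_eigenvalue_nuisance hb h) ?_
    (projectionObjective_row_le hs.weight_nonneg (fun i => hb.lower_pos.le.trans (hq i).1.1) hτ hw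
      k _)
  · have := hs.cross_nuisance k j
    simp only [← mul_assoc, decorrelated_apply] at this
    simp only [nuisance] at this ⊢
    linarith
  · rw [hcard, hs₂]; rfl
  · rw [show 50 * (κ₁ / L) * s₂ = (50 * κ₁ * s₂) / L by ring]
    gcongr

theorem decorrelated_eq_sub (w w₀ : Matrix (Fin d) (Fin m) ℝ) (x : Fin d ⊕ Fin m → ℝ)
    (k : Fin d) : decorrelated w x k = decorrelated w₀ x k - (w k - w₀ k) ⬝ᵥ nuisance x := by
  rw [decorrelated_apply, decorrelated_apply, sub_dotProduct]; ring

theorem abs_decorrelated_sub_le (hs : RegularSample b B R₁ R₂ β₀ P κ₁ a o) (hB : 1 ≤ B)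
    {w : Matrix (Fin d) (Fin m) ℝ} {k : Fin d}
    (hw : ∑ j, |(w k - projection b β₀ P k) j| ≤ 1) (i : Fin n) :
    |decorrelated (projection b β₀ P) (o i).2 k -
      (w k - projection b β₀ P k) ⬝ᵥ nuisance (o i).2| ≤ 3 * B := by
  have h1 := hs.decorrelated_le i k
  have h2 : |(w k - projection b β₀ P k) ⬝ᵥ nuisance (o i).2| ≤ B * 1 :=
    (abs_dotProduct_le fun j => hs.covariate_le i (Sum.inr j)).trans
      (mul_le_mul_of_nonneg_left hw (by linarith))
  have := abs_sub (decorrelated (projection b β₀ P) (o i).2 k)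
    ((w k - projection b β₀ P k) ⬝ᵥ nuisance (o i).2)
  linarith

theorem abs_informationEstimate_sub_le {r E D : ℝ} {δ : Fin n → Bool}
    (hs : RegularSample b B R₁ R₂ β₀ P κ₁ (sampleWeight r δ) o)
    (hb : LinkBounds b R₁ R₂ ε c₀ L) (hB : 1 ≤ B) (hκ₁ : κ₁ ≤ 1) {β : Param d m}
    (hβ : ∑ j, |(β - β₀) j| ≤ ε / B)
    (hE : ∑ i, sampleWeight r δ i * ((β - β₀) ⬝ᵥ (o i).2) ^ 2 ≤ E)
    {w : Matrix (Fin d) (Fin m) ℝ} (hw : ∀ k, ∑ j, |(w k - projection b β₀ P k) j| ≤ 1)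
    (hD : ∀ k, ∑ i, sampleWeight r δ i *
      ((w k - projection b β₀ P k) ⬝ᵥ nuisance (o i).2) ^ 2 ≤ D) (k l : Fin d) :
    |informationEstimate b r o δ β w k l - information b β₀ P k l| ≤
      κ₁ + 4 * B ^ 2 * L * √(2 * E) + 6 * B * L * √(2 * D) := by
  have hL : 0 < L := by linarith [hb.one_le]
  have hq := fun i => hs.estimated_weight_bounds hb (by linarith) hβ i
  have htot : ∑ i, sampleWeight r δ i ≤ 2 := by linarith [(abs_le.1 hs.total).2]
  have h1 := abs_information_plugin_sub_le (L := L) (B := B)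
    (q := fun i => iteratedDeriv 2 b (β₀ ⬝ᵥ (o i).2))
    (q' := fun i => iteratedDeriv 2 b (β ⬝ᵥ (o i).2)) (h := fun i => (β - β₀) ⬝ᵥ (o i).2)
    (v := fun i => (w k - projection b β₀ P k) ⬝ᵥ nuisance (o i).2)
    (v' := fun i => (w l - projection b β₀ P l) ⬝ᵥ nuisance (o i).2)
    hs.weight_nonneg htot hL.le (by linarith) (hs.info k l) (fun i => (hq i).2.1)
    (fun i => by
      rw [abs_of_nonneg (hb.lower_pos.le.trans (hq i).1.1)]
      exact (hq i).1.2)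
    (fun i => hs.decorrelated_le i k) (fun i => hs.decorrelated_le i l)
    (hs.abs_decorrelated_sub_le hB (hw l)) hE (hD k) (hD l)
  rw [informationEstimate, subsampleMean_eq_sum]
  simp only [decorrelated_eq_sub w (projection b β₀ P)]
  calc _ ≤ _ := h1
    _ = _ := by ring

theorem score_eq_sum (b : ℝ → ℝ) (o : Fin n → Obs d m) (β : Param d m)
    (w : Matrix (Fin d) (Fin m) ℝ) (k : Fin d) :
    score b o β w k = ∑ i, sampleWeight (n : ℝ) (fun _ : Fin n => true) i *
      ((deriv b (β ⬝ᵥ (o i).2) - (o i).1) * decorrelated w (o i).2 k) := by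
  simp [score, Finset.mul_sum, sampleWeight]

/-- Linearisation of the full-data decorrelated score. By decorrelation the linear term involves
only the error of the target parameter, up to the sampling error of the cross moments. -/
theorem abs_score_sub_le {N Nw E D : ℝ}
    (hs : RegularSample b B R₁ R₂ β₀ P κ₂ (sampleWeight (n : ℝ) fun _ : Fin n => true) o)
    (hb : LinkBounds b R₁ R₂ ε c₀ L) (hB : 1 ≤ B) {β : Param d m}
    (hβ : ∑ j, |(β - β₀) j| ≤ ε / B) (hN : ∑ j, |(β - β₀) j| ≤ N)
    (hE : ∑ i, sampleWeight (n : ℝ) (fun _ : Fin n => true) i *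
      ((β - β₀) ⬝ᵥ (o i).2) ^ 2 ≤ E)
    {w : Matrix (Fin d) (Fin m) ℝ} {k : Fin d}
    (hw : ∑ j, |(w k - projection b β₀ P k) j| ≤ 1)
    (hNw : ∑ j, |(w k - projection b β₀ P k) j| ≤ Nw)
    (hD : ∑ i, sampleWeight (n : ℝ) (fun _ : Fin n => true) i *
      ((w k - projection b β₀ P k) ⬝ᵥ nuisance (o i).2) ^ 2 ≤ D) :
    |score b o β w k - score b o β₀ (projection b β₀ P) k -
      (information b β₀ P *ᵥ (target β - target β₀)) k| ≤
      κ₂ * Nw + κ₂ * N + L * √(E * D) + 3 * B * L * E := by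
  have hL : 0 < L := by linarith [hb.one_le]
  have hκ := hs.deviation_nonneg
  have hq := fun i => hs.estimated_weight_bounds hb (by linarith) hβ i
  set A := sampleWeight (n : ℝ) fun _ : Fin n => true with hA
  have hεv : |∑ i, A i * ((deriv b (β₀ ⬝ᵥ (o i).2) - (o i).1) *
      ((w k - projection b β₀ P k) ⬝ᵥ nuisance (o i).2))| ≤ κ₂ * Nw := by
    simp only [← mul_assoc]
    refine (abs_sum_mul_dotProduct_le (x := fun i => nuisance (o i).2) fun j => ?_).trans
      (mul_le_mul_of_nonneg_left hNw hκ)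
    have := hs.score (Sum.inr j)
    simp only [← mul_assoc] at this
    exact this
  have hqe : |∑ i, A i * (iteratedDeriv 2 b (β₀ ⬝ᵥ (o i).2) * ((β - β₀) ⬝ᵥ (o i).2) *
      decorrelated (projection b β₀ P) (o i).2 k) -
      (information b β₀ P *ᵥ (target β - target β₀)) k| ≤ κ₂ * N := by
    set M : Fin d ⊕ Fin m → ℝ := fun j => ∑ i, A i * (iteratedDeriv 2 b (β₀ ⬝ᵥ (o i).2) *
      (decorrelated (projection b β₀ P) (o i).2 k * (o i).2 j)) with hM
    set M₀ : Fin d ⊕ Fin m → ℝ := Sum.elim (information b β₀ P k) 0 with hM₀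
    have e1 : ∑ i, A i * (iteratedDeriv 2 b (β₀ ⬝ᵥ (o i).2) * ((β - β₀) ⬝ᵥ (o i).2) *
        decorrelated (projection b β₀ P) (o i).2 k) = (β - β₀) ⬝ᵥ M := by
      simp only [hM, dotProduct, Finset.mul_sum, Finset.sum_mul]
      rw [Finset.sum_comm]
      exact Finset.sum_congr rfl fun j _ => Finset.sum_congr rfl fun i _ => by ring
    have e2 : (information b β₀ P *ᵥ (target β - target β₀)) k = (β - β₀) ⬝ᵥ M₀ := by
      simp [hM₀, Matrix.mulVec, dotProduct, target, mul_comm]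
    rw [e1, e2, ← dotProduct_sub]
    refine (abs_dotProduct_le (B := κ₂) fun j => ?_).trans (mul_le_mul_of_nonneg_left hN hκ)
    rcases j with l | j
    · exact hs.cross_target k l
    · simpa [hM, hM₀] using hs.cross_nuisance k j
  have h1 := abs_score_remainder_le (L := L) (B := B)
    (ρ := fun i => deriv b (β ⬝ᵥ (o i).2) - deriv b (β₀ ⬝ᵥ (o i).2) -
      iteratedDeriv 2 b (β₀ ⬝ᵥ (o i).2) * ((β - β₀) ⬝ᵥ (o i).2))
    hs.weight_nonneg hL.le hεv hqe
    (fun i => by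
      rw [abs_of_nonneg (hb.lower_pos.le.trans (hs.weight_mem hb i).1)]
      exact (hs.weight_mem hb i).2)
    (fun i => (hq i).2.2) (hs.abs_decorrelated_sub_le hB hw) hE hD (by linarith)
  rw [score_eq_sum, score_eq_sum]
  simp only [decorrelated_eq_sub w (projection b β₀ P)]
  convert h1 using 4
  refine Finset.sum_congr rfl fun i _ => ?_
  ring

end RegularSample

end Rates

/-! ### Rates in terms of the sparsity levels -/

section Sparsity

variable {s₁ s₂ : ℕ}

theorem one_le_max_sqrt (h : (1 : ℝ) ≤ max (s₁ : ℝ) s₂) : 1 ≤ max (s₁ : ℝ) √s₂ := by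
  rcases le_max_iff.1 h with h | h
  · exact le_max_of_le_left h
  · exact le_max_of_le_right (Real.one_le_sqrt.2 h)

theorem natCast_le_sq (s : ℕ) : (s : ℝ) ≤ (s : ℝ) ^ 2 := by
  exact_mod_cast Nat.le_self_pow (by norm_num) s

theorem max_le_sq_max_sqrt : max (s₁ : ℝ) s₂ ≤ max (s₁ : ℝ) √s₂ ^ 2 := by
  refine max_le ((natCast_le_sq s₁).trans ?_) ?_
  · gcongr; exact le_max_left _ _
  · calc (s₂ : ℝ) = √s₂ ^ 2 := (Real.sq_sqrt (Nat.cast_nonneg _)).symm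
      _ ≤ _ := by gcongr; exact le_max_right _ _

theorem sqrt_max_le : √(max (s₁ : ℝ) s₂) ≤ max (s₁ : ℝ) √s₂ :=
  Real.sqrt_le_iff.2 ⟨le_max_of_le_left (Nat.cast_nonneg _), max_le_sq_max_sqrt⟩

theorem sqrt_mul_max_le : √((s₁ : ℝ) * max (s₁ : ℝ) s₂) ≤ s₁ * max (s₁ : ℝ) √s₂ := by
  refine Real.sqrt_le_iff.2 ⟨by positivity, ?_⟩
  rw [mul_pow]
  exact mul_le_mul (natCast_le_sq s₁) max_le_sq_max_sqrt (by positivity) (by positivity)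

theorem natCast_le_mul_max (h : (1 : ℝ) ≤ max (s₁ : ℝ) s₂) :
    (s₁ : ℝ) ≤ s₁ * max (s₁ : ℝ) √s₂ :=
  le_mul_of_one_le_right (Nat.cast_nonneg _) (one_le_max_sqrt h)

theorem max_sqrt_le_add : max (s₁ : ℝ) √s₂ ≤ s₁ + s₂ := by
  refine max_le (by simp) ?_
  have h1 : √(s₂ : ℝ) ≤ s₂ := Real.sqrt_le_iff.2 ⟨Nat.cast_nonneg _, natCast_le_sq s₂⟩
  have h2 : (0 : ℝ) ≤ s₁ := Nat.cast_nonneg _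
  linarith

end Sparsity

/-- The constant in the bound `‖β̂ - β₀‖₁ ≲ s₁ ρ`; `Λ` is the upper constant of `λ`. -/
noncomputable def pilotL1Const (C₁ c₀ L Λ : ℝ) : ℝ := 40 * Λ / (C₁ / L * c₀)

/-- The constant in the bound of the squared prediction error of `β̂` by `s₁ ρ²`. -/
noncomputable def pilotPredConst (C₁ c₀ L Λ : ℝ) : ℝ := 32 * Λ ^ 2 / (C₁ / L * c₀ ^ 2)

/-- The constant in the `ℓ¹` bound for a row of `ŵ - w₀` by `(s₁ ∨ s₂) ρ`; `T` is the upper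
constant of `τ`, and `K` that of the deviations of the empirical moments. -/
noncomputable def projL1Const (C₁ c₀ L B K Λ T : ℝ) : ℝ :=
  40 * T / (C₁ / L * c₀) + 20 * B ^ 2 * L ^ 2 * pilotPredConst C₁ c₀ L Λ / (c₀ * K)

/-- The constant in the bound of the squared prediction error of a row of `ŵ` by
`(s₁ ∨ s₂) ρ²`. -/
noncomputable def projPredConst (C₁ c₀ L B Λ T : ℝ) : ℝ :=
  32 * T ^ 2 / (C₁ / L * c₀ ^ 2) + 64 * B ^ 2 * L ^ 2 * pilotPredConst C₁ c₀ L Λ / c₀ ^ 2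

/-- The constant in the max-norm bound of the plug-in information matrix by `(s₁ ∨ √s₂) ρ`. -/
noncomputable def infoConst (C₁ c₀ L B K Λ T : ℝ) : ℝ :=
  K + 4 * B ^ 2 * L * √(2 * pilotPredConst C₁ c₀ L Λ) +
    6 * B * L * √(2 * projPredConst C₁ c₀ L B Λ T)

section Remainder

variable {d m n : ℕ} {b : ℝ → ℝ} {C₁ R₁ R₂ κ Cg ε c₀ L B K ρ : ℝ} {β₀ : Param d m}
  {P : Measure (Obs d m)} {o : Fin n → Obs d m} {r : ℝ} {δ : Fin n → Bool} {s₁ s₂ : ℕ}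

theorem pilotPredConst_nonneg (hb : LinkBounds b R₁ R₂ ε c₀ L) (hC₁ : 0 < C₁) (Λ : ℝ) :
    0 ≤ pilotPredConst C₁ c₀ L Λ := by
  have := hb.lower_pos
  have := hb.one_le
  unfold pilotPredConst
  positivity

theorem projPredConst_nonneg (hb : LinkBounds b R₁ R₂ ε c₀ L) (hC₁ : 0 < C₁) (Λ T : ℝ) :
    0 ≤ projPredConst C₁ c₀ L B Λ T := by
  have := hb.lower_pos
  have := hb.one_le
  have := pilotPredConst_nonneg hb hC₁ Λ
  unfold projPredConst
  positivity

theorem infoConst_nonneg (hb : LinkBounds b R₁ R₂ ε c₀ L) (hB : 0 ≤ B) (hK : 0 ≤ K) (Λ T : ℝ) :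
    0 ≤ infoConst C₁ c₀ L B K Λ T := by
  have := hb.one_le
  unfold infoConst
  positivity

theorem RegularSample.pilot_sparse_rates {lam Λ : ℝ}
    (hs : RegularSample b B R₁ R₂ β₀ P (K * ρ) (sampleWeight r δ) o)
    (hb : LinkBounds b R₁ R₂ ε c₀ L) (h : BoundedModel b C₁ B R₁ R₂ κ Cg L β₀ P)
    (hconv : ConvexOn ℝ Set.univ b) (hC₁ : 0 < C₁) (hB : 1 ≤ B) (hK : 0 < K) (hρ : 0 < ρ)
    (hlam : 2 * K * ρ ≤ lam) (hΛ : lam ≤ Λ * ρ) (hs₁ : s₁ = supportSize β₀)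
    (hη : 50 * K * (s₁ * ρ) ≤ C₁) (hsmall : pilotL1Const C₁ c₀ L Λ * (s₁ * ρ) < ε / B)
    {β : Param d m} (hβ : SelectsArgmin (lassoObjective b r lam o δ) Set.univ β) :
    ∑ i, sampleWeight r δ i * ((β - β₀) ⬝ᵥ (o i).2) ^ 2 ≤
        pilotPredConst C₁ c₀ L Λ * (s₁ * ρ ^ 2) ∧
      ∑ j, |(β - β₀) j| ≤ pilotL1Const C₁ c₀ L Λ * (s₁ * ρ) := by
  have hc₀ := hb.lower_pos
  have hL := hb.one_le
  have hlam0 : 0 < lam := lt_of_lt_of_le (by positivity) hlam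
  have e1 : 40 * s₁ * lam / (C₁ / L * c₀) ≤ pilotL1Const C₁ c₀ L Λ * (s₁ * ρ) := by
    calc 40 * s₁ * lam / (C₁ / L * c₀) ≤ 40 * s₁ * (Λ * ρ) / (C₁ / L * c₀) := by gcongr
      _ = _ := by unfold pilotL1Const; ring
  have e2 : 32 * s₁ * lam ^ 2 / (C₁ / L * c₀ ^ 2) ≤
      pilotPredConst C₁ c₀ L Λ * (s₁ * ρ ^ 2) := by
    calc 32 * s₁ * lam ^ 2 / (C₁ / L * c₀ ^ 2) ≤ 32 * s₁ * (Λ * ρ) ^ 2 / (C₁ / L * c₀ ^ 2) := by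
          gcongr
      _ = _ := by unfold pilotPredConst; ring
  have := hs.pilot_rates hb h hconv hC₁ hB hlam0 (by linarith) (s₁ := s₁) (by rw [hs₁])
    (by linarith) (e1.trans_lt hsmall) hβ
  exact ⟨this.1.trans e2, this.2.trans e1⟩

theorem RegularSample.projection_sparse_rates {τ Λ T : ℝ}
    (hs : RegularSample b B R₁ R₂ β₀ P (K * ρ) (sampleWeight r δ) o)
    (hb : LinkBounds b R₁ R₂ ε c₀ L) (h : BoundedModel b C₁ B R₁ R₂ κ Cg L β₀ P)
    (hC₁ : 0 < C₁) (hB : 1 ≤ B) (hK : 0 < K) (hρ : 0 < ρ)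
    (hτ : 4 * K * ρ ≤ τ) (hT : τ ≤ T * ρ) (hs₂ : s₂ = columnSupportSize (projection b β₀ P))
    (hη : 50 * K * (s₂ * ρ) ≤ C₁) {β : Param d m} (hβ : ∑ j, |(β - β₀) j| ≤ ε / B)
    (hE : ∑ i, sampleWeight r δ i * ((β - β₀) ⬝ᵥ (o i).2) ^ 2 ≤
      pilotPredConst C₁ c₀ L Λ * (s₁ * ρ ^ 2))
    {w : Matrix (Fin d) (Fin m) ℝ}
    (hw : SelectsArgmin (projectionObjective b r τ o δ β) Set.univ w) (k : Fin d) :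
    ∑ i, sampleWeight r δ i * ((w k - projection b β₀ P k) ⬝ᵥ nuisance (o i).2) ^ 2 ≤
        projPredConst C₁ c₀ L B Λ T * (max (s₁ : ℝ) s₂ * ρ ^ 2) ∧
      ∑ j, |(w k - projection b β₀ P k) j| ≤
        projL1Const C₁ c₀ L B K Λ T * (max (s₁ : ℝ) s₂ * ρ) := by
  have hc₀ := hb.lower_pos
  have hL := hb.one_le
  have hτ0 : 0 < τ := lt_of_lt_of_le (by positivity) hτ
  have hA := pilotPredConst_nonneg hb hC₁ Λ
  have hT0 : 0 ≤ T := by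
    by_contra! hneg
    have := mul_neg_of_neg_of_pos hneg hρ
    linarith
  have h1 : (s₁ : ℝ) ≤ max (s₁ : ℝ) s₂ := le_max_left _ _
  have h2 : (s₂ : ℝ) ≤ max (s₁ : ℝ) s₂ := le_max_right _ _
  set A := pilotPredConst C₁ c₀ L Λ with hAdef
  set S : ℝ := max (s₁ : ℝ) s₂ with hS
  have hS0 : 0 ≤ S := le_trans (Nat.cast_nonneg _) h1
  have := hs.projection_rates hb h hC₁ hB hτ0 (by linarith) (s₂ := s₂) (by rw [hs₂])
    (by linarith) hβ hE hw k
  refine ⟨this.1.trans ?_, this.2.trans ?_⟩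
  · calc 32 * s₂ * τ ^ 2 / (C₁ / L * c₀ ^ 2) + 64 * B ^ 2 * L ^ 2 * (A * (s₁ * ρ ^ 2)) / c₀ ^ 2
        ≤ 32 * S * (T * ρ) ^ 2 / (C₁ / L * c₀ ^ 2) +
          64 * B ^ 2 * L ^ 2 * (A * (S * ρ ^ 2)) / c₀ ^ 2 := by gcongr
      _ = _ := by unfold projPredConst; rw [← hAdef]; ring
  · calc 40 * s₂ * τ / (C₁ / L * c₀) + 80 * B ^ 2 * L ^ 2 * (A * (s₁ * ρ ^ 2)) / (c₀ * τ)
        ≤ 40 * S * (T * ρ) / (C₁ / L * c₀) +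
          80 * B ^ 2 * L ^ 2 * (A * (S * ρ ^ 2)) / (c₀ * (4 * K * ρ)) := by gcongr
      _ = _ := by unfold projL1Const; rw [← hAdef]; field_simp; ring

theorem RegularSample.information_sparse_rate {Λ T : ℝ}
    (hs : RegularSample b B R₁ R₂ β₀ P (K * ρ) (sampleWeight r δ) o)
    (hb : LinkBounds b R₁ R₂ ε c₀ L) (hB : 1 ≤ B) (hC₁ : 0 < C₁) (hK : 0 < K) (hρ : 0 < ρ)
    (hs₁₂ : (1 : ℝ) ≤ max (s₁ : ℝ) s₂) (hκ₁ : K * ρ ≤ 1) {β : Param d m}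
    (hβ : ∑ j, |(β - β₀) j| ≤ ε / B)
    (hE : ∑ i, sampleWeight r δ i * ((β - β₀) ⬝ᵥ (o i).2) ^ 2 ≤
      pilotPredConst C₁ c₀ L Λ * (s₁ * ρ ^ 2))
    {w : Matrix (Fin d) (Fin m) ℝ} (hw : ∀ k, ∑ j, |(w k - projection b β₀ P k) j| ≤ 1)
    (hD : ∀ k, ∑ i, sampleWeight r δ i *
      ((w k - projection b β₀ P k) ⬝ᵥ nuisance (o i).2) ^ 2 ≤
      projPredConst C₁ c₀ L B Λ T * (max (s₁ : ℝ) s₂ * ρ ^ 2)) (k l : Fin d) :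
    |informationEstimate b r o δ β w k l - information b β₀ P k l| ≤
      infoConst C₁ c₀ L B K Λ T * (max (s₁ : ℝ) √s₂ * ρ) := by
  have hL := hb.one_le
  have hA := pilotPredConst_nonneg hb hC₁ Λ
  have hA' := projPredConst_nonneg (B := B) hb hC₁ Λ T
  refine (hs.abs_informationEstimate_sub_le hb hB hκ₁ hβ hE hw hD k l).trans ?_
  set A := pilotPredConst C₁ c₀ L Λ with hAdef
  set A' := projPredConst C₁ c₀ L B Λ T with hAdef'
  set t : ℝ := max (s₁ : ℝ) √s₂ with ht
  have ht1 : 1 ≤ t := one_le_max_sqrt hs₁₂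
  have hroot : ∀ {A s : ℝ}, 0 ≤ A → √s ≤ t → √(2 * (A * (s * ρ ^ 2))) ≤ √(2 * A) * (t * ρ) := by
    intro A s hA hst
    rw [show 2 * (A * (s * ρ ^ 2)) = 2 * A * (s * ρ ^ 2) by ring, Real.sqrt_mul (by positivity),
      Real.sqrt_mul' _ (sq_nonneg ρ), Real.sqrt_sq hρ.le]
    gcongr
  have h1 := hroot hA ((Real.sqrt_le_sqrt (le_max_left (s₁ : ℝ) s₂)).trans sqrt_max_le)
  have h2 := hroot hA' (sqrt_max_le (s₁ := s₁) (s₂ := s₂))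
  have h3 : K * ρ ≤ K * (t * ρ) := by
    have := le_mul_of_one_le_left hρ.le ht1
    gcongr
  calc _ ≤ K * (t * ρ) + 4 * B ^ 2 * L * (√(2 * A) * (t * ρ)) +
        6 * B * L * (√(2 * A') * (t * ρ)) := by gcongr
    _ = _ := by unfold infoConst; rw [← hAdef, ← hAdef']; ring

/-- What the argument needs to know about the approximate inverse `G` of `Φ`, for a max-norm error
`ζ`. Both the minimiser and its symmetrization qualify. -/
structure IsApproxInverse (b : ℝ → ℝ) (β₀ : Param d m) (P : Measure (Obs d m)) (ζ : ℝ)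
    (G : Matrix (Fin d) (Fin d) ℝ) : Prop where
  row_le : ∀ k, ∑ l, |G k l| ≤ ∑ l, |(information b β₀ P)⁻¹ k l|
  close : ∀ k l, |G k l - (information b β₀ P)⁻¹ k l| ≤ ζ

theorem IsApproxInverse.symmetrize [IsProbabilityMeasure P] {ζ : ℝ} {G : Matrix (Fin d) (Fin d) ℝ}
    (hG : IsApproxInverse b β₀ P ζ G) (h : BoundedModel b C₁ B R₁ R₂ κ Cg L β₀ P)
    (hb : LinkBounds b R₁ R₂ ε c₀ L) (hC₁ : 0 < C₁) (hB : 0 ≤ B) :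
    IsApproxInverse b β₀ P ζ (symmetrize G) where
  row_le k := (Finset.sum_le_sum fun l _ => abs_symmetrize_le k l).trans (hG.row_le k)
  close := abs_symmetrize_sub_le (h.inv_information_comm hb hC₁ hB) hG.close

theorem BoundedModel.isApproxInverse [IsProbabilityMeasure P]
    (h : BoundedModel b C₁ B R₁ R₂ κ Cg L β₀ P)
    (hb : LinkBounds b R₁ R₂ ε c₀ L) (hC₁ : 0 < C₁) (hB : 0 ≤ B) (hκ : 0 < κ)
    {A G : Matrix (Fin d) (Fin d) ℝ} {η g : ℝ} (hη : 0 ≤ η)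
    (hA : ∀ k l, |A k l - information b β₀ P k l| ≤ η) (hg : |Cg| / κ * η ≤ g)
    (hG : SelectsArgmin entrywiseL1 (climeFeasible A g) G) :
    IsApproxInverse b β₀ P (|Cg| / κ * (g + |Cg| / κ * η)) G := by
  have hu := h.isUnit_det_information hκ
  have := clime_bounds (Matrix.nonsing_inv_mul _ hu) (Matrix.mul_nonsing_inv _ hu)
    (h.inv_information_comm hb hC₁ hB) hη (h.sum_abs_inv_information_le hb hC₁ hB hκ) hA hg hG
  exact ⟨this.1, this.2⟩

/-- The constant of the Bahadur remainder, in terms of the constants `N, Nw` of the `ℓ¹` errors,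
`E, D` of the full-sample prediction errors, and `Z` of the approximate inverse. -/
noncomputable def remainderConst (L B K κ Cg N Nw E D Z : ℝ) : ℝ :=
  2 * |Cg| * Z * (K + L * (2 * B * B) * N) +
    |Cg| / κ * (K * (Nw + N) + L * √(E * D) + 3 * B * L * E)

/-- The Bahadur remainder for a given approximate inverse, from the rates of all estimators. -/
theorem RegularSample.abs_remainder_le [IsProbabilityMeasure P] {ℓ N Nw E D Z : ℝ}
    (hs : RegularSample b B R₁ R₂ β₀ P (K * ℓ) (sampleWeight (n : ℝ) fun _ : Fin n => true) o)
    (h : BoundedModel b C₁ B R₁ R₂ κ Cg L β₀ P)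
    (hb : LinkBounds b R₁ R₂ ε c₀ L) (hC₁ : 0 < C₁) (hB : 1 ≤ B) (hκ : 0 < κ) (hK : 0 ≤ K)
    (hρ : 0 ≤ ρ) (hℓ : 0 ≤ ℓ) (hs₁₂ : (1 : ℝ) ≤ max (s₁ : ℝ) s₂) (hN : 0 ≤ N) (hNw : 0 ≤ Nw)
    (hE : 0 ≤ E) (hD : 0 ≤ D) (hZ : 0 ≤ Z) {β : Param d m} (hβ : ∑ j, |(β - β₀) j| ≤ ε / B)
    (hβN : ∑ j, |(β - β₀) j| ≤ N * (s₁ * ρ))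
    (hβE : ∑ i, sampleWeight (n : ℝ) (fun _ : Fin n => true) i *
      ((β - β₀) ⬝ᵥ (o i).2) ^ 2 ≤ E * (s₁ * ρ ^ 2))
    {w : Matrix (Fin d) (Fin m) ℝ} (hw : ∀ k, ∑ j, |(w k - projection b β₀ P k) j| ≤ 1)
    (hwN : ∀ k, ∑ j, |(w k - projection b β₀ P k) j| ≤ Nw * (max (s₁ : ℝ) s₂ * ρ))
    (hwD : ∀ k, ∑ i, sampleWeight (n : ℝ) (fun _ : Fin n => true) i *
      ((w k - projection b β₀ P k) ⬝ᵥ nuisance (o i).2) ^ 2 ≤ D * (max (s₁ : ℝ) s₂ * ρ ^ 2))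
    {G : Matrix (Fin d) (Fin d) ℝ}
    (hG : IsApproxInverse b β₀ P (Z * (max (s₁ : ℝ) √s₂ * ρ)) G) (k : Fin d) :
    |((debiased b o β w G - target β₀) +
      (information b β₀ P)⁻¹ *ᵥ score b o β₀ (projection b β₀ P)) k| ≤
      remainderConst L B K κ Cg N Nw E D Z *
        (ρ * ℓ * (max (s₁ : ℝ) s₂ + max (s₁ : ℝ) √s₂) + s₁ * max (s₁ : ℝ) √s₂ * ρ ^ 2) := by
  have hL := hb.one_le
  have hB0 : 0 ≤ B := by linarith
  set S : ℝ := max (s₁ : ℝ) s₂ with hS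
  set t : ℝ := max (s₁ : ℝ) √s₂ with ht
  have ht1 : 1 ≤ t := one_le_max_sqrt hs₁₂
  have hs₁t : (s₁ : ℝ) ≤ s₁ * t := natCast_le_mul_max hs₁₂
  have hs₁S : (s₁ : ℝ) ≤ S := le_max_left _ _
  set X : ℝ := ρ * ℓ * (S + t) with hX
  set Y : ℝ := s₁ * t * ρ ^ 2 with hY
  have hX0 : 0 ≤ X := by positivity
  have hY0 : 0 ≤ Y := by positivity
  have hρℓ : 0 ≤ ρ * ℓ := by positivity
  have hSX : ρ * ℓ * S ≤ X := by rw [hX]; gcongr; linarith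
  have htX : ρ * ℓ * t ≤ X := by rw [hX]; gcongr; linarith
  have hs₁X : ρ * ℓ * s₁ ≤ X := (by gcongr : ρ * ℓ * s₁ ≤ ρ * ℓ * S).trans hSX
  have hs₁Y : s₁ * ρ ^ 2 ≤ Y := by rw [hY]; gcongr
  have hroot : √(E * (s₁ * ρ ^ 2) * (D * (S * ρ ^ 2))) ≤ √(E * D) * Y := by
    rw [show E * (s₁ * ρ ^ 2) * (D * (S * ρ ^ 2)) = E * D * (s₁ * S * (ρ ^ 2) ^ 2) by ring,
      Real.sqrt_mul (by positivity), Real.sqrt_mul' _ (sq_nonneg _), Real.sqrt_sq (sq_nonneg _)]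
    have : √((s₁ : ℝ) * S) ≤ s₁ * t := sqrt_mul_max_le
    rw [hY]
    gcongr
  have hrow : ∀ k, ∑ l, |G k l| ≤ |Cg| / κ := fun k =>
    (hG.row_le k).trans (h.sum_abs_inv_information_le hb hC₁ hB0 hκ k)
  have hdiff : ∀ k, ∑ l, |G k l - (information b β₀ P)⁻¹ k l| ≤ 2 * |Cg| * (Z * (t * ρ)) :=
    fun k => sum_abs_sub_le_of_sparse (by positivity) (hG.row_le k) (hG.close k)
      ((h.rows_sparse k).trans (le_abs_self _))
  set ω : ℝ := K * X * (Nw + N) + L * (√(E * D) * Y) + 3 * B * L * (E * Y) with hω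
  have hexp : ∀ k, |score b o β w k - score b o β₀ (projection b β₀ P) k -
      (information b β₀ P *ᵥ (target β - target β₀)) k| ≤ ω := by
    intro k
    refine (hs.abs_score_sub_le hb hB hβ hβN hβE (hw k) (hwN k) (hwD k)).trans ?_
    have h1 : K * ℓ * (Nw * (S * ρ)) ≤ K * X * Nw := by
      calc K * ℓ * (Nw * (S * ρ)) = K * (ρ * ℓ * S) * Nw := by ring
        _ ≤ _ := by gcongr
    have h2 : K * ℓ * (N * (s₁ * ρ)) ≤ K * X * N := by
      calc K * ℓ * (N * (s₁ * ρ)) = K * (ρ * ℓ * s₁) * N := by ring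
        _ ≤ _ := by gcongr
    have h3 : L * √(E * (s₁ * ρ ^ 2) * (D * (S * ρ ^ 2))) ≤ L * (√(E * D) * Y) := by gcongr
    have h4 : 3 * B * L * (E * (s₁ * ρ ^ 2)) ≤ 3 * B * L * (E * Y) := by gcongr
    rw [hω]; linarith
  have hΔ : ∑ k, |(target β - target β₀) k| ≤ N * (s₁ * ρ) := by
    refine le_trans ?_ hβN
    rw [Fintype.sum_sum_type]
    exact le_add_of_nonneg_right (Finset.sum_nonneg fun _ _ => abs_nonneg _)
  have key := abs_debiased_remainder_le (B₂ := L * (2 * B * B))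
    (Matrix.nonsing_inv_mul _ (h.isUnit_det_information hκ)) (by positivity) (by positivity)
    (T := score b o β₀ (projection b β₀ P)) (κ := K * ℓ)
    (fun k => by rw [RegularSample.score_eq_sum]; exact hs.decorrelated_score k) hexp
    (h.abs_information_le hb hB0) hΔ (by positivity) hrow hdiff k
  have e : (debiased b o β w G - target β₀) +
      (information b β₀ P)⁻¹ *ᵥ score b o β₀ (projection b β₀ P) =
      target β - target β₀ - G *ᵥ score b o β w +
        (information b β₀ P)⁻¹ *ᵥ score b o β₀ (projection b β₀ P) := by
    rw [debiased]; abel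
  rw [e]
  refine key.trans ?_
  have hκ' : 0 ≤ |Cg| / κ := by positivity
  have f1 : 2 * |Cg| * (Z * (t * ρ)) * (K * ℓ + L * (2 * B * B) * (N * (s₁ * ρ))) ≤
      2 * |Cg| * Z * (K + L * (2 * B * B) * N) * (X + Y) := by
    calc 2 * |Cg| * (Z * (t * ρ)) * (K * ℓ + L * (2 * B * B) * (N * (s₁ * ρ)))
        = 2 * |Cg| * Z * (K * (ρ * ℓ * t) + L * (2 * B * B) * N * Y) := by rw [hY]; ring
      _ ≤ 2 * |Cg| * Z * (K * (X + Y) + L * (2 * B * B) * N * (X + Y)) := by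
          gcongr
          · linarith
          · linarith
      _ = _ := by ring
  have f2 : ω ≤ (K * (Nw + N) + L * √(E * D) + 3 * B * L * E) * (X + Y) := by
    calc ω ≤ K * (X + Y) * (Nw + N) + L * (√(E * D) * (X + Y)) + 3 * B * L * (E * (X + Y)) := by
          rw [hω]
          gcongr <;> linarith
      _ = _ := by ring
  calc _ ≤ 2 * |Cg| * Z * (K + L * (2 * B * B) * N) * (X + Y) +
        |Cg| / κ * ((K * (Nw + N) + L * √(E * D) + 3 * B * L * E) * (X + Y)) := by gcongr
    _ = _ := by unfold remainderConst; ring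

end Remainder

/-! ### The Bahadur representation -/

section Assembly

/-- The constant in the bound of the squared full-sample prediction errors, obtained from that on
the subsample and the `ℓ¹` error. -/
noncomputable def fullPredConst (c₀ L K A N : ℝ) : ℝ := (L * A + 2 * K * N ^ 2) / c₀

/-- The constant in the max-norm bound of `G - Φ⁻¹` by `(s₁ ∨ √s₂) ρ`. -/
noncomputable def inverseConst (κ Cg A Lg : ℝ) : ℝ := |Cg| / κ * (Lg + |Cg| / κ * A)

/-- The constant of the Bahadur remainder in terms of the model and the tuning constants. -/
noncomputable def bahadurConst (C₁ c₀ L B K κ Cg Λ T Lg : ℝ) : ℝ :=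
  remainderConst L B K κ Cg (pilotL1Const C₁ c₀ L Λ) (projL1Const C₁ c₀ L B K Λ T)
    (fullPredConst c₀ L K (pilotPredConst C₁ c₀ L Λ) (pilotL1Const C₁ c₀ L Λ))
    (fullPredConst c₀ L K (projPredConst C₁ c₀ L B Λ T) (projL1Const C₁ c₀ L B K Λ T))
    (inverseConst κ Cg (infoConst C₁ c₀ L B K Λ T) Lg)

variable {d m n : ℕ} {b : ℝ → ℝ} {C₁ R₁ R₂ κ Cg ε c₀ L B K ρ : ℝ} {β₀ : Param d m}
  {P : Measure (Obs d m)} {o : Fin n → Obs d m} {r : ℝ} {δ : Fin n → Bool} {s₁ s₂ : ℕ}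

/-- The deterministic core: on a sample that is regular both for the subsample and for the full
sample weights, the three estimators satisfy the Bahadur bound. -/
theorem abs_bahadur_le_of_regularSample [IsProbabilityMeasure P] {ℓ lam τ g Λ T Lg : ℝ}
    (hs : RegularSample b B R₁ R₂ β₀ P (K * ρ) (sampleWeight r δ) o)
    (hs' : RegularSample b B R₁ R₂ β₀ P (K * ℓ) (sampleWeight (n : ℝ) fun _ : Fin n => true) o)
    (h : BoundedModel b C₁ B R₁ R₂ κ Cg L β₀ P) (hb : LinkBounds b R₁ R₂ ε c₀ L)
    (hconv : ConvexOn ℝ Set.univ b) (hC₁ : 0 < C₁) (hB : 1 ≤ B) (hκ : 0 < κ) (hK : 0 < K)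
    (hρ : 0 < ρ) (hℓ : 0 ≤ ℓ) (hℓρ : ℓ ≤ ρ)
    (hs₁ : s₁ = supportSize β₀) (hs₂ : s₂ = columnSupportSize (projection b β₀ P))
    (hs₁₂ : (1 : ℝ) ≤ max (s₁ : ℝ) s₂)
    (hsmall_one : max (s₁ : ℝ) s₂ * ρ ≤ 1) (hsmall_K : K * (max (s₁ : ℝ) s₂ * ρ) ≤ 1)
    (hsmall_eig : 50 * K * (max (s₁ : ℝ) s₂ * ρ) ≤ C₁)
    (hsmall_pilot : |pilotL1Const C₁ c₀ L Λ| * (max (s₁ : ℝ) s₂ * ρ) < ε / B)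
    (hsmall_proj : |projL1Const C₁ c₀ L B K Λ T| * (max (s₁ : ℝ) s₂ * ρ) ≤ 1)
    (hlam : 2 * K * ρ ≤ lam) (hΛ : lam ≤ Λ * ρ) (hτ : 4 * K * ρ ≤ τ) (hT : τ ≤ T * ρ)
    (hg : |Cg| / κ * infoConst C₁ c₀ L B K Λ T * (max (s₁ : ℝ) √s₂ * ρ) ≤ g)
    (hLg : g ≤ Lg * (max (s₁ : ℝ) √s₂ * ρ)) {β : Param d m}
    (hβ : SelectsArgmin (lassoObjective b r lam o δ) Set.univ β)
    {w : Matrix (Fin d) (Fin m) ℝ}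
    (hw : SelectsArgmin (projectionObjective b r τ o δ β) Set.univ w)
    {G : Matrix (Fin d) (Fin d) ℝ}
    (hG : SelectsArgmin entrywiseL1 (climeFeasible (informationEstimate b r o δ β w) g) G) :
    ∀ G' ∈ ({G, symmetrize G} : Set (Matrix (Fin d) (Fin d) ℝ)), ∀ k,
      |((debiased b o β w G' - target β₀) +
        (information b β₀ P)⁻¹ *ᵥ score b o β₀ (projection b β₀ P)) k| ≤
      bahadurConst C₁ c₀ L B K κ Cg Λ T Lg *
        (ρ * ℓ * (max (s₁ : ℝ) s₂ + max (s₁ : ℝ) √s₂) + s₁ * max (s₁ : ℝ) √s₂ * ρ ^ 2) := by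
  have hc₀ := hb.lower_pos
  have hL := hb.one_le
  have hB0 : 0 ≤ B := by linarith
  set S : ℝ := max (s₁ : ℝ) s₂ with hS
  set t : ℝ := max (s₁ : ℝ) √s₂ with ht
  have ht1 : 1 ≤ t := one_le_max_sqrt hs₁₂
  have hs₁S : (s₁ : ℝ) * ρ ≤ S * ρ := by gcongr; exact le_max_left _ _
  have hs₂S : (s₂ : ℝ) * ρ ≤ S * ρ := by gcongr; exact le_max_right _ _
  have hρS : ρ ≤ S * ρ := le_mul_of_one_le_left hρ.le hs₁₂
  have hΛ0 : 0 ≤ Λ := by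
    by_contra! hneg
    have := mul_neg_of_neg_of_pos hneg hρ
    have : 0 < 2 * K * ρ := by positivity
    linarith
  have hT0 : 0 ≤ T := by
    by_contra! hneg
    have := mul_neg_of_neg_of_pos hneg hρ
    have : 0 < 4 * K * ρ := by positivity
    linarith
  set N := pilotL1Const C₁ c₀ L Λ with hN
  set A := pilotPredConst C₁ c₀ L Λ with hA
  set Nw := projL1Const C₁ c₀ L B K Λ T with hNw
  set D := projPredConst C₁ c₀ L B Λ T with hD
  set I := infoConst C₁ c₀ L B K Λ T with hI
  have hA0 : 0 ≤ A := pilotPredConst_nonneg hb hC₁ Λ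
  have hD0 : 0 ≤ D := projPredConst_nonneg hb hC₁ Λ T
  have hI0 : 0 ≤ I := infoConst_nonneg hb hB0 hK.le Λ T
  have hN0 : 0 ≤ N := by rw [hN, pilotL1Const]; positivity
  have hNw0 : 0 ≤ Nw := by rw [hNw, projL1Const, ← hA]; positivity
  rw [abs_of_nonneg hN0] at hsmall_pilot
  rw [abs_of_nonneg hNw0] at hsmall_proj
  have hpilot_small : N * (s₁ * ρ) < ε / B :=
    (mul_le_mul_of_nonneg_left hs₁S hN0).trans_lt hsmall_pilot
  obtain ⟨hβE, hβN⟩ := hs.pilot_sparse_rates hb h hconv hC₁ hB hK hρ hlam hΛ hs₁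
    ((mul_le_mul_of_nonneg_left hs₁S (by positivity)).trans hsmall_eig) hpilot_small hβ
  have hβε : ∑ j, |(β - β₀) j| ≤ ε / B := hβN.trans hpilot_small.le
  have hproj := fun k => hs.projection_sparse_rates (Λ := Λ) (s₁ := s₁) hb h hC₁ hB hK hρ hτ hT hs₂
    ((mul_le_mul_of_nonneg_left hs₂S (by positivity)).trans hsmall_eig) hβε hβE hw k
  have hwone : ∀ k, ∑ j, |(w k - projection b β₀ P k) j| ≤ 1 :=
    fun k => (hproj k).2.trans hsmall_proj
  have hinfo := hs.information_sparse_rate (Λ := Λ) (T := T) hb hB hC₁ hK hρ hs₁₂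
    ((mul_le_mul_of_nonneg_left hρS hK.le).trans hsmall_K) hβε hβE hwone fun k => (hproj k).1
  have hinv : IsApproxInverse b β₀ P (inverseConst κ Cg I Lg * (t * ρ)) G := by
    have := h.isApproxInverse hb hC₁ hB0 hκ (by positivity) hinfo (by rw [← mul_assoc]; exact hg) hG
    refine ⟨this.row_le, fun k l => (this.close k l).trans ?_⟩
    calc |Cg| / κ * (g + |Cg| / κ * (I * (t * ρ)))
        ≤ |Cg| / κ * (Lg * (t * ρ) + |Cg| / κ * (I * (t * ρ))) := by gcongr
      _ = _ := by unfold inverseConst; ring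
  have htρ : 0 < t * ρ := by positivity
  have hLg0 : 0 ≤ Lg := by
    have h1 : 0 ≤ |Cg| / κ * I * (t * ρ) := by positivity
    exact nonneg_of_mul_nonneg_left (h1.trans (hg.trans hLg)) htρ
  have hZ0 : 0 ≤ inverseConst κ Cg I Lg := by unfold inverseConst; positivity
  have hfull : ∀ {A N s : ℝ}, 0 ≤ N → 0 ≤ s → s * ρ ≤ 1 →
      (L * (A * (s * ρ ^ 2)) + 2 * (K * ρ) * (N * (s * ρ)) ^ 2) / c₀ ≤
        fullPredConst c₀ L K A N * (s * ρ ^ 2) := by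
    intro A N s hN hs0 hs1
    calc (L * (A * (s * ρ ^ 2)) + 2 * (K * ρ) * (N * (s * ρ)) ^ 2) / c₀
        = (L * (A * (s * ρ ^ 2)) + 2 * K * N ^ 2 * (s * ρ ^ 2) * (s * ρ)) / c₀ := by ring
      _ ≤ (L * (A * (s * ρ ^ 2)) + 2 * K * N ^ 2 * (s * ρ ^ 2) * 1) / c₀ := by gcongr
      _ = _ := by unfold fullPredConst; ring
  have hKℓ : K * ℓ ≤ K * ρ := by gcongr
  have hβE' := (hs.prediction_error_le hs' hb hKℓ hβN hβE).trans
    (hfull hN0 (Nat.cast_nonneg _) (hs₁S.trans hsmall_one))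
  have hwD' := fun k => (hs.prediction_error_nuisance_le hs' hb hKℓ (hproj k).2 (hproj k).1).trans
    (hfull hNw0 (by positivity) hsmall_one)
  have hmain : ∀ G', IsApproxInverse b β₀ P (inverseConst κ Cg I Lg * (t * ρ)) G' → ∀ k,
      |((debiased b o β w G' - target β₀) +
        (information b β₀ P)⁻¹ *ᵥ score b o β₀ (projection b β₀ P)) k| ≤
      bahadurConst C₁ c₀ L B K κ Cg Λ T Lg * (ρ * ℓ * (S + t) + s₁ * t * ρ ^ 2) :=
    fun G' hG' k => hs'.abs_remainder_le h hb hC₁ hB hκ hK.le hρ.le hℓ hs₁₂ hN0 hNw0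
      (by unfold fullPredConst; positivity) (by unfold fullPredConst; positivity) hZ0
      hβε hβN hβE' hwone (fun k => (hproj k).2) hwD' hG' k
  rintro G' (rfl | rfl)
  · exact hmain _ hinv
  · exact hmain _ (hinv.symmetrize h hb hC₁ hB0)

theorem bahadurConst_nonneg (hb : LinkBounds b R₁ R₂ ε c₀ L) (hC₁ : 0 < C₁) (hB : 0 ≤ B)
    (hK : 0 ≤ K) (hκ : 0 < κ) {Λ T Lg : ℝ} (hΛ : 0 ≤ Λ) (hT : 0 ≤ T) (hLg : 0 ≤ Lg) :
    0 ≤ bahadurConst C₁ c₀ L B K κ Cg Λ T Lg := by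
  have hc₀ := hb.lower_pos
  have hL := hb.one_le
  have hA0 := pilotPredConst_nonneg hb hC₁ Λ
  have hD0 := projPredConst_nonneg (B := B) hb hC₁ Λ T
  have hI0 := infoConst_nonneg (C₁ := C₁) hb hB hK Λ T
  have hN0 : 0 ≤ pilotL1Const C₁ c₀ L Λ := by unfold pilotL1Const; positivity
  have hNw0 : 0 ≤ projL1Const C₁ c₀ L B K Λ T := by unfold projL1Const; positivity
  unfold bahadurConst remainderConst fullPredConst inverseConst
  positivity

/-- The scaled remainder in the form of the stated rate. -/
theorem sqrt_mul_rate_le {lp r n : ℝ} (hlp : 0 ≤ lp) (hr : 0 < r) (hrn : r ≤ n)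
    (hs₁₂ : (1 : ℝ) ≤ max (s₁ : ℝ) s₂) :
    √n * (√(lp / r) * √(lp / n) * (max (s₁ : ℝ) s₂ + max (s₁ : ℝ) √s₂) +
      s₁ * max (s₁ : ℝ) √s₂ * √(lp / r) ^ 2) ≤
      3 * (√n * s₁ * max (s₁ : ℝ) √s₂ * (lp / r) + s₂ * lp / √r) := by
  have hn : 0 < n := hr.trans_le hrn
  set S : ℝ := max (s₁ : ℝ) s₂ with hS
  set t : ℝ := max (s₁ : ℝ) √s₂ with ht
  have hsq : √(lp / r) ^ 2 = lp / r := Real.sq_sqrt (by positivity)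
  have hprod : √n * (√(lp / r) * √(lp / n)) = lp / √r := by
    rw [Real.sqrt_div hlp, Real.sqrt_div hlp]
    have h1 : √n ≠ 0 := (Real.sqrt_pos.2 hn).ne'
    have h2 : √r ≠ 0 := (Real.sqrt_pos.2 hr).ne'
    field_simp
    rw [Real.sq_sqrt hlp]
  have hSt : S + t ≤ 2 * (s₁ + s₂) := by
    have h1 : S ≤ s₁ + s₂ := max_le (by simp) (by simp)
    have h2 : t ≤ s₁ + s₂ := max_sqrt_le_add
    linarith
  have hs₁ : (s₁ : ℝ) * (lp / √r) ≤ √n * s₁ * t * (lp / r) := by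
    have h1 : lp / √r ≤ √n * (lp / r) := by
      have h2 : √r ≤ √n := Real.sqrt_le_sqrt hrn
      have h3 : √r * √r = r := Real.mul_self_sqrt hr.le
      have h4 : 0 < √r := Real.sqrt_pos.2 hr
      calc lp / √r = √r * (lp / (√r * √r)) := by field_simp
        _ ≤ √n * (lp / r) := by rw [h3]; gcongr
    calc (s₁ : ℝ) * (lp / √r) ≤ (s₁ * t) * (√n * (lp / r)) := by
          gcongr
          exact natCast_le_mul_max hs₁₂
      _ = _ := by ring
  have h5 : lp / √r * (S + t) ≤ lp / √r * (2 * (s₁ + s₂)) := by gcongr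
  have e1 : √n * (√(lp / r) * √(lp / n) * (S + t) + s₁ * t * √(lp / r) ^ 2) =
      lp / √r * (S + t) + √n * s₁ * t * (lp / r) := by
    rw [mul_add, ← mul_assoc, hprod, hsq]; ring
  have e2 : (s₂ : ℝ) * lp / √r = s₂ * (lp / √r) := by ring
  have h6 : 0 ≤ (s₂ : ℝ) * (lp / √r) := by positivity
  rw [e1, e2]
  linarith

/-- The almost sure bounds of the model hold at all observations of the sample. -/
theorem BoundedModel.ae_sample {Ω : Type*} [MeasurableSpace Ω] {μ : Measure Ω}
    {O : Fin n → Ω → Obs d m} {δ : Fin n → Ω → Bool}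
    (h : BoundedModel b C₁ B R₁ R₂ κ Cg L β₀ P) (hO : IsPoissonSubsample μ P r O δ) :
    ∀ᵐ ω ∂μ, ∀ i, (∀ j, |(O i ω).2 j| ≤ B) ∧
      (∀ k, |decorrelated (projection b β₀ P) (O i ω).2 k| ≤ 2 * B) ∧
      β₀ ⬝ᵥ (O i ω).2 ∈ Set.Icc R₁ R₂ := by
  rw [ae_all_iff]
  intro i
  have h1 : ∀ᵐ a ∂(μ.map (O i)), (∀ j, |a.2 j| ≤ B) ∧
      (∀ k, |decorrelated (projection b β₀ P) a.2 k| ≤ 2 * B) ∧ β₀ ⬝ᵥ a.2 ∈ Set.Icc R₁ R₂ := by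
    rw [hO.law_obs i]
    filter_upwards [h.covariates_le, h.decorrelated_le, h.predictor_mem] with a h1 h2 h3
    exact ⟨h1, h2, h3⟩
  exact ae_of_ae_map (hO.measurable_obs i).aemeasurable h1

/-- A sequence of random variables bounded by a multiple of `a n`, except with vanishing
probability, is `O_P(a n)`. -/
theorem isBigOP_of_measure_le {Ω : ℕ → Type*} [∀ n, MeasurableSpace (Ω n)]
    {μ : ∀ n, Measure (Ω n)} {Z : ∀ n, Ω n → ℝ} {a η : ℕ → ℝ} {M : ℝ}
    (hη : Tendsto η atTop (𝓝 0))
    (h : ∀ᶠ n in atTop, μ n {ω | M * |a n| < |Z n ω|} ≤ ENNReal.ofReal (η n)) :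
    IsBigOP μ Z a := by
  intro ε hε
  refine ⟨M, ?_⟩
  filter_upwards [h, hη.eventually (eventually_le_nhds hε)] with n h1 h2
  exact h1.trans (ENNReal.ofReal_le_ofReal h2)

end Assembly

end SubsampledGLM

theorem theorem4
    (b : ℝ → ℝ) (c : ℝ) (hc : 0 < c) (ν : Measure ℝ) [SigmaFinite ν]
    (hν : IsCumulantFunction b c ν)
    (C₁ C₂ C R₁ R₂ κ Cg : ℝ) (hC₁ : 0 < C₁) (hκ : 0 < κ)
    (hb : LinkRegularity b R₁ R₂) :
    -- the tuning parameters have the prescribed orders, with large enough constants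
    ∃ Klam > 0, ∃ Kτ > 0, ∀ Llam Lτ : ℝ, ∃ Kg > 0, ∀ Lg : ℝ,
    -- a sequence of models, indexed by the sample size
    ∀ (d m : ℕ → ℕ) (β₀ : ∀ n, Param (d n) (m n)) (P : ∀ n, Measure (Obs (d n) (m n)))
      [∀ n, IsProbabilityMeasure (P n)]
      (Ω : ℕ → Type*) [∀ n, MeasurableSpace (Ω n)] (μ : ∀ n, Measure (Ω n))
      [∀ n, IsProbabilityMeasure (μ n)]
      (r : ℕ → ℝ) (O : ∀ n, Fin n → Ω n → Obs (d n) (m n)) (δ : ∀ n, Fin n → Ω n → Bool)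
      (p s₁ s₂ ρ : ℕ → ℝ)
      (_ : ∀ n, p n = (d n + m n : ℕ))
      (_ : ∀ n, s₁ n = supportSize (β₀ n))
      (_ : ∀ n, s₂ n = columnSupportSize (projection b (β₀ n) (P n)))
      (_ : ∀ n, ρ n = √(Real.log (p n) / r n))
      (_ : ∀ᶠ n in atTop, IsCanonicalGLM b c ν (β₀ n) (P n))
      (_ : ∀ᶠ n in atTop, PopulationConditions b C₁ C₂ C R₁ R₂ κ Cg (β₀ n) (P n))
      (_ : ∀ᶠ n in atTop, IsPoissonSubsample (μ n) (P n) (r n) (O n) (δ n))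
      (_ : ∀ᶠ n in atTop, 0 < r n ∧ r n ≤ n)
      (_ : Tendsto p atTop atTop)
      (_ : ∀ᶠ n in atTop, 1 ≤ max (s₁ n) (s₂ n))
      (_ : Tendsto (fun n => max (s₁ n) (s₂ n) * √(Real.log (p n) / n)) atTop (𝓝 0))
      (_ : Tendsto (fun n => max (s₁ n) (s₂ n) * ρ n) atTop (𝓝 0))
      -- the tuning parameters
      (lam τ g : ℕ → ℝ)
      (_ : ∀ᶠ n in atTop, Klam * ρ n ≤ lam n ∧ lam n ≤ Llam * ρ n)
      (_ : ∀ᶠ n in atTop, Kτ * ρ n ≤ τ n ∧ τ n ≤ Lτ * ρ n)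
      (_ : ∀ᶠ n in atTop, Kg * (max (s₁ n) √(s₂ n) * ρ n) ≤ g n ∧
        g n ≤ Lg * (max (s₁ n) √(s₂ n) * ρ n))
      -- the estimators
      (βhat : ∀ n, Ω n → Param (d n) (m n))
      (what : ∀ n, Ω n → Matrix (Fin (d n)) (Fin (m n)) ℝ)
      (Ghat : ∀ n, Ω n → Matrix (Fin (d n)) (Fin (d n)) ℝ)
      (_ : ∀ᶠ n in atTop, ∀ᵐ ω ∂μ n, SelectsArgmin
        (lassoObjective b (r n) (lam n) (fun i => O n i ω) (fun i => δ n i ω))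
        Set.univ (βhat n ω))
      (_ : ∀ᶠ n in atTop, ∀ᵐ ω ∂μ n, SelectsArgmin
        (projectionObjective b (r n) (τ n) (fun i => O n i ω) (fun i => δ n i ω) (βhat n ω))
        Set.univ (what n ω))
      (_ : ∀ᶠ n in atTop, ∀ᵐ ω ∂μ n, SelectsArgmin entrywiseL1
        (climeFeasible (informationEstimate b (r n) (fun i => O n i ω) (fun i => δ n i ω)
          (βhat n ω) (what n ω)) (g n))
        (Ghat n ω)),
      -- the uniform Bahadur representation, for the minimiser itself and for its symmetrization
      IsBigOP μ (fun n ω => bahadurRemainder b (β₀ n) (P n) (fun i => O n i ω)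
          (debiased b (fun i => O n i ω) (βhat n ω) (what n ω) (Ghat n ω)))
        (fun n => √(n : ℝ) * s₁ n * max (s₁ n) √(s₂ n) * (Real.log (p n) / r n)
          + s₂ n * Real.log (p n) / √(r n)) ∧
      IsBigOP μ (fun n ω => bahadurRemainder b (β₀ n) (P n) (fun i => O n i ω)
          (debiased b (fun i => O n i ω) (βhat n ω) (what n ω) (symmetrize (Ghat n ω))))
        (fun n => √(n : ℝ) * s₁ n * max (s₁ n) √(s₂ n) * (Real.log (p n) / r n)
          + s₂ n * Real.log (p n) / √(r n)) := by
  obtain ⟨ε, c₀, L, hlb⟩ := hb.exists_linkBounds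
  have hc₀ := hlb.lower_pos
  have hL := hlb.one_le
  set B : ℝ := |C| + 1 with hBdef
  have hB : 1 ≤ B := by rw [hBdef]; linarith [abs_nonneg C]
  have hB0 : 0 < B := by linarith
  set K : ℝ := concentrationConst L B with hKdef
  have hK : 0 < K := by rw [hKdef, concentrationConst]; positivity
  have hconv : ConvexOn ℝ Set.univ b :=
    convexOn_univ_of_deriv2_nonneg hlb.differentiable hlb.differentiable_deriv fun t => by
      rw [← iteratedDeriv_eq_iterate]
      exact hν.iteratedDeriv_two_nonneg hc t
  refine ⟨2 * K, by positivity, 4 * K, by positivity, fun Λ T => ?_⟩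
  have hI0 := infoConst_nonneg (C₁ := C₁) hlb hB0.le hK.le Λ T
  refine ⟨|Cg| / κ * infoConst C₁ c₀ L B K Λ T + 1, by positivity, fun Lg => ?_⟩
  intro d m β₀ P _ Ω _ μ _ r O δ p s₁ s₂ ρ hp hs₁ hs₂ hρ hGLM hpop hsamp hr hptop hs₁₂ hsn hsr
    lam τ g hlam hτ hg βhat what Ghat hβ hw hG
  set M := 3 * bahadurConst C₁ c₀ L B K κ Cg Λ T Lg with hM
  -- the products of sparsity and rate that have to be small all tend to zero
  have hsmall : ∀ A x : ℝ, 0 < x → ∀ᶠ n in atTop, A * (max (s₁ n) (s₂ n) * ρ n) < x := by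
    intro A x hx
    have h1 : Tendsto (fun n => A * (max (s₁ n) (s₂ n) * ρ n)) atTop (𝓝 0) := by
      simpa using hsr.const_mul A
    exact h1.eventually (eventually_lt_nhds hx)
  have hη : Tendsto (fun n => 24 / p n ^ 2) atTop (𝓝 0) :=
    tendsto_const_nhds.div_atTop ((tendsto_pow_atTop (by norm_num)).comp hptop)
  have key : ∀ᶠ n in atTop, μ n {ω | ¬ ∀ G ∈ ({Ghat n ω, symmetrize (Ghat n ω)} : Set _),
      |bahadurRemainder b (β₀ n) (P n) (fun i => O n i ω)
        (debiased b (fun i => O n i ω) (βhat n ω) (what n ω) G)| ≤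
      M * |√(n : ℝ) * s₁ n * max (s₁ n) √(s₂ n) * (Real.log (p n) / r n)
          + s₂ n * Real.log (p n) / √(r n)|} ≤ ENNReal.ofReal (24 / p n ^ 2) := by
    filter_upwards [hGLM, hpop, hsamp, hr, hptop.eventually_ge_atTop 2, hs₁₂, hlam, hτ, hg, hβ, hw,
      hG, eventually_ne_atTop 0, hsmall 1 1 one_pos, hsmall K 1 one_pos, hsmall (50 * K) C₁ hC₁,
      hsmall |pilotL1Const C₁ c₀ L Λ| (ε / B) (div_pos hlb.eps_pos hB0),
      hsmall |projL1Const C₁ c₀ L B K Λ T| 1 one_pos] with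
      n hGLM hpop hsamp hr hp2 hs₁₂ hlam hτ hg hβ hw hG hn sm1 smK smE smP smW
    rw [hs₁ n, hs₂ n] at hs₁₂ sm1 smK smE smP smW hg ⊢
    rw [one_mul] at sm1
    have hmodel := hpop.boundedModel hlb hκ
    have hn0 : (0 : ℝ) < n := by positivity
    have hlog : 0 < Real.log (p n) := Real.log_pos (by linarith)
    have hρ0 : 0 < ρ n := by rw [hρ n]; exact Real.sqrt_pos.2 (div_pos hlog hr.1)
    have hℓρ : √(Real.log (p n) / n) ≤ ρ n := by
      rw [hρ n]
      exact Real.sqrt_le_sqrt (div_le_div_of_nonneg_left hlog.le hr.1 hr.2)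
    have hρ1 : ρ n ≤ 1 := (le_mul_of_one_le_left hρ0.le hs₁₂).trans sm1.le
    have hdm : 1 ≤ d n + m n := by
      have : (1 : ℝ) ≤ (d n + m n : ℕ) := by rw [← hp n]; linarith
      exact_mod_cast this
    have hbad := hmodel.measure_not_concentrated_le hlb hGLM hν hc hC₁ hB hsamp hr.1 hn hdm
      (by rw [← hp n, ← hρ n]; exact hρ1)
    have hbad' := hmodel.measure_not_concentrated_le hlb hGLM hν hc hC₁ hB (hsamp.full hn) hn0 hn
      hdm (by rw [← hp n]; exact hℓρ.trans hρ1)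
    rw [← hp n, ← hρ n] at hbad
    rw [← hp n] at hbad'
    have hae := hmodel.ae_sample hsamp
    have hnull : μ n {ω | ¬ ((∀ i, (∀ j, |(O n i ω).2 j| ≤ B) ∧
        (∀ k, |decorrelated (projection b (β₀ n) (P n)) (O n i ω).2 k| ≤ 2 * B) ∧
        β₀ n ⬝ᵥ (O n i ω).2 ∈ Set.Icc R₁ R₂) ∧ _ ∧ _ ∧ _)} = 0 :=
      ae_iff.1 (hae.and (hβ.and (hw.and hG)))
    refine (measure_mono (fun ω hω => ?_)).trans ((measure_union_le _ _).trans
      ((add_le_add ((measure_union_le _ _).trans (add_le_add hbad hbad')) hnull.le).trans ?_))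
    · by_contra hcon
      simp only [Set.mem_union, Set.mem_ofPred_eq, not_or, not_not] at hcon
      obtain ⟨⟨hc1, hc2⟩, hpt, hβ, hw, hG⟩ := hcon
      refine hω fun G' hG' => ?_
      have hreg : RegularSample b B R₁ R₂ (β₀ n) (P n) (K * ρ n)
          (sampleWeight (r n) fun i => δ n i ω) (fun i => O n i ω) :=
        ⟨hc1, sampleWeight_nonneg hr.1 _, fun i => (hpt i).1, fun i => (hpt i).2.1,
          fun i => (hpt i).2.2⟩
      have hreg' : RegularSample b B R₁ R₂ (β₀ n) (P n) (K * √(Real.log (p n) / n))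
          (sampleWeight (n : ℝ) fun _ : Fin n => true) (fun i => O n i ω) :=
        ⟨hc2, sampleWeight_nonneg hn0 _, fun i => (hpt i).1, fun i => (hpt i).2.1,
          fun i => (hpt i).2.2⟩
      have htρ : 0 ≤ max (supportSize (β₀ n) : ℝ)
          √(columnSupportSize (projection b (β₀ n) (P n))) * ρ n := by positivity
      have hcoord := abs_bahadur_le_of_regularSample hreg hreg' hmodel hlb hconv hC₁ hB hκ hK hρ0
        (Real.sqrt_nonneg _) hℓρ rfl rfl hs₁₂ sm1.le smK.le smE.le smP smW.le hlam.1 hlam.2 hτ.1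
        hτ.2 (le_trans (by linarith) hg.1) hg.2 hβ hw hG G' hG'
      have hΛ0 : 0 ≤ Λ := by
        have : 0 < 2 * K * ρ n := by positivity
        exact nonneg_of_mul_nonneg_left (this.le.trans (hlam.1.trans hlam.2)) hρ0
      have hT0 : 0 ≤ T := by
        have : 0 < 4 * K * ρ n := by positivity
        exact nonneg_of_mul_nonneg_left (this.le.trans (hτ.1.trans hτ.2)) hρ0
      have hLg0 : 0 ≤ Lg := by
        have htpos : 0 < max (supportSize (β₀ n) : ℝ)
            √(columnSupportSize (projection b (β₀ n) (P n))) * ρ n :=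
          mul_pos (by linarith [one_le_max_sqrt hs₁₂]) hρ0
        have : 0 ≤ (|Cg| / κ * infoConst C₁ c₀ L B K Λ T + 1) *
          (max (supportSize (β₀ n) : ℝ)
            √(columnSupportSize (projection b (β₀ n) (P n))) * ρ n) := by positivity
        exact nonneg_of_mul_nonneg_left (this.trans (hg.1.trans hg.2)) htpos
      have hconst := bahadurConst_nonneg (Cg := Cg) hlb hC₁ hB0.le hK.le hκ hΛ0 hT0 hLg0
      have hrate := sqrt_mul_rate_le hlog.le hr.1 hr.2 hs₁₂
      rw [← hρ n] at hrate
      rw [bahadurRemainder, abs_norm, norm_smul, Real.norm_eq_abs, abs_of_nonneg (Real.sqrt_nonneg _)]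
      have hnorm := (pi_norm_le_iff_of_nonneg (mul_nonneg hconst (by positivity))).2 fun k =>
        (Real.norm_eq_abs _).trans_le (hcoord k)
      calc √(n : ℝ) * _ ≤ √(n : ℝ) * _ := mul_le_mul_of_nonneg_left hnorm (Real.sqrt_nonneg _)
        _ = bahadurConst C₁ c₀ L B K κ Cg Λ T Lg * (√(n : ℝ) * _) := by ring
        _ ≤ bahadurConst C₁ c₀ L B K κ Cg Λ T Lg * _ := mul_le_mul_of_nonneg_left hrate hconst
        _ = M * _ := by rw [hM]; ring
        _ ≤ M * |_| := mul_le_mul_of_nonneg_left (le_abs_self _) (by positivity)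
    · rw [add_zero, ← ENNReal.ofReal_add (by positivity) (by positivity)]
      apply ENNReal.ofReal_le_ofReal
      rw [← add_div]; norm_num
  constructor
  · refine isBigOP_of_measure_le (M := M) hη (key.mono fun n hn => (measure_mono fun ω hω hcon => ?_).trans hn)
    exact not_lt.2 (hcon _ (Set.mem_insert _ _)) hω
  · refine isBigOP_of_measure_le (M := M) hη (key.mono fun n hn => (measure_mono fun ω hω hcon => ?_).trans hn)
    exact not_lt.2 (hcon _ (Set.mem_insert_of_mem _ rfl)) hω
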